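/- Let $\tau,\eta\in\mathbb C$ with $\mathrm{Im}\,\tau>0$, $\mathrm{Im}\,\eta>0$, and put $p=e^{2\pi i\tau}$, $q=e^{4\pi i\eta}$, $(t;p)_\infty=\prod_{k\ge0}(1-tp^k)$, $R(\tau)=p^{-1/8}/(i(p;p)_\infty)$ with $p^{-1/8}=e^{-\pi i\tau/4}$, and $$\Gamma(z)=\prod_{j,k\ge 0}\frac{1-e^{-2\pi iz}p^{j+1}q^{k+1}}{1-e^{2\pi iz}p^jq^k}.$$ Let $\theta_1(z|\tau)=-\sum_{n\in\mathbb Z}e^{\pi i(n+\frac12)^2\tau}e^{2\pi i(n+\frac12)(z+\frac12)}$, $\theta_2(z|\tau)=\theta_1(z+\frac12|\tau)$, $\theta_3(z|\tau)=e^{\pi i\tau/4+\pi iz}\theta_2(z+\frac\tau2|\tau)$, $\theta_4(z|\tau)=\theta_3(z+\frac12|\tau)$. A test function is an entire function $\Phi$ with $\Phi(z+1)=\Phi(z)$. For $\mathrm{Im}(-g\pm z)>0$ (and $\Gamma(-2g)\ne0$) the intertwining operator is $$[\mathrm M(g)\Phi](z)=\frac{(q;q)_\infty(p;p)_\infty}{2}\int_0^1\frac{\Gamma(z+x-g)\Gamma(z-x-g)\Gamma(-z+x-g)\Gamma(-z-x-g)}{\Gamma(-2g)\Gamma(2x)\Gamma(-2x)}\Phi(x)\,dx,$$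 and for other $g\in\mathbb C$ it is defined by meromorphic continuation in $g$ at fixed $z$ (removable singularities filled in, value $0$ at a pole). Let $P=e^{\frac12\partial_z}$, $(P\Phi)(z)=\Phi(z+\frac12)$. For $k\in\{3,4\}$ let $$\mathrm A_k(g)=e^{\pi iz^2/\eta}\frac{e^{\pi i\eta}}{R(\tau)\theta_1(2z|\tau)}\Big[\theta_k(z+g+\eta|\tfrac\tau2)e^{\eta\partial_z}-\theta_k(z-g-\eta|\tfrac\tau2)e^{-\eta\partial_z}\Big]e^{-\pi iz^2/\eta},$$ let $\mathrm B_k(g)$ be obtained from $\mathrm A_k(g)$ by exchanging $2\eta$ and $\tau$, and let $$\mathrm M^{(k)}(n\eta+m\tfrac\tau2)=\mathrm A_k((n-1)\eta+m\tfrac\tau2)\cdots\mathrm A_k(m\tfrac\tau2)\,\mathrm B_k((m-1)\tfrac\tau2)\cdots\mathrm B_k(0)\,\theta_k^{-m}(z|\eta)\,\theta_k^{-n}(z|\tfrac\tau2),$$ $$\mathrm M^{(k)}(n\eta+m\tfrac\tau2+\tfrac12)=\mathrm A_k((n-1)\eta+m\tfrac\tau2+\tfrac12)\cdots\mathrm A_k(m\tfrac\tau2+\tfrac12)\,\mathrm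 B_k((m-1)\tfrac\tau2+\tfrac12)\cdots\mathrm B_k(\tfrac12)\,\theta_k^{-m}(z+\tfrac12|\eta)\,\theta_k^{-n}(z+\tfrac12|\tfrac\tau2)\,P .$$ Then: 1. For every test function $\Phi$ and every $z\in\mathbb C$ the meromorphic continuation in $g$ to all of $\mathbb C$ exists and is unique. 2. For every even test function $\Phi$ and all $z$ outside a closed discrete set, $g\mapsto[\mathrm M(g)\Phi](z)$ is analytic at $g=\frac12$ and $\mathrm M(\frac12)\Phi=P\Phi$ at $z$. 3. For all $g\in\mathbb C$, as operators on functions of $z$: $\mathrm A_{3,4}(g+\frac12)=\mathrm A_{4,3}(g)$ and $\mathrm B_{3,4}(g+\frac12)=\mathrm B_{4,3}(g)$. Moreover, for all integers $n,m\ge0$: 4. $\mathrm M(n\eta+m\frac\tau2+\frac12)\Phi=\mathrm M(n\eta+m\frac\tau2)P\Phi$ for every test function $\Phi$. 5. $\mathrm M^{(3,4)}(n\eta+m\frac\tau2+\frac12)=\mathrm M^{(4,3)}(n\eta+m\frac\tau2)P$, as operators on functions of $z$. 6. $\mathrm M^{(k)}(n\eta+m\frac\tau2+\frac12)=\mathrm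 M^{(k)}(n\eta+m\frac\tau2)P$ for $k=3,4$ (the operators do not depend on $k$): for every function $\Phi$ both sides applied to $\Phi$ agree at all $z$ outside a closed discrete set. 7. Suppose that $1,2\eta,\tau$ are linearly independent over $\mathbb Q$. Then for every test function $\Phi$ and all $z$ outside a closed discrete set, $g\mapsto[\mathrm M(g)\Phi](z)$ is analytic at $g=n\eta+m\frac\tau2$ and at $g=n\eta+m\frac\tau2+\frac12$. If moreover $\Phi$ is even, then its values at these two points are $[\mathrm M^{(k)}(n\eta+m\frac\tau2)\Phi](z)$ and $[\mathrm M^{(k)}(n\eta+m\frac\tau2+\frac12)\Phi](z)$, for $k=3$ and for $k=4$. -/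

import Mathlib

open scoped Real Topology

noncomputable section

namespace EllipticDouble

/-! ### Jacobi theta functions -/

/-- `θ₁(z|τ)`. -/
def theta1 (z τ : ℂ) : ℂ :=
  -∑' n : ℤ, Complex.exp (π * Complex.I * ((n : ℂ) + 1 / 2) ^ 2 * τ) *
    Complex.exp (2 * π * Complex.I * ((n : ℂ) + 1 / 2) * (z + 1 / 2))

/-- `θ₂(z|τ)`. -/
def theta2 (z τ : ℂ) : ℂ := theta1 (z + 1 / 2) τ

/-- `θ₃(z|τ)`. -/
def theta3 (z τ : ℂ) : ℂ :=
  Complex.exp (π * Complex.I * τ / 4 + π * Complex.I * z) * theta2 (z + τ / 2) τ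

/-- `θ₄(z|τ)`. -/
def theta4 (z τ : ℂ) : ℂ := theta3 (z + 1 / 2) τ

/-- The index `k ∈ {3, 4}`. -/
inductive ThetaIndex : Type
  | three : ThetaIndex
  | four : ThetaIndex

/-- The exchange of `3` and `4`. -/
def ThetaIndex.swap : ThetaIndex → ThetaIndex
  | .three => .four
  | .four => .three

/-- `θ_k(z|τ)` for `k ∈ {3, 4}`. -/
def theta : ThetaIndex → ℂ → ℂ → ℂ
  | .three => theta3
  | .four => theta4

/-! ### q-products and the elliptic gamma function -/

/-- `(t;p)_∞ = ∏_{k ≥ 0} (1 - t p^k)`. -/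
def qPoch (t p : ℂ) : ℂ := ∏' k : ℕ, (1 - t * p ^ k)

/-- The base `e^{2πiτ}` attached to `τ`; so `p = base τ` and `q = base (2η)`. -/
def base (τ : ℂ) : ℂ := Complex.exp (2 * π * Complex.I * τ)

/-- The constant `R(τ) = p^{-1/8} / (i (p;p)_∞)`, `p = e^{2πiτ}`. -/
def constR (τ : ℂ) : ℂ :=
  Complex.exp (-(π * Complex.I * τ / 4)) / (Complex.I * qPoch (base τ) (base τ))

/-- The elliptic gamma function `Γ(z) = Γ(z|τ,2η)`. At a pole one of the factors has the value
`0` in Lean, so that `1 / Γ` has its correct value `0` there. -/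
def ellGamma (τ η z : ℂ) : ℂ :=
  ∏' nm : ℕ × ℕ,
    (1 - Complex.exp (-(2 * π * Complex.I * z)) *
        base τ ^ (nm.1 + 1) * base (2 * η) ^ (nm.2 + 1)) /
      (1 - Complex.exp (2 * π * Complex.I * z) * base τ ^ nm.1 * base (2 * η) ^ nm.2)

/-! ### The intertwining operator -/

/-- The integral
`(q;q)_∞ (p;p)_∞ / 2 · ∫₀¹ Γ(±z ± x - g) / Γ(-2g, ±2x) · Φ(x) dx`,
which converges for `Im(-g ± z) > 0`. -/
def intertwinerIntegral (τ η g : ℂ) (Φ : ℂ → ℂ) (z : ℂ) : ℂ :=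
  qPoch (base (2 * η)) (base (2 * η)) * qPoch (base τ) (base τ) / 2 *
    ∫ x in (0 : ℝ)..1,
      ellGamma τ η (z + x - g) * ellGamma τ η (z - x - g) *
        ellGamma τ η (-z + x - g) * ellGamma τ η (-z - x - g) /
      (ellGamma τ η (-2 * g) * ellGamma τ η (2 * x) * ellGamma τ η (-2 * x)) * Φ x

/-- `F` is the meromorphic continuation, in the spin `g ∈ ℂ`, of the integral
`intertwinerIntegral τ η g Φ z`, which defines the operator for `Im(-g ± z) > 0`
(where `Γ(-2g) = 0` the integral has a zero denominator). Normal form means: removable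
singularities are filled in, and the value at a pole is `0`. -/
def IsSpinContinuation (τ η : ℂ) (Φ : ℂ → ℂ) (z : ℂ) (F : ℂ → ℂ) : Prop :=
  MeromorphicNFOn F Set.univ ∧
    ∀ g : ℂ, 0 < (-g + z).im → 0 < (-g - z).im → ellGamma τ η (-2 * g) ≠ 0 →
      F g = intertwinerIntegral τ η g Φ z

open Classical in
/-- The intertwining operator: `intertwiner τ η g Φ z` is `[M(g)Φ](z)`, the integral where it
converges and its meromorphic continuation in `g` elsewhere. -/
def intertwiner (τ η g : ℂ) (Φ : ℂ → ℂ) (z : ℂ) : ℂ :=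
  if h : ∃ F : ℂ → ℂ, IsSpinContinuation τ η Φ z F then h.choose g else 0

/-- The half-period shift `P = e^{∂_z/2}`. -/
def halfShift (Φ : ℂ → ℂ) : ℂ → ℂ := fun z => Φ (z + 1 / 2)

/-- Holomorphic functions of `e^{2πiz}` on `ℂ \ {0}`: entire functions of `z` with period `1`. -/
def IsTestFunction (Φ : ℂ → ℂ) : Prop :=
  Differentiable ℂ Φ ∧ ∀ z, Φ (z + 1) = Φ z

/-! ### The difference operators -/

/-- The operator `A_k(g)`. -/
def opA (τ η : ℂ) (k : ThetaIndex) (g : ℂ) (Φ : ℂ → ℂ) : ℂ → ℂ := fun z =>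
  Complex.exp (π * Complex.I * z ^ 2 / η) *
    (Complex.exp (π * Complex.I * η) / constR τ / theta1 (2 * z) τ) *
    (theta k (z + g + η) (τ / 2) *
        (Complex.exp (-(π * Complex.I * (z + η) ^ 2 / η)) * Φ (z + η)) -
      theta k (z - g - η) (τ / 2) *
        (Complex.exp (-(π * Complex.I * (z - η) ^ 2 / η)) * Φ (z - η)))

/-- The operator `B_k(g)`. -/
def opB (τ η : ℂ) (k : ThetaIndex) (g : ℂ) (Φ : ℂ → ℂ) : ℂ → ℂ := fun z =>
  Complex.exp (2 * π * Complex.I * z ^ 2 / τ) *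
    (Complex.exp (π * Complex.I * (τ / 2)) / constR (2 * η) / theta1 (2 * z) (2 * η)) *
    (theta k (z + g + τ / 2) η *
        (Complex.exp (-(2 * π * Complex.I * (z + τ / 2) ^ 2 / τ)) * Φ (z + τ / 2)) -
      theta k (z - g - τ / 2) η *
        (Complex.exp (-(2 * π * Complex.I * (z - τ / 2) ^ 2 / τ)) * Φ (z - τ / 2)))

/-- `A_k(s + (n-1)η) ⋯ A_k(s + η) A_k(s)`. -/
def prodA (τ η : ℂ) (k : ThetaIndex) (s : ℂ) : ℕ → (ℂ → ℂ) → ℂ → ℂ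
  | 0, Φ => Φ
  | n + 1, Φ => opA τ η k (s + n * η) (prodA τ η k s n Φ)

/-- `B_k(s + (m-1)τ/2) ⋯ B_k(s + τ/2) B_k(s)`. -/
def prodB (τ η : ℂ) (k : ThetaIndex) (s : ℂ) : ℕ → (ℂ → ℂ) → ℂ → ℂ
  | 0, Φ => Φ
  | m + 1, Φ => opB τ η k (s + m * (τ / 2)) (prodB τ η k s m Φ)

/-- The factored difference operator `M^{(k)}(nη + mτ/2)`. -/
def factoredM (τ η : ℂ) (k : ThetaIndex) (n m : ℕ) (Φ : ℂ → ℂ) : ℂ → ℂ :=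
  prodA τ η k (m * (τ / 2)) n
    (prodB τ η k 0 m
      (fun z => (theta k z η ^ m)⁻¹ * (theta k z (τ / 2) ^ n)⁻¹ * Φ z))

/-- The factored difference operator `M^{(k)}(nη + mτ/2 + 1/2)`. -/
def factoredMHalf (τ η : ℂ) (k : ThetaIndex) (n m : ℕ) (Φ : ℂ → ℂ) : ℂ → ℂ :=
  prodA τ η k (m * (τ / 2) + 1 / 2) n
    (prodB τ η k (1 / 2) m
      (fun z => (theta k (z + 1 / 2) η ^ m)⁻¹ * (theta k (z + 1 / 2) (τ / 2) ^ n)⁻¹ *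
        halfShift Φ z))

end EllipticDouble

end

open EllipticDouble

noncomputable section

namespace EllipticDouble

open Filter

/-! On the domain of convergence the integrand has two families of poles in x, at g − a_i below the
real line and at a_i − g above it, where a_i = ±z + jτ + 2kη. For Im g < C only finitely many of
them can reach the contour. Partial fractions in e^{2πix} separate the families, because for one
pole of each kind the product of the two exponentials, e^{2πi(a_i + a_j − 2g)}, is free of x. Once a
single family is left, the contour moves away from it. Hence the integral continues meromorphically,
with singularities only where opposite poles pinch the contour (`poleIntegral_step`,
`exists_meromorphic_poleIntegral`). Uniqueness is the identity theorem together with the normal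
form.

Let 2g₀ = mτ + 2nη, with no other lattice vector congruent to it modulo 1. For generic z the
pinching occurs in disjoint pairs, so the integral has at most a simple pole at g₀, which the zero
of 1/Γ(−2g) cancels. What survives is a combination of residues: for even Φ the value [M(g₀)Φ](z)
depends only on Φ at the finitely many points z + αη + βτ/2 (`exists_pinch_poleIntegral`,
`intertwiner_regular_and_local`). At g = 0 the residues are found by comparison with an explicit
integral and give M(0) = 1 on even functions (`intertwiner_zero`).

The functional equation of Γ, the Jacobi triple product and a three-term theta identity give M(g +
η)θ_k = A_k(g)M(g), first under the integral sign and then by continuation (`intertwiner_add_eta`).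
Climbing from M(0) = 1 requires dividing Φ by θ_k. The quotient need not be entire, but by locality
an even test function interpolating it at the relevant points serves as well
(`exists_even_testFunction`, `IsFactored.succ`). The factors B_k come from the exchange of 2η and τ,
under which M is symmetric (`isFactored`).

Half periods: since Γ and Φ have period 1, the substitution x → x + 1/2 gives M(g + 1/2) = M(g)P,
while θ_k(z + 1/2) exchanges θ₃ and θ₄ in the difference operators. For incommensurate periods the
factored operators for k = 3 and k = 4 both represent M, hence agree. The other η form a countable
set and are reached by density and continuity (`factoredM_eq`). -/

/-- `ee u = e^{2πiu}`. -/
def ee (u : ℂ) : ℂ := Complex.exp (2 * π * Complex.I * u)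

lemma ee_zero : ee 0 = 1 := by simp [ee]

lemma ee_add (u v : ℂ) : ee (u + v) = ee u * ee v := by
  rw [ee, ee, ee, ← Complex.exp_add]; ring_nf

lemma ee_neg (u : ℂ) : ee (-u) = (ee u)⁻¹ := by
  rw [ee, ee, ← Complex.exp_neg]; ring_nf

lemma ee_sub (u v : ℂ) : ee (u - v) = ee u / ee v := by
  rw [sub_eq_add_neg, ee_add, ee_neg, div_eq_mul_inv]

lemma ee_ne_zero (u : ℂ) : ee u ≠ 0 := Complex.exp_ne_zero _

lemma ee_nat_mul (n : ℕ) (u : ℂ) : ee (n * u) = ee u ^ n := by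
  rw [ee, ee, ← Complex.exp_nat_mul]; ring_nf

lemma ee_one : ee 1 = 1 := by
  rw [ee, mul_one, Complex.exp_two_pi_mul_I]

lemma ee_add_one (u : ℂ) : ee (u + 1) = ee u := by rw [ee_add, ee_one, mul_one]

lemma ee_eq_one_iff (u : ℂ) : ee u = 1 ↔ ∃ n : ℤ, u = n := by
  rw [ee, Complex.exp_eq_one_iff]
  refine exists_congr fun n => ⟨fun h => ?_, fun h => by rw [h]; ring⟩
  have : (2 * π * Complex.I : ℂ) ≠ 0 := Complex.two_pi_I_ne_zero
  apply mul_left_cancel₀ this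
  rw [h]; ring

lemma norm_ee (u : ℂ) : ‖ee u‖ = Real.exp (-(2 * π * u.im)) := by
  rw [ee, Complex.norm_exp]
  congr 1
  simp [Complex.mul_re, Complex.mul_im]

lemma norm_ee_lt_one {u : ℂ} (hu : 0 < u.im) : ‖ee u‖ < 1 := by
  rw [norm_ee, Real.exp_lt_one_iff]
  have := Real.pi_pos
  nlinarith [mul_pos this hu]

lemma one_sub_ee_ne_zero {u : ℂ} (hu : u.im ≠ 0) : 1 - ee u ≠ 0 := by
  intro h
  obtain ⟨n, rfl⟩ := (ee_eq_one_iff u).1 (sub_eq_zero.1 h).symm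
  simp at hu

lemma differentiable_ee : Differentiable ℂ ee := by unfold ee; fun_prop

lemma hasDerivAt_ee (u : ℂ) : HasDerivAt ee (2 * π * Complex.I * ee u) u := by
  have := ((hasDerivAt_id u).const_mul (2 * π * Complex.I)).cexp
  refine this.congr_deriv ?_
  simp [ee, mul_comm]

lemma base_eq_ee (τ : ℂ) : base τ = ee τ := rfl

/-! ### Infinite products -/

lemma summable_norm_geometric (t : ℂ) {p : ℂ} (hp : ‖p‖ < 1) :
    Summable fun k : ℕ => ‖-(t * p ^ k)‖ := by
  simpa using (summable_geometric_of_lt_one (norm_nonneg _) hp).mul_left ‖t‖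

lemma multipliable_qPoch (t : ℂ) {p : ℂ} (hp : ‖p‖ < 1) :
    Multipliable fun k : ℕ => 1 - t * p ^ k := by
  simpa [sub_eq_add_neg] using multipliable_one_add_of_summable (summable_norm_geometric t hp)

lemma tendsto_qPoch (t : ℂ) {p : ℂ} (hp : ‖p‖ < 1) :
    Tendsto (fun n : ℕ => ∏ k ∈ Finset.range n, (1 - t * p ^ k)) atTop (𝓝 (qPoch t p)) :=
  (multipliable_qPoch t hp).hasProd.tendsto_prod_nat

lemma qPoch_eq_mul (t : ℂ) {p : ℂ} (hp : ‖p‖ < 1) : qPoch t p = (1 - t) * qPoch (t * p) p := by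
  have h1 := (tendsto_qPoch t hp).comp (tendsto_add_atTop_nat 1)
  have h2 := (tendsto_qPoch (t * p) hp).const_mul (1 - t)
  refine tendsto_nhds_unique h1 (h2.congr fun n => ?_)
  simp only [Function.comp, Finset.prod_range_succ']
  rw [pow_zero, mul_one, mul_comm]
  congr 1
  exact Finset.prod_congr rfl fun k _ => by ring

lemma qPoch_ne_zero {t p : ℂ} (hp : ‖p‖ < 1) (h : ∀ k : ℕ, t * p ^ k ≠ 1) : qPoch t p ≠ 0 := by
  have := tprod_one_add_ne_zero_of_summable (f := fun k : ℕ => -(t * p ^ k))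
    (fun k hk => h k (by linear_combination -hk)) (summable_norm_geometric t hp)
  simpa [qPoch, sub_eq_add_neg] using this

lemma qPoch_self_ne_zero {p : ℂ} (hp : ‖p‖ < 1) : qPoch p p ≠ 0 := by
  refine qPoch_ne_zero hp fun k hk => ?_
  have : ‖p ^ (k + 1)‖ < 1 := by
    rw [norm_pow]; exact pow_lt_one₀ (norm_nonneg _) hp (by omega)
  rw [pow_succ', hk] at this
  simp at this

lemma differentiable_qPoch_left {p : ℂ} (hp : ‖p‖ < 1) : Differentiable ℂ fun t => qPoch t p := by
  intro t
  have hu := (summable_geometric_of_lt_one (norm_nonneg _) hp).mul_left (‖t‖ + 1)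
  have := Summable.hasProdLocallyUniformlyOn_one_add (K := Metric.ball t 1)
    (f := fun (k : ℕ) (t : ℂ) => -(t * p ^ k)) Metric.isOpen_ball hu
    (Eventually.of_forall fun k x hx => by
      rw [norm_neg, norm_mul, norm_pow]
      gcongr
      have := norm_sub_norm_le x t
      rw [Metric.mem_ball, dist_eq_norm] at hx
      linarith) (fun k => by fun_prop)
  have h2 := this.differentiableOn (.of_forall fun s => by
    simpa [Finset.prod_fn] using DifferentiableOn.finsetProd (fun _ _ => by fun_prop))
    Metric.isOpen_ball
  have h3 := (h2 t (Metric.mem_ball_self one_pos)).differentiableAt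
    (Metric.isOpen_ball.mem_nhds (Metric.mem_ball_self one_pos))
  simpa [qPoch, sub_eq_add_neg] using h3

/-! ### The Jacobi triple product -/

/-- `(p;p)_n`. -/
def finPoch (p : ℂ) (n : ℕ) : ℂ := ∏ k ∈ Finset.range n, (1 - p ^ (k + 1))

lemma finPoch_succ (p : ℂ) (n : ℕ) : finPoch p (n + 1) = finPoch p n * (1 - p ^ (n + 1)) := by
  rw [finPoch, Finset.prod_range_succ]; rfl

lemma one_sub_pow_ne_zero {p : ℂ} (hp : ‖p‖ < 1) (k : ℕ) : 1 - p ^ (k + 1) ≠ 0 := by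
  intro h
  have : ‖p ^ (k + 1)‖ < 1 := by
    rw [norm_pow]; exact pow_lt_one₀ (norm_nonneg _) hp (by omega)
  rw [← sub_eq_zero.1 h] at this
  simp at this

lemma finPoch_ne_zero {p : ℂ} (hp : ‖p‖ < 1) (n : ℕ) : finPoch p n ≠ 0 :=
  Finset.prod_ne_zero_iff.2 fun k _ => one_sub_pow_ne_zero hp k

lemma tendsto_finPoch {p : ℂ} (hp : ‖p‖ < 1) :
    Tendsto (finPoch p) atTop (𝓝 (qPoch p p)) :=
  (tendsto_qPoch p hp).congr fun n => Finset.prod_congr rfl fun k _ => by rw [pow_succ']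

/-- The finite `q`-binomial theorem. -/
lemma prod_one_add_eq_sum {q : ℂ} (hq : ‖q‖ < 1) (x : ℂ) (M : ℕ) :
    ∑ ij ∈ Finset.HasAntidiagonal.antidiagonal M,
      q ^ (ij.2.choose 2) * x ^ ij.2 / (finPoch q ij.1 * finPoch q ij.2) =
      (∏ k ∈ Finset.range M, (1 + x * q ^ k)) / finPoch q M := by
  induction M with
  | zero => simp [finPoch]
  | succ M ih =>
    set S := fun M => ∑ ij ∈ Finset.HasAntidiagonal.antidiagonal M,
      q ^ (ij.2.choose 2) * x ^ ij.2 / (finPoch q ij.1 * finPoch q ij.2) with hS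
    -- With i + j = M + 1, split 1 − q^(M+1) = (1 − q^i) + q^i(1 − q^j). The first part lowers i,
    -- the second lowers j, and each returns a multiple of `S M`.
    have key : (1 - q ^ (M + 1)) * S (M + 1) = (1 + x * q ^ M) * S M := by
      have h1 : ∑ ij ∈ Finset.HasAntidiagonal.antidiagonal (M + 1), (1 - q ^ ij.1) *
          (q ^ (ij.2.choose 2) * x ^ ij.2 / (finPoch q ij.1 * finPoch q ij.2)) = S M := by
        rw [Finset.Nat.sum_antidiagonal_succ]
        simp only [pow_zero, sub_self, zero_mul, zero_add]
        refine Finset.sum_congr rfl fun ij _ => ?_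
        rw [finPoch_succ]
        have := one_sub_pow_ne_zero hq ij.1
        have := finPoch_ne_zero hq ij.1
        have := finPoch_ne_zero hq ij.2
        field_simp
      have h2 : ∑ ij ∈ Finset.HasAntidiagonal.antidiagonal (M + 1), q ^ ij.1 * (1 - q ^ ij.2) *
          (q ^ (ij.2.choose 2) * x ^ ij.2 / (finPoch q ij.1 * finPoch q ij.2)) =
          x * q ^ M * S M := by
        rw [Finset.Nat.sum_antidiagonal_succ']
        simp only [pow_zero, sub_self, zero_mul, mul_zero, zero_add]
        rw [hS, Finset.mul_sum]
        refine Finset.sum_congr rfl fun ij hij => ?_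
        rw [finPoch_succ, Nat.choose_succ_succ' ij.2 1, Nat.choose_one_right,
          ← Finset.HasAntidiagonal.mem_antidiagonal.1 hij]
        have := one_sub_pow_ne_zero hq ij.2
        have := finPoch_ne_zero hq ij.1
        have := finPoch_ne_zero hq ij.2
        field_simp
        ring
      rw [add_mul, one_mul, ← h2, ← h1, ← Finset.sum_add_distrib, hS, Finset.mul_sum]
      refine Finset.sum_congr rfl fun ij hij => ?_
      rw [← Finset.HasAntidiagonal.mem_antidiagonal.1 hij, pow_add]
      ring
    have h3 := one_sub_pow_ne_zero hq M
    have h4 := finPoch_ne_zero hq M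
    change S (M + 1) = _
    change S M = _ at ih
    rw [ih] at key
    rw [finPoch_succ, Finset.prod_range_succ]
    apply mul_left_cancel₀ h3
    rw [key]
    field_simp

lemma ee_half : ee (1 / 2) = -1 := by
  rw [ee, ← Complex.exp_pi_mul_I]; ring_nf

/-- Each factor is turned over by 1 − w = −w(1 − w⁻¹); the monomials −w, with −1 = e^{πi}, collect
in the prefactor. -/
lemma prod_one_sub_ee_neg (u τ : ℂ) (N : ℕ) :
    ∏ k ∈ Finset.range N, (1 - ee (u - (k + 1) * τ)) =
      ee (N * (u + 1 / 2) - N * (N + 1) / 2 * τ) *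
        ∏ k ∈ Finset.range N, (1 - ee ((k + 1) * τ - u)) := by
  induction N with
  | zero => simp [ee_zero]
  | succ N ih =>
    rw [Finset.prod_range_succ, Finset.prod_range_succ, ih]
    have h1 : ee (((N + 1 : ℕ) : ℂ) * (u + 1 / 2) - (N + 1 : ℕ) * ((N + 1 : ℕ) + 1) / 2 * τ) =
        ee (N * (u + 1 / 2) - N * (N + 1) / 2 * τ) * (-ee (u - (N + 1) * τ)) := by
      rw [neg_eq_neg_one_mul, ← ee_half, ← ee_add, ← ee_add]
      congr 1; push_cast; ring
    have h2 : (-ee (u - (N + 1) * τ)) * (1 - ee ((N + 1) * τ - u)) =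
        1 - ee (u - (N + 1) * τ) := by
      have : ee (u - (N + 1) * τ) * ee ((N + 1) * τ - u) = 1 := by
        rw [← ee_add, ← ee_zero]; congr 1; ring
      linear_combination this
    rw [h1, ← h2]
    ring

/-- This is the q-binomial theorem with 2N factors, recentred: starting the progression at u − Nτ
puts N factors on each side, and the monomial `c` from turning over the left half also completes the
square in the summands. -/
lemma finite_triple_product {τ : ℂ} (hτ : 0 < τ.im) (u : ℂ) (N : ℕ) :
    ∑ n ∈ Finset.Icc (-N : ℤ) N, jacobiTheta₂_term n (u + 1 / 2 - τ / 2) τ /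
        (finPoch (ee τ) (N - n).toNat * finPoch (ee τ) (N + n).toNat) =
      (∏ k ∈ Finset.range N, (1 - ee u * ee τ ^ k)) *
        (∏ k ∈ Finset.range N, (1 - ee (τ - u) * ee τ ^ k)) / finPoch (ee τ) (2 * N) := by
  have h := prod_one_add_eq_sum (norm_ee_lt_one hτ) (ee (u + 1 / 2 - N * τ)) (2 * N)
  have hc := ee_ne_zero (N * (u + 1 / 2) - N * (N + 1) / 2 * τ)
  set c := ee (N * (u + 1 / 2) - N * (N + 1) / 2 * τ)
  have hprod : ∏ k ∈ Finset.range (2 * N), (1 + ee (u + 1 / 2 - N * τ) * ee τ ^ k) =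
      c * ((∏ k ∈ Finset.range N, (1 - ee u * ee τ ^ k)) *
        (∏ k ∈ Finset.range N, (1 - ee (τ - u) * ee τ ^ k))) := by
    rw [two_mul, Finset.prod_range_add]
    have e1 : ∏ k ∈ Finset.range N, (1 + ee (u + 1 / 2 - N * τ) * ee τ ^ k) =
        ∏ k ∈ Finset.range N, (1 - ee (u - (k + 1) * τ)) := by
      rw [← Finset.prod_range_reflect]
      refine Finset.prod_congr rfl fun k hk => ?_
      have hk' := Finset.mem_range.1 hk
      rw [← ee_nat_mul, Nat.cast_sub (by omega), Nat.cast_sub (by omega), ← ee_add,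
        sub_eq_add_neg 1, neg_eq_neg_one_mul, ← ee_half, ← ee_add]
      congr 2; push_cast; ring
    have e2 : ∏ k ∈ Finset.range N, (1 + ee (u + 1 / 2 - N * τ) * ee τ ^ (N + k)) =
        ∏ k ∈ Finset.range N, (1 - ee u * ee τ ^ k) := by
      refine Finset.prod_congr rfl fun k _ => ?_
      rw [← ee_nat_mul, ← ee_nat_mul, ← ee_add, ← ee_add, sub_eq_add_neg 1, neg_eq_neg_one_mul,
        ← ee_half, ← ee_add]
      congr 2; push_cast; ring
    have e3 : ∏ k ∈ Finset.range N, (1 - ee ((k + 1) * τ - u)) =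
        ∏ k ∈ Finset.range N, (1 - ee (τ - u) * ee τ ^ k) := by
      refine Finset.prod_congr rfl fun k _ => ?_
      rw [← ee_nat_mul, ← ee_add]
      congr 2; ring
    rw [e1, prod_one_sub_ee_neg, e2, e3]
    ring
  rw [hprod] at h
  apply mul_left_cancel₀ hc
  rw [← mul_div_assoc, ← h, Finset.Nat.sum_antidiagonal_eq_sum_range_succ_mk, Finset.mul_sum]
  refine Finset.sum_nbij' (fun n => (N - n).toNat) (fun j => (N : ℤ) - j) ?_ ?_ ?_ ?_ ?_
  · intro n hn; simp only [Finset.mem_Icc, Finset.mem_range] at *; omega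
  · intro n hn; simp only [Finset.mem_Icc, Finset.mem_range] at *; omega
  · intro n hn; simp only [Finset.mem_Icc] at *; omega
  · intro n hn; simp only [Finset.mem_range] at *; omega
  · intro n hn
    obtain ⟨h1, h2⟩ := Finset.mem_Icc.1 hn
    obtain ⟨j, hj⟩ : ∃ j : ℕ, (j : ℤ) = N + n := ⟨(N + n).toNat, by omega⟩
    have hn' : n = (j : ℤ) - N := by omega
    have hj1 : (N + n).toNat = j := by omega
    have hj2 : 2 * N - (N - n).toNat = j := by omega
    simp only [hj1, hj2]
    rw [mul_div_assoc', ← ee_nat_mul, ← ee_nat_mul, ← ee_add, Nat.cast_choose_two]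
    congr 1
    rw [hn', jacobiTheta₂_term]
    simp only [c, ee]
    rw [← Complex.exp_add]
    congr 1; push_cast; ring

/-- The **Jacobi triple product**. -/
theorem jacobi_triple_product {τ : ℂ} (hτ : 0 < τ.im) (u : ℂ) :
    jacobiTheta₂ (u + 1 / 2 - τ / 2) τ =
      qPoch (ee u) (ee τ) * qPoch (ee (τ - u)) (ee τ) * qPoch (ee τ) (ee τ) := by
  have hp := norm_ee_lt_one hτ
  have hQ := tendsto_finPoch hp
  have hQ0 := qPoch_self_ne_zero hp
  set p := ee τ
  set Q := qPoch p p
  set T := fun n : ℤ => jacobiTheta₂_term n (u + 1 / 2 - τ / 2) τ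
  have hT : HasSum T _ := hasSum_jacobiTheta₂_term _ hτ
  have hR : Tendsto (fun N : ℕ => (∏ k ∈ Finset.range N, (1 - ee u * p ^ k)) *
      (∏ k ∈ Finset.range N, (1 - ee (τ - u) * p ^ k)) / finPoch p (2 * N)) atTop
      (𝓝 (qPoch (ee u) p * qPoch (ee (τ - u)) p / Q)) :=
    ((tendsto_qPoch _ hp).mul (tendsto_qPoch _ hp)).div
      (hQ.comp (tendsto_id.const_mul_atTop' (by norm_num))) hQ0
  obtain ⟨C, hC⟩ : ∃ C : ℝ, ∀ n, ‖(finPoch p n)⁻¹‖ ≤ C := by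
    obtain ⟨C, hC⟩ := (Metric.isBounded_range_of_tendsto _ (hQ.inv₀ hQ0)).exists_norm_le
    exact ⟨C, fun n => hC _ ⟨n, rfl⟩⟩
  -- Dominated convergence for the finite sums extended by zero to ℤ; `C` bounds 1/(p;p)_n uniformly
  -- because the limit (p;p)_∞ is nonzero.
  set G : ℕ → ℤ → ℂ := fun N n => if n ∈ Finset.Icc (-N : ℤ) N then
    T n / (finPoch p (N - n).toNat * finPoch p (N + n).toNat) else 0
  have hL : Tendsto (fun N => ∑' n, G N n) atTop (𝓝 (∑' n, T n / (Q * Q))) := by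
    refine tendsto_tsum_of_dominated_convergence (bound := fun n => ‖T n‖ * (C * C))
      (hT.summable.norm.mul_right _) (fun n => ?_) (Eventually.of_forall fun N n => ?_)
    · have t1 : Tendsto (fun N : ℕ => ((N : ℤ) - n).toNat) atTop atTop :=
        tendsto_atTop.2 fun b => by
          filter_upwards [eventually_ge_atTop (b + n.natAbs)] with N hN; omega
      have t2 : Tendsto (fun N : ℕ => ((N : ℤ) + n).toNat) atTop atTop :=
        tendsto_atTop.2 fun b => by
          filter_upwards [eventually_ge_atTop (b + n.natAbs)] with N hN; omega
      have := (tendsto_const_nhds (x := T n)).div ((hQ.comp t1).mul (hQ.comp t2))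
        (mul_ne_zero hQ0 hQ0)
      refine this.congr' ?_
      filter_upwards [eventually_ge_atTop n.natAbs] with N hN
      exact (if_pos (Finset.mem_Icc.2 ⟨by omega, by omega⟩)).symm
    · have hC0 : 0 ≤ C := (norm_nonneg _).trans (hC 0)
      simp only [G]
      split_ifs
      · rw [div_eq_mul_inv, mul_inv, norm_mul, norm_mul]
        gcongr
        · exact hC _
        · exact hC _
      · rw [norm_zero]; positivity
  have hLR : ∀ N : ℕ, ∑' n, G N n = (∏ k ∈ Finset.range N, (1 - ee u * p ^ k)) *
      (∏ k ∈ Finset.range N, (1 - ee (τ - u) * p ^ k)) / finPoch p (2 * N) := fun N => by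
    rw [← finite_triple_product hτ, tsum_eq_sum (s := Finset.Icc (-N : ℤ) N)]
    · exact Finset.sum_congr rfl fun n hn => if_pos hn
    · exact fun n hn => if_neg hn
  have := tendsto_nhds_unique hL (hR.congr fun N => (hLR N).symm)
  rw [tsum_div_const, hT.tsum_eq] at this
  rw [div_eq_div_iff (mul_ne_zero hQ0 hQ0) hQ0] at this
  apply mul_right_cancel₀ hQ0
  linear_combination this

/-! ### Theta functions through `jacobiTheta₂` -/

lemma theta1_eq (z τ : ℂ) : theta1 z τ =
    -(ee (τ / 8 + z / 2 + 1 / 4) * jacobiTheta₂ (z + 1 / 2 + τ / 2) τ) := by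
  rw [theta1, jacobiTheta₂, ← tsum_mul_left]
  congr 2
  ext n
  rw [jacobiTheta₂_term, ee, ← Complex.exp_add, ← Complex.exp_add]
  ring_nf

lemma jacobiTheta₂_shift (z τ : ℂ) :
    jacobiTheta₂ (z + τ) τ = ee (-τ / 2 - z) * jacobiTheta₂ z τ := by
  rw [jacobiTheta₂_add_left', ee]
  ring_nf

/-- Unfolding down to θ₁ moves the argument by τ + 1 in total, and quasi-periodicity cancels the
exponential prefactors. -/
lemma theta3_eq (z τ : ℂ) : theta3 z τ = jacobiTheta₂ z τ := by
  rw [theta3, theta2, theta1_eq]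
  have e : z + τ / 2 + 1 / 2 + 1 / 2 + τ / 2 = z + τ + 1 := by ring
  rw [e, jacobiTheta₂_add_left, jacobiTheta₂_shift]
  have : Complex.exp (π * Complex.I * τ / 4 + π * Complex.I * z) = ee (τ / 8 + z / 2) := by
    rw [ee]; ring_nf
  rw [this, neg_eq_neg_one_mul (ee _ * _), ← ee_half]
  have h : ee (τ / 8 + z / 2) * ee (1 / 2) * ee (τ / 8 + (z + τ / 2 + 1 / 2) / 2 + 1 / 4) *
      ee (-τ / 2 - z) = 1 := by
    rw [← ee_add, ← ee_add, ← ee_add]; ring_nf; exact ee_one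
  linear_combination (jacobiTheta₂ z τ) * h

lemma theta4_eq (z τ : ℂ) : theta4 z τ = jacobiTheta₂ (z + 1 / 2) τ := by
  rw [theta4, theta3_eq]

/-- The multiplicative theta function `θ(e^{2πiu};p) = (e^{2πiu};p)(p e^{-2πiu};p)`. -/
def mtheta (τ u : ℂ) : ℂ := qPoch (ee u) (ee τ) * qPoch (ee (τ - u)) (ee τ)

/-- The triple product, with R(τ) designed to absorb p^{1/8} and (p;p)_∞. It translates the
multiplicative theta function in the functional equation of Γ into θ₁. -/
lemma constR_mul_theta1 {τ : ℂ} (hτ : 0 < τ.im) (z : ℂ) :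
    constR τ * theta1 z τ = ee (-z / 2) * mtheta τ z := by
  have hQ := qPoch_self_ne_zero (norm_ee_lt_one hτ)
  have e : z + 1 / 2 + τ / 2 = (z + 1 / 2 - τ / 2) + τ := by ring
  rw [theta1_eq, e, jacobiTheta₂_shift, jacobi_triple_product hτ, constR, base_eq_ee, mtheta]
  have h1 : Complex.exp (-(π * Complex.I * τ / 4)) = ee (-τ / 8) := by rw [ee]; ring_nf
  have h2 : Complex.I = ee (1 / 4) := by
    rw [ee]; refine Complex.exp_pi_div_two_mul_I.symm.trans ?_; congr 1; ring
  have h4 : -(ee (τ / 8 + z / 2 + 1 / 4)) * ee (-τ / 2 - (z + 1 / 2 - τ / 2)) * ee (-τ / 8) =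
      ee (1 / 4) * ee (-z / 2) := by
    rw [neg_eq_neg_one_mul, ← ee_half]
    simp only [← ee_add]
    ring_nf
  rw [h1, h2]
  have h3 := ee_ne_zero (1 / 4)
  rw [div_mul_eq_mul_div, div_eq_iff (mul_ne_zero h3 hQ)]
  linear_combination (qPoch (ee z) (ee τ) * qPoch (ee (τ - z)) (ee τ) * qPoch (ee τ) (ee τ)) * h4

/-! ### The addition formula -/

lemma ee_int_half (n : ℤ) : ee (n / 2) = (-1) ^ n := by
  rw [← ee_half, ee, ee, ← Complex.exp_int_mul]; ring_nf

/-- The terms of the series `∑ (-1)^m ...` pair up under `(k, l) ↦ (k + l + 1, k - l)`. -/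
lemma tsum_eq_tsum_of_opposite_parity (F : ℤ × ℤ → ℂ) :
    ∑' mn : ℤ × ℤ, ((-1 : ℂ) ^ mn.1 - (-1) ^ mn.2) * F mn =
      ∑' kl : ℤ × ℤ, 2 * (ee (((kl.1 + kl.2 + 1 : ℤ) : ℂ) / 2) *
        F (kl.1 + kl.2 + 1, kl.1 - kl.2)) := by
  have hφ : Function.Injective fun kl : ℤ × ℤ => (kl.1 + kl.2 + 1, kl.1 - kl.2) := by
    rintro ⟨k, l⟩ ⟨k', l'⟩ h
    simp only [Prod.mk.injEq] at h ⊢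
    omega
  have hsupp : (Function.support fun mn : ℤ × ℤ => ((-1 : ℂ) ^ mn.1 - (-1) ^ mn.2) * F mn) ⊆
      Set.range fun kl : ℤ × ℤ => (kl.1 + kl.2 + 1, kl.1 - kl.2) := by
    rintro ⟨m, n⟩ hmn
    have hne : ((-1 : ℂ) ^ m - (-1) ^ n) ≠ 0 := left_ne_zero_of_mul hmn
    obtain ⟨k, hk⟩ : ∃ k, m + n = 2 * k + 1 := by
      rcases Int.even_or_odd m with hm | hm <;> rcases Int.even_or_odd n with hn | hn
      · simp [hm.neg_one_zpow, hn.neg_one_zpow] at hne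
      · exact hm.add_odd hn
      · exact hm.add_even hn
      · simp [hm.neg_one_zpow, hn.neg_one_zpow] at hne
    exact ⟨(k, m - k - 1), by simp only [Prod.mk.injEq]; omega⟩
  refine Eq.trans (hφ.tsum_eq hsupp).symm (tsum_congr fun ⟨k, l⟩ => ?_)
  have hpar : ((-1 : ℂ) ^ (k + l + 1) - (-1) ^ (k - l)) = 2 * ee (((k + l + 1 : ℤ) : ℂ) / 2) := by
    rw [ee_int_half]
    have : (k - l) = (k + l + 1) - (2 * l + 1) := by ring
    rw [this, zpow_sub₀ (by norm_num), Odd.neg_one_zpow ⟨l, rfl⟩]; ring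
  simp only [hpar, mul_assoc]

lemma im_half_pos {τ : ℂ} (hτ : 0 < τ.im) : 0 < (τ / 2).im := by
  have : (τ / 2).im = τ.im / 2 := by simp
  rw [this]; linarith

lemma jacobiTheta₂_mul_jacobiTheta₂ {τ τ' : ℂ} (hτ : 0 < τ.im) (hτ' : 0 < τ'.im) (x y : ℂ) :
    HasSum (fun mn : ℤ × ℤ => jacobiTheta₂_term mn.1 x τ * jacobiTheta₂_term mn.2 y τ')
      (jacobiTheta₂ x τ * jacobiTheta₂ y τ') := by
  have h1 := ((summable_jacobiTheta₂_term_iff x τ).2 hτ).norm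
  have h2 := ((summable_jacobiTheta₂_term_iff y τ').2 hτ').norm
  have := (summable_mul_of_summable_norm h1 h2).hasSum
  rwa [← tsum_mul_tsum_of_summable_norm h1 h2] at this

lemma jacobiTheta₂_term_add_half (n : ℤ) (z τ : ℂ) :
    jacobiTheta₂_term n (z + 1 / 2) τ = (-1) ^ n * jacobiTheta₂_term n z τ := by
  rw [← ee_int_half]
  simp only [jacobiTheta₂_term, ee]
  rw [← Complex.exp_add]; ring_nf

/-- Adding 1/2 to x or to y inserts (−1)^m or (−1)^n in the product of the two series, so the
difference keeps only indices of opposite parity. There (m, n) = (k + l + 1, k − l) gives (m² +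
n²)/2 = (k + 1/2)² + (l + 1/2)², which are the exponents of θ₁ at x ± y. -/
lemma two_mul_theta1_mul_theta1 {τ : ℂ} (hτ : 0 < τ.im) (x y : ℂ) :
    2 * (theta1 (x + y) τ * theta1 (x - y) τ) =
      theta4 x (τ / 2) * theta3 y (τ / 2) - theta4 y (τ / 2) * theta3 x (τ / 2) := by
  have hτ2 := im_half_pos hτ
  have h1 := (jacobiTheta₂_mul_jacobiTheta₂ hτ2 hτ2 (x + 1 / 2) y).sub
    (jacobiTheta₂_mul_jacobiTheta₂ hτ2 hτ2 x (y + 1 / 2))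
  have h2 := (jacobiTheta₂_mul_jacobiTheta₂ hτ hτ (x + y + 1 / 2 + τ / 2)
    (x - y + 1 / 2 + τ / 2)).mul_left
      (2 * (ee (τ / 8 + (x + y) / 2 + 1 / 4) * ee (τ / 8 + (x - y) / 2 + 1 / 4)))
  have h3 := tsum_eq_tsum_of_opposite_parity
    fun mn => jacobiTheta₂_term mn.1 x (τ / 2) * jacobiTheta₂_term mn.2 y (τ / 2)
  have e1 : ∀ mn : ℤ × ℤ, ((-1 : ℂ) ^ mn.1 - (-1) ^ mn.2) *
      (jacobiTheta₂_term mn.1 x (τ / 2) * jacobiTheta₂_term mn.2 y (τ / 2)) =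
      jacobiTheta₂_term mn.1 (x + 1 / 2) (τ / 2) * jacobiTheta₂_term mn.2 y (τ / 2) -
      jacobiTheta₂_term mn.1 x (τ / 2) * jacobiTheta₂_term mn.2 (y + 1 / 2) (τ / 2) := fun mn => by
    rw [jacobiTheta₂_term_add_half, jacobiTheta₂_term_add_half]; ring
  have e2 : ∀ kl : ℤ × ℤ, 2 * (ee (((kl.1 + kl.2 + 1 : ℤ) : ℂ) / 2) *
      (jacobiTheta₂_term (kl.1 + kl.2 + 1) x (τ / 2) *
        jacobiTheta₂_term (kl.1 - kl.2) y (τ / 2))) =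
      2 * (ee (τ / 8 + (x + y) / 2 + 1 / 4) * ee (τ / 8 + (x - y) / 2 + 1 / 4)) *
      (jacobiTheta₂_term kl.1 (x + y + 1 / 2 + τ / 2) τ *
        jacobiTheta₂_term kl.2 (x - y + 1 / 2 + τ / 2) τ) := fun kl => by
    rw [mul_assoc]
    congr 1
    simp only [jacobiTheta₂_term, ee, ← Complex.exp_add]
    congr 1
    push_cast
    ring
  simp only [e1, e2] at h3
  rw [h1.tsum_eq, h2.tsum_eq] at h3
  rw [theta1_eq, theta1_eq, theta4_eq, theta4_eq, theta3_eq, theta3_eq]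
  linear_combination -h3

lemma theta4_add_half (z τ : ℂ) : theta4 (z + 1 / 2) τ = theta3 z τ := by
  rw [theta4_eq, theta3_eq, ← jacobiTheta₂_add_left z, add_assoc, add_halves]

lemma theta_add_half (k : ThetaIndex) (z τ : ℂ) :
    theta k (z + 1 / 2) τ = theta k.swap z τ := by
  cases k
  · rfl
  · exact theta4_add_half z τ

lemma theta_sub_half (k : ThetaIndex) (z τ : ℂ) :
    theta k (z - 1 / 2) τ = theta k.swap z τ := by
  have := theta_add_half k.swap (z - 1 / 2) τ
  rw [sub_add_cancel] at this
  cases k <;> exact this.symm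

lemma theta_add_one (k : ThetaIndex) (z τ : ℂ) : theta k (z + 1) τ = theta k z τ := by
  have e : z + 1 = z + 1 / 2 + 1 / 2 := by ring
  rw [e, theta_add_half, theta_add_half]
  cases k <;> rfl

lemma theta_neg (k : ThetaIndex) (z τ : ℂ) : theta k (-z) τ = theta k z τ := by
  cases k
  · simp only [theta, theta3_eq, jacobiTheta₂_neg_left]
  · simp only [theta]
    rw [theta4_eq, theta4_eq, ← jacobiTheta₂_neg_left, ← jacobiTheta₂_add_left]
    ring_nf

lemma differentiable_theta (k : ThetaIndex) {τ : ℂ} (hτ : 0 < τ.im) :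
    Differentiable ℂ fun z => theta k z τ := by
  cases k
  · simp only [theta, theta3_eq]
    exact fun z => differentiableAt_jacobiTheta₂_fst z hτ
  · simp only [theta, theta4_eq]
    exact fun z => (differentiableAt_jacobiTheta₂_fst (z + 1 / 2) hτ).comp z
      (differentiableAt_id.add_const _)

lemma differentiable_theta1 {τ : ℂ} (hτ : 0 < τ.im) :
    Differentiable ℂ fun z => theta1 z τ := by
  simp only [theta1_eq, ee]
  exact fun z => (DifferentiableAt.mul (by fun_prop)
    ((differentiableAt_jacobiTheta₂_fst (z + 1 / 2 + τ / 2) hτ).comp z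
      ((differentiableAt_id.add_const _).add_const _))).neg

/-- The three-term identity behind the intertwining relation. -/
lemma theta_three_term (k : ThetaIndex) {τ : ℂ} (hτ : 0 < τ.im) (z G x : ℂ) :
    theta k (z + G) (τ / 2) * (theta1 (z - G + x) τ * theta1 (z - G - x) τ) -
      theta k (z - G) (τ / 2) * (theta1 (z + G + x) τ * theta1 (z + G - x) τ) =
    theta k x (τ / 2) * (theta1 (2 * z) τ * theta1 (-2 * G) τ) := by
  have h1 := two_mul_theta1_mul_theta1 hτ (z - G) x
  have h2 := two_mul_theta1_mul_theta1 hτ (z + G) x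
  have h3 := two_mul_theta1_mul_theta1 hτ (z - G) (z + G)
  have e1 : z - G + (z + G) = 2 * z := by ring
  have e2 : z - G - (z + G) = -2 * G := by ring
  rw [e1, e2] at h3
  apply mul_left_cancel₀ (two_ne_zero (α := ℂ))
  -- The three addition formulas are the 2×2 minors of the columns (θ₃, θ₄) at z − G, z + G, x. The
  -- claim expands a 3×3 determinant in which the row θ_k is repeated.
  cases k <;> simp only [theta]
  · linear_combination theta3 (z + G) (τ / 2) * h1 - theta3 (z - G) (τ / 2) * h2 -
      theta3 x (τ / 2) * h3
  · linear_combination theta4 (z + G) (τ / 2) * h1 - theta4 (z - G) (τ / 2) * h2 -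
      theta4 x (τ / 2) * h3

/-! ### The double product -/

/-- The lattice vector `jτ + 2kη`. -/
def lat (τ η : ℂ) (nm : ℕ × ℕ) : ℂ := nm.1 * τ + nm.2 * (2 * η)

lemma base_pow_mul_base_pow (τ η : ℂ) (j k : ℕ) :
    base τ ^ j * base (2 * η) ^ k = ee (lat τ η (j, k)) := by
  rw [base_eq_ee, base_eq_ee, ← ee_nat_mul, ← ee_nat_mul, ← ee_add, lat]

lemma lat_im (τ η : ℂ) (nm : ℕ × ℕ) : (lat τ η nm).im = nm.1 * τ.im + nm.2 * (2 * η.im) := by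
  simp [lat]

lemma lat_im_nonneg {τ η : ℂ} (hτ : 0 < τ.im) (hη : 0 < η.im) (nm : ℕ × ℕ) :
    0 ≤ (lat τ η nm).im := by
  rw [lat_im]; positivity

lemma im_two_mul_pos {η : ℂ} (hη : 0 < η.im) : 0 < (2 * η).im := by
  have : (2 * η).im = 2 * η.im := by simp
  rw [this]; linarith

lemma summable_norm_ee_lat {τ η : ℂ} (hτ : 0 < τ.im) (hη : 0 < η.im) :
    Summable fun nm => ‖ee (lat τ η nm)‖ := by
  have h1 := summable_geometric_of_lt_one (norm_nonneg _) (norm_ee_lt_one hτ)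
  have h2 := summable_geometric_of_lt_one (norm_nonneg _) (norm_ee_lt_one (im_two_mul_pos hη))
  refine (h1.mul_of_nonneg h2 (fun _ => by positivity) (fun _ => by positivity)).congr
    fun nm => ?_
  rw [← norm_pow, ← norm_pow, ← norm_mul, ← ee_nat_mul, ← ee_nat_mul, ← ee_add]; rfl

/-- `∏_{(j,k) ∉ s} (1 - e^{2πiz} p^j q^k)`. -/
def drest (τ η : ℂ) (s : Finset (ℕ × ℕ)) (z : ℂ) : ℂ :=
  ∏' nm : ℕ × ℕ, (1 + if nm ∈ s then 0 else -ee (z + lat τ η nm))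

/-- `(e^{2πiz}; p, q)_∞`. -/
def dprod (τ η z : ℂ) : ℂ := drest τ η ∅ z

/-- `∏_{(j,k) ∈ s} (1 - e^{2πiz} p^j q^k)`. -/
def dfin (τ η : ℂ) (s : Finset (ℕ × ℕ)) (z : ℂ) : ℂ := ∏ nm ∈ s, (1 - ee (z + lat τ η nm))

section
variable {τ η : ℂ}

lemma norm_drest_term_le (s : Finset (ℕ × ℕ)) (z : ℂ) (nm : ℕ × ℕ) :
    ‖if nm ∈ s then 0 else -ee (z + lat τ η nm)‖ ≤ ‖ee z‖ * ‖ee (lat τ η nm)‖ := by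
  split_ifs
  · rw [norm_zero]; positivity
  · rw [norm_neg, ee_add, norm_mul]

lemma summable_drest (hτ : 0 < τ.im) (hη : 0 < η.im) (s : Finset (ℕ × ℕ)) (z : ℂ) :
    Summable fun nm : ℕ × ℕ => ‖if nm ∈ s then 0 else -ee (z + lat τ η nm)‖ :=
  Summable.of_nonneg_of_le (fun _ => norm_nonneg _) (norm_drest_term_le s z)
    ((summable_norm_ee_lat hτ hη).mul_left _)

lemma hasProd_drest (hτ : 0 < τ.im) (hη : 0 < η.im) (s : Finset (ℕ × ℕ)) (z : ℂ) :
    HasProd (fun nm : ℕ × ℕ => 1 + if nm ∈ s then 0 else -ee (z + lat τ η nm)) (drest τ η s z) :=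
  (multipliable_one_add_of_summable (summable_drest hτ hη s z)).hasProd

lemma hasProd_dprod (hτ : 0 < τ.im) (hη : 0 < η.im) (z : ℂ) :
    HasProd (fun nm : ℕ × ℕ => 1 - ee (z + lat τ η nm)) (dprod τ η z) := by
  refine (hasProd_drest hτ hη ∅ z).congr_fun fun nm => ?_
  rw [if_neg (Finset.notMem_empty _), sub_eq_add_neg]

lemma drest_ne_zero (hτ : 0 < τ.im) (hη : 0 < η.im) {s : Finset (ℕ × ℕ)} {z : ℂ}
    (h : ∀ nm ∉ s, ee (z + lat τ η nm) ≠ 1) : drest τ η s z ≠ 0 := by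
  refine tprod_one_add_ne_zero_of_summable (fun nm => ?_) (summable_drest hτ hη s z)
  split_ifs with hs
  · simp
  · intro h0; exact h nm hs (by linear_combination -h0)

lemma dprod_ne_zero (hτ : 0 < τ.im) (hη : 0 < η.im) {z : ℂ}
    (h : ∀ nm, ee (z + lat τ η nm) ≠ 1) : dprod τ η z ≠ 0 :=
  drest_ne_zero hτ hη fun nm _ => h nm

lemma dprod_ne_zero_of_im_pos (hτ : 0 < τ.im) (hη : 0 < η.im) {z : ℂ} (hz : 0 < z.im) :
    dprod τ η z ≠ 0 := by
  refine dprod_ne_zero hτ hη fun nm h => ?_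
  refine one_sub_ee_ne_zero (u := z + lat τ η nm) ?_ (by rw [h, sub_self])
  rw [Complex.add_im]
  have := lat_im_nonneg hτ hη nm
  linarith

/-- Isolates in `dfin` the finitely many factors that may vanish in a given half-plane. -/
lemma dprod_eq_dfin_mul_drest (hτ : 0 < τ.im) (hη : 0 < η.im) (s : Finset (ℕ × ℕ)) (z : ℂ) :
    dprod τ η z = dfin τ η s z * drest τ η s z := by
  have h1 : HasProd (fun nm : ℕ × ℕ => if nm ∈ s then 1 - ee (z + lat τ η nm) else 1)
      (dfin τ η s z) := by
    rw [dfin, Finset.prod_congr rfl fun nm (hnm : nm ∈ s) =>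
      (if_pos hnm : (if nm ∈ s then 1 - ee (z + lat τ η nm) else 1) = _).symm]
    exact hasProd_prod_of_ne_finset_one fun nm hnm => if_neg hnm
  refine (hasProd_dprod hτ hη z).unique ((h1.mul (hasProd_drest hτ hη s z)).congr_fun ?_)
  intro nm
  split_ifs <;> ring

lemma differentiable_drest (hτ : 0 < τ.im) (hη : 0 < η.im) (s : Finset (ℕ × ℕ)) :
    Differentiable ℂ (drest τ η s) := by
  intro z
  have hd : ∀ nm : ℕ × ℕ, Differentiable ℂ fun z => if nm ∈ s then 0 else -ee (z + lat τ η nm) :=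
    fun nm => by
      split_ifs
      · fun_prop
      · exact (differentiable_ee.comp (by fun_prop)).neg
  obtain ⟨C, hC⟩ : ∃ C, ∀ x ∈ Metric.ball z 1, ‖ee x‖ ≤ C := by
    have := ((isCompact_closedBall z 1).image differentiable_ee.continuous).isBounded.exists_norm_le
    obtain ⟨C, hC⟩ := this
    exact ⟨C, fun x hx => hC _ ⟨x, Metric.ball_subset_closedBall hx, rfl⟩⟩
  have hu := (summable_norm_ee_lat hτ hη).mul_left C
  have := Summable.hasProdLocallyUniformlyOn_one_add (K := Metric.ball z 1)
    (f := fun (nm : ℕ × ℕ) (z : ℂ) => if nm ∈ s then 0 else -ee (z + lat τ η nm))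
    Metric.isOpen_ball hu (Eventually.of_forall fun nm x hx =>
      (norm_drest_term_le s x nm).trans (by gcongr; exact hC x hx))
    (fun nm => (hd nm).continuous.continuousOn)
  have h2 := this.differentiableOn (.of_forall fun t => by
    simpa [Finset.prod_fn] using DifferentiableOn.finsetProd
      (fun nm _ => ((hd nm).const_add 1).differentiableOn)) Metric.isOpen_ball
  exact (h2 z (Metric.mem_ball_self one_pos)).differentiableAt
    (Metric.isOpen_ball.mem_nhds (Metric.mem_ball_self one_pos))

lemma differentiable_dprod (hτ : 0 < τ.im) (hη : 0 < η.im) : Differentiable ℂ (dprod τ η) :=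
  differentiable_drest hτ hη ∅

lemma drest_add_one (s : Finset (ℕ × ℕ)) (z : ℂ) : drest τ η s (z + 1) = drest τ η s z := by
  simp only [drest, add_right_comm z 1, ee_add_one]

lemma dprod_add_one (z : ℂ) : dprod τ η (z + 1) = dprod τ η z := drest_add_one ∅ z

/-- Exchange of the two bases. -/
lemma dprod_swap (z : ℂ) : dprod (2 * η) (τ / 2) z = dprod τ η z := by
  rw [dprod, dprod, drest, drest, ← (Equiv.prodComm ℕ ℕ).tprod_eq]
  refine tprod_congr fun nm => ?_
  simp only [lat, Equiv.prodComm_apply, Prod.fst_swap, Prod.snd_swap, Finset.notMem_empty,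
    if_false]
  ring_nf

/-- The row k = 0 of the double product is (e^{2πiz}; p)_∞; lowering k by one in the other rows
shifts z by 2η. -/
lemma dprod_eq_qPoch_mul (hτ : 0 < τ.im) (hη : 0 < η.im) (z : ℂ) :
    dprod τ η z = qPoch (ee z) (ee τ) * dprod τ η (z + 2 * η) := by
  set f := fun nm : ℕ × ℕ => 1 - ee (z + lat τ η nm) with hf
  have h1 : HasProd (fun nm : ℕ × ℕ => if nm.2 = 0 then f nm else 1)
      (qPoch (ee z) (ee τ)) := by
    have hi : Function.Injective fun j : ℕ => (j, 0) := fun j j' h => (Prod.mk.inj h).1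
    refine (hi.hasProd_iff ?_).1 ((multipliable_qPoch (ee z) (norm_ee_lt_one hτ)).hasProd.congr_fun
      fun j => ?_)
    · rintro ⟨j, k⟩ hjk
      refine if_neg fun hk => hjk ⟨j, ?_⟩
      rw [show k = 0 from hk]
    · simp only [Function.comp, if_true, hf, lat]
      rw [← ee_nat_mul, ← ee_add]
      simp
  have h2 : HasProd (fun nm : ℕ × ℕ => if nm.2 = 0 then 1 else f nm)
      (dprod τ η (z + 2 * η)) := by
    have hi : Function.Injective fun jk : ℕ × ℕ => (jk.1, jk.2 + 1) := by
      rintro ⟨j, k⟩ ⟨j', k'⟩ h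
      simpa using h
    refine (hi.hasProd_iff ?_).1 ((hasProd_dprod hτ hη (z + 2 * η)).congr_fun fun jk => ?_)
    · rintro ⟨j, k⟩ hjk
      refine if_pos ?_
      by_contra hk
      exact hjk ⟨(j, k - 1), by simp only [Prod.mk.injEq, true_and]; simp only at hk; omega⟩
    · simp only [Function.comp, Nat.succ_ne_zero, if_false, hf, lat]
      congr 2
      push_cast
      ring
  refine (hasProd_dprod hτ hη z).unique ((h1.mul h2).congr_fun fun nm => ?_)
  split_ifs <;> simp [hf]

lemma dprod_eq_qPoch_mul' (hτ : 0 < τ.im) (hη : 0 < η.im) (z : ℂ) :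
    dprod τ η z = qPoch (ee z) (ee (2 * η)) * dprod τ η (z + τ) := by
  have := dprod_eq_qPoch_mul (im_two_mul_pos hη) (im_half_pos hτ) z
  rwa [dprod_swap, dprod_swap, mul_div_cancel₀ _ (two_ne_zero)] at this

/-! ### The elliptic gamma function -/

lemma ellGamma_eq (hτ : 0 < τ.im) (hη : 0 < η.im) (z : ℂ) :
    ellGamma τ η z = dprod τ η (τ + 2 * η - z) / dprod τ η z := by
  have e : ∀ nm : ℕ × ℕ, (1 - Complex.exp (-(2 * π * Complex.I * z)) *
        base τ ^ (nm.1 + 1) * base (2 * η) ^ (nm.2 + 1)) /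
      (1 - Complex.exp (2 * π * Complex.I * z) * base τ ^ nm.1 * base (2 * η) ^ nm.2) =
      (1 - ee (τ + 2 * η - z + lat τ η nm)) / (1 - ee (z + lat τ η nm)) := fun nm => by
    rw [mul_assoc (Complex.exp _), mul_assoc (Complex.exp (2 * π * Complex.I * z)),
      base_pow_mul_base_pow, base_pow_mul_base_pow]
    have h1 : Complex.exp (-(2 * π * Complex.I * z)) = ee (-z) := by rw [ee]; ring_nf
    have h2 : Complex.exp (2 * π * Complex.I * z) = ee z := rfl
    rw [h1, h2, ← ee_add, ← ee_add]
    congr 3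
    simp only [lat]; push_cast; ring
  rw [ellGamma, tprod_congr e]
  by_cases h : ∀ nm, ee (z + lat τ η nm) ≠ 1
  · exact ((hasProd_dprod hτ hη (τ + 2 * η - z)).div₀ (hasProd_dprod hτ hη z)
      (dprod_ne_zero hτ hη h)).tprod_eq
  -- At a pole both sides are 0: the quotient because its denominator vanishes, the infinite product
  -- because one of its factors has the form x/0.
  · push Not at h
    obtain ⟨nm, hnm⟩ := h
    have h0 : dprod τ η z = 0 := by
      rw [← (hasProd_dprod hτ hη z).tprod_eq]
      exact tprod_of_exists_eq_zero ⟨nm, by rw [hnm, sub_self]⟩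
    rw [h0, div_zero]
    exact tprod_of_exists_eq_zero ⟨nm, by rw [hnm, sub_self, div_zero]⟩

lemma ellGamma_swap (hτ : 0 < τ.im) (hη : 0 < η.im) (z : ℂ) :
    ellGamma (2 * η) (τ / 2) z = ellGamma τ η z := by
  rw [ellGamma_eq hτ hη, ellGamma_eq (im_two_mul_pos hη) (im_half_pos hτ), dprod_swap, dprod_swap]
  congr 2; ring

lemma ellGamma_add_one (hτ : 0 < τ.im) (hη : 0 < η.im) (z : ℂ) :
    ellGamma τ η (z + 1) = ellGamma τ η z := by
  rw [ellGamma_eq hτ hη, ellGamma_eq hτ hη, dprod_add_one, ← dprod_add_one (_ - (z + 1))]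
  congr 2; ring

/-- The hypothesis excludes the poles of Γ(z), where the conventional value 0 would spoil the
functional equation. -/
lemma ellGamma_add_two_mul (hτ : 0 < τ.im) (hη : 0 < η.im) {z : ℂ} (hz : dprod τ η z ≠ 0) :
    ellGamma τ η (z + 2 * η) = mtheta τ z * ellGamma τ η z := by
  rw [ellGamma_eq hτ hη, ellGamma_eq hτ hη, mtheta]
  have h1 := dprod_eq_qPoch_mul hτ hη z
  have h2 := dprod_eq_qPoch_mul hτ hη (τ - z)
  have e1 : τ + 2 * η - (z + 2 * η) = τ - z := by ring
  have e2 : τ + 2 * η - z = τ - z + 2 * η := by ring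
  rw [e1, e2, h1, h2]
  rw [h1] at hz
  have h3 := left_ne_zero_of_mul hz
  have h4 := right_ne_zero_of_mul hz
  field_simp

/-- The entire function `(t;p)_∞ (tq;q)_∞`, `t = e^{2πiz}`, so that
`1 / (Γ(z)Γ(-z)) = reflFactor z * reflFactor (-z)`. -/
def reflFactor (τ η z : ℂ) : ℂ := qPoch (ee z) (ee τ) * qPoch (ee (z + 2 * η)) (ee (2 * η))

lemma dprod_eq_reflFactor_mul (hτ : 0 < τ.im) (hη : 0 < η.im) (z : ℂ) :
    dprod τ η z = reflFactor τ η z * dprod τ η (τ + 2 * η + z) := by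
  rw [dprod_eq_qPoch_mul hτ hη z, dprod_eq_qPoch_mul' hτ hη (z + 2 * η), reflFactor, mul_assoc]
  congr 3; ring

lemma differentiable_reflFactor (hτ : 0 < τ.im) (hη : 0 < η.im) :
    Differentiable ℂ (reflFactor τ η) :=
  ((differentiable_qPoch_left (norm_ee_lt_one hτ)).comp differentiable_ee).mul
    ((differentiable_qPoch_left (norm_ee_lt_one (im_two_mul_pos hη))).comp
      (differentiable_ee.comp (differentiable_id.add_const _)))

lemma reflFactor_add_one (z : ℂ) : reflFactor τ η (z + 1) = reflFactor τ η z := by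
  rw [reflFactor, reflFactor, add_right_comm, ee_add_one, ee_add_one]

/-- Shows that 1/Γ(±2x) contributes no poles to the integrand. The hypotheses exclude the zeros of
Γ(z) and Γ(−z); at the poles a reflection factor vanishes and both sides are 0. -/
lemma inv_ellGamma_mul (hτ : 0 < τ.im) (hη : 0 < η.im) {z : ℂ}
    (h1 : dprod τ η (τ + 2 * η + z) ≠ 0) (h2 : dprod τ η (τ + 2 * η - z) ≠ 0) :
    (ellGamma τ η z * ellGamma τ η (-z))⁻¹ = reflFactor τ η z * reflFactor τ η (-z) := by
  rw [ellGamma_eq hτ hη, ellGamma_eq hτ hη, dprod_eq_reflFactor_mul hτ hη z,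
    dprod_eq_reflFactor_mul hτ hη (-z), sub_neg_eq_add, ← sub_eq_add_neg]
  by_cases h3 : reflFactor τ η z = 0
  · simp [h3]
  by_cases h4 : reflFactor τ η (-z) = 0
  · simp [h4]
  field_simp

end

/-! ### Holomorphic parametric integrals and contour shifts -/

/-- Differentiation under the integral. A bound `M` for `F` on a compact disc times the interval
gives, by Cauchy's estimate on radius r/2, the bound M/(r/2) for the derivative; the derivative is
measurable in x as a pointwise limit of difference quotients. -/
lemma differentiableOn_intervalIntegral {S : Set ℂ} (hS : IsOpen S) {F : ℂ → ℝ → ℂ} {a b : ℝ}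
    (hc : ContinuousOn (Function.uncurry F) (S ×ˢ Set.univ))
    (hd : ∀ x, DifferentiableOn ℂ (fun g => F g x) S) :
    DifferentiableOn ℂ (fun g => ∫ x in a..b, F g x) S := by
  intro g₀ hg₀
  obtain ⟨r, hr, hrS⟩ := Metric.nhds_basis_closedBall.mem_iff.1 (hS.mem_nhds hg₀)
  have hK : IsCompact (Metric.closedBall g₀ r ×ˢ Set.uIcc a b) :=
    (isCompact_closedBall _ _).prod isCompact_uIcc
  obtain ⟨M, hM⟩ := (hK.image_of_continuousOn (hc.mono
    (Set.prod_mono hrS (Set.subset_univ _)))).isBounded.exists_norm_le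
  have hM' : ∀ g ∈ Metric.closedBall g₀ r, ∀ x ∈ Set.uIcc a b, ‖F g x‖ ≤ M := fun g hg x hx =>
    hM _ ⟨(g, x), ⟨hg, hx⟩, rfl⟩
  have hcx : ∀ g ∈ S, Continuous (F g) := fun g hg => by
    rw [← continuousOn_univ]
    exact hc.comp (f := fun x : ℝ => (g, x)) (by fun_prop) fun x _ => ⟨hg, trivial⟩
  have hball : ∀ g ∈ Metric.ball g₀ (r / 2), Metric.closedBall g (r / 2) ⊆
      Metric.closedBall g₀ r := fun g hg => by
    refine Metric.closedBall_subset_closedBall' ?_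
    have := Metric.mem_ball.1 hg
    linarith
  have hdiff : ∀ g ∈ S, ∀ x, HasDerivAt (fun g => F g x) (deriv (fun g => F g x) g) g :=
    fun g hg x => ((hd x g hg).differentiableAt (hS.mem_nhds hg)).hasDerivAt
  have hb2 : Metric.ball g₀ (r / 2) ⊆ S := fun g hg =>
    hrS (hball g hg (Metric.mem_closedBall_self (by positivity)))
  have hmeas : MeasureTheory.AEStronglyMeasurable (fun x => deriv (fun g => F g x) g₀)
      (MeasureTheory.volume.restrict (Set.uIoc a b)) := by
    have hseq : Tendsto (fun n : ℕ => (r / 2 : ℂ) * (1 / ((n : ℂ) + 1))) atTop (𝓝[≠] 0) := by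
      refine tendsto_nhdsWithin_iff.2 ⟨?_, Eventually.of_forall fun n => ?_⟩
      · have := (tendsto_one_div_add_atTop_nhds_zero_nat (𝕜 := ℂ)).const_mul (r / 2 : ℂ)
        simpa using this
      · have h1 : (n : ℂ) + 1 ≠ 0 := Nat.cast_add_one_ne_zero n
        have h2 : (r : ℂ) ≠ 0 := by exact_mod_cast hr.ne'
        simp [h1, h2]
    have hmem : ∀ n : ℕ, g₀ + (r / 2 : ℂ) * (1 / ((n : ℂ) + 1)) ∈ S := fun n => by
      refine hrS ?_
      rw [Metric.mem_closedBall, dist_eq_norm, add_sub_cancel_left, norm_mul, norm_div, norm_div]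
      have h3 : ‖(n : ℂ) + 1‖ = n + 1 := by
        rw [← Nat.cast_succ, Complex.norm_natCast, Nat.cast_succ]
      rw [h3, norm_one, Complex.norm_real, Real.norm_of_nonneg hr.le, Complex.norm_ofNat]
      have : 1 / ((n : ℝ) + 1) ≤ 1 := by
        rw [div_le_one (by positivity)]; linarith [n.cast_nonneg (α := ℝ)]
      have h4 : 0 < 1 / ((n : ℝ) + 1) := by positivity
      nlinarith
    refine aestronglyMeasurable_of_tendsto_ae atTop (f := fun (n : ℕ) x =>
      ((r / 2 : ℂ) * (1 / ((n : ℂ) + 1)))⁻¹ •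
        (F (g₀ + (r / 2 : ℂ) * (1 / ((n : ℂ) + 1))) x - F g₀ x)) (fun n => ?_)
        (Eventually.of_forall fun x => ?_)
    · exact (((hcx _ (hmem n)).sub (hcx _ hg₀)).const_smul (_ : ℂ)).aestronglyMeasurable
    · exact (hasDerivAt_iff_tendsto_slope_zero.1 (hdiff g₀ hg₀ x)).comp hseq
  have := intervalIntegral.hasDerivAt_integral_of_dominated_loc_of_deriv_le
    (μ := MeasureTheory.volume) (a := a) (b := b) (F := F)
    (F' := fun g x => deriv (fun g => F g x) g) (x₀ := g₀) (bound := fun _ => M / (r / 2))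
    (s := Metric.ball g₀ (r / 2)) (Metric.ball_mem_nhds _ (by positivity))
    (by filter_upwards [hS.mem_nhds hg₀] with g hg using (hcx g hg).aestronglyMeasurable)
    ((hcx g₀ hg₀).intervalIntegrable _ _) hmeas
    (Eventually.of_forall fun x hx g hg => by
      refine Complex.norm_deriv_le_of_forall_mem_sphere_norm_le (by positivity)
        (DifferentiableOn.diffContOnCl ?_) fun w hw =>
          hM' w (hball g hg (Metric.sphere_subset_closedBall hw)) x (Set.uIoc_subset_uIcc hx)
      exact (hd x).mono (Metric.closure_ball_subset_closedBall.trans ((hball g hg).trans hrS)))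
    (by simp)
    (Eventually.of_forall fun x _ g hg => hdiff g (hb2 hg) x)
  exact this.2.differentiableAt.differentiableWithinAt

lemma periodic_intervalIntegral {f : ℂ → ℂ} (hf : ∀ x, f (x + 1) = f x) (c y : ℝ) :
    ∫ x : ℝ in c..c + 1, f (x + y * Complex.I) = ∫ x : ℝ in (0 : ℝ)..1, f (x + y * Complex.I) := by
  have hp : Function.Periodic (fun x : ℝ => f (x + y * Complex.I)) 1 := fun x => by
    simp only
    rw [← hf (x + y * Complex.I)]; push_cast; ring_nf
  have := hp.intervalIntegral_add_eq c 0
  rwa [zero_add] at this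

/-- Cauchy's theorem on a rectangle of width one, whose vertical sides cancel by `hv`. The left edge
`c` is free so that the rectangle can later be centred at a pole. -/
lemma rectangle_shift {f : ℂ → ℂ} (c y₁ y₂ : ℝ)
    (hd : DifferentiableOn ℂ f (Set.Icc c (c + 1) ×ℂ Set.uIcc y₁ y₂))
    (hv : ∀ y : ℝ, f (((c + 1 : ℝ) : ℂ) + y * Complex.I) = f (c + y * Complex.I)) :
    ∫ x : ℝ in c..c + 1, f (x + y₁ * Complex.I) = ∫ x : ℝ in c..c + 1, f (x + y₂ * Complex.I) := by
  have := Complex.integral_boundary_rect_eq_zero_of_differentiableOn f (c + y₁ * Complex.I)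
    (((c + 1 : ℝ) : ℂ) + y₂ * Complex.I)
  simp only [Complex.add_re, Complex.add_im, Complex.ofReal_re, Complex.ofReal_im, Complex.mul_re,
    Complex.mul_im, Complex.I_re, Complex.I_im, mul_zero, mul_one, sub_zero, add_zero, zero_add,
    hv] at this
  rw [Set.uIcc_of_le (by linarith : c ≤ c + 1)] at this
  have h := this hd
  rw [add_sub_assoc, sub_self, add_zero] at h
  exact sub_eq_zero.1 h

lemma contour_shift {f : ℂ → ℂ} (hf : ∀ x, f (x + 1) = f x) (y₁ y₂ : ℝ)
    (hd : DifferentiableOn ℂ f {x | x.im ∈ Set.uIcc y₁ y₂}) :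
    ∫ x : ℝ in (0 : ℝ)..1, f (x + y₁ * Complex.I) =
      ∫ x : ℝ in (0 : ℝ)..1, f (x + y₂ * Complex.I) := by
  have := rectangle_shift (f := f) 0 y₁ y₂ (hd.mono fun x hx => hx.2) fun y => by
    rw [← hf (((0 : ℝ) : ℂ) + _)]; push_cast; ring_nf
  simpa using this

/-! ### Integrals with two families of poles -/

/-- Holomorphic in the spin `g`, `Im g < C`, and in `x`, `|Im x| < L`, with period `1` in `x`. -/
structure IsAdmissible (C L : ℝ) (H : ℂ × ℂ → ℂ) : Prop where
  diff : DifferentiableOn ℂ H {w | w.1.im < C ∧ |w.2.im| < L}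
  periodic : ∀ g x, H (g, x + 1) = H (g, x)

variable {ι : Type*}

/-- `∏_{i ∈ A} (1 - e^{2πi(x + a_i - g)})`. -/
def poleUp (a : ι → ℂ) (A : Finset ι) (w : ℂ × ℂ) : ℂ := ∏ i ∈ A, (1 - ee (w.2 + a i - w.1))

/-- `∏_{i ∈ B} (1 - e^{2πi(-x + a_i - g)})`. -/
def poleDown (a : ι → ℂ) (B : Finset ι) (w : ℂ × ℂ) : ℂ := ∏ i ∈ B, (1 - ee (-w.2 + a i - w.1))

/-- The integral with the two families of poles. -/
def poleIntegral (a : ι → ℂ) (A B : Finset ι) (H : ℂ × ℂ → ℂ) (g : ℂ) : ℂ :=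
  ∫ x : ℝ in (0 : ℝ)..1, H (g, x) / (poleUp a A (g, x) * poleDown a B (g, x))

lemma differentiable_poleUp (a : ι → ℂ) (A : Finset ι) : Differentiable ℂ (poleUp a A) := by
  classical
  induction A using Finset.induction_on with
  | empty => exact differentiable_const (1 : ℂ)
  | insert i A hi ih =>
    have : poleUp a (insert i A) = fun w => (1 - ee (w.2 + a i - w.1)) * poleUp a A w :=
      funext fun w => Finset.prod_insert hi
    rw [this]
    exact ((differentiable_ee.comp (by fun_prop : Differentiable ℂ
      fun w : ℂ × ℂ => w.2 + a i - w.1)).const_sub 1).mul ih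

lemma differentiable_poleDown (a : ι → ℂ) (A : Finset ι) : Differentiable ℂ (poleDown a A) := by
  classical
  induction A using Finset.induction_on with
  | empty => exact differentiable_const (1 : ℂ)
  | insert i A hi ih =>
    have : poleDown a (insert i A) = fun w => (1 - ee (-w.2 + a i - w.1)) * poleDown a A w :=
      funext fun w => Finset.prod_insert hi
    rw [this]
    exact ((differentiable_ee.comp (by fun_prop : Differentiable ℂ
      fun w : ℂ × ℂ => -w.2 + a i - w.1)).const_sub 1).mul ih

lemma poleUp_periodic (a : ι → ℂ) (A : Finset ι) (g x : ℂ) :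
    poleUp a A (g, x + 1) = poleUp a A (g, x) := by
  refine Finset.prod_congr rfl fun i _ => ?_
  rw [← ee_add_one (x + a i - g)]; ring_nf

lemma poleDown_periodic (a : ι → ℂ) (A : Finset ι) (g x : ℂ) :
    poleDown a A (g, x + 1) = poleDown a A (g, x) := by
  refine Finset.prod_congr rfl fun i _ => ?_
  rw [← ee_add_one (-(x + 1) + a i - g)]; ring_nf

lemma poleUp_ne_zero {a : ι → ℂ} {A : Finset ι} {g x : ℂ}
    (h : ∀ i ∈ A, g.im < (a i).im + x.im) : poleUp a A (g, x) ≠ 0 :=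
  Finset.prod_ne_zero_iff.2 fun i hi => one_sub_ee_ne_zero (by
    simp only [Complex.sub_im, Complex.add_im]
    have := h i hi
    linarith)

lemma poleDown_ne_zero {a : ι → ℂ} {A : Finset ι} {g x : ℂ}
    (h : ∀ i ∈ A, g.im < (a i).im - x.im) : poleDown a A (g, x) ≠ 0 :=
  Finset.prod_ne_zero_iff.2 fun i hi => one_sub_ee_ne_zero (by
    simp only [Complex.sub_im, Complex.add_im, Complex.neg_im]
    have := h i hi
    linarith)

lemma isOpen_im_lt (C : ℝ) : IsOpen {g : ℂ | g.im < C} :=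
  isOpen_lt Complex.continuous_im continuous_const

section
variable {C L : ℝ} {H : ℂ × ℂ → ℂ} {a : ι → ℂ}

lemma IsAdmissible.mul {H' : ℂ × ℂ → ℂ} (hH : IsAdmissible C L H) (hH' : IsAdmissible C L H') :
    IsAdmissible C L fun w => H w * H' w :=
  ⟨hH.diff.mul hH'.diff, fun g x => by rw [hH.periodic, hH'.periodic]⟩

lemma isAdmissible_ee (i : ι) : IsAdmissible C L fun w => ee (-w.2 + a i - w.1) :=
  ⟨(differentiable_ee.comp (by fun_prop : Differentiable ℂ
    fun w : ℂ × ℂ => -w.2 + a i - w.1)).differentiableOn, fun g x => by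
      rw [← ee_add_one (-(x + 1) + a i - g)]; ring_nf⟩

lemma IsAdmissible.diff_snd (hH : IsAdmissible C L H) {g : ℂ} (hg : g.im < C) :
    DifferentiableOn ℂ (fun x => H (g, x)) {x | |x.im| < L} :=
  hH.diff.comp (f := fun x => (g, x)) (by fun_prop) fun _ hx => ⟨hg, hx⟩

lemma IsAdmissible.diff_fst (hH : IsAdmissible C L H) {x : ℂ} (hx : |x.im| < L) :
    DifferentiableOn ℂ (fun g => H (g, x)) {g | g.im < C} :=
  hH.diff.comp (f := fun g => (g, x)) (by fun_prop) fun _ hg => ⟨hg, hx⟩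

lemma IsAdmissible.differentiableOn_integral (hH : IsAdmissible C L H) {y : ℝ} (hy : |y| < L)
    {D : ℂ × ℂ → ℂ} (hD : Differentiable ℂ D)
    (hD0 : ∀ g x : ℂ, g.im < C → x.im = y → D (g, x) ≠ 0) :
    DifferentiableOn ℂ (fun g => ∫ x : ℝ in (0 : ℝ)..1,
      H (g, x + y * Complex.I) / D (g, x + y * Complex.I)) {g | g.im < C} := by
  have him : ∀ x : ℝ, ((x : ℂ) + y * Complex.I).im = y := fun x => by simp
  refine differentiableOn_intervalIntegral (F := fun g x =>
    H (g, x + y * Complex.I) / D (g, x + y * Complex.I)) (isOpen_im_lt C) ?_ fun x => ?_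
  · have hm : Continuous fun w : ℂ × ℝ => (w.1, (w.2 : ℂ) + y * Complex.I) := by fun_prop
    refine ContinuousOn.div (hH.diff.continuousOn.comp hm.continuousOn ?_)
      (hD.continuous.comp hm).continuousOn ?_
    · rintro ⟨g, x⟩ ⟨hg, -⟩
      exact ⟨hg, by simpa using hy⟩
    · rintro ⟨g, x⟩ ⟨hg, -⟩
      exact hD0 _ _ hg (him x)
  · refine DifferentiableOn.div (hH.diff_fst (by rwa [him])) ?_ fun g hg => hD0 _ _ hg (him x)
    exact (hD.comp (by fun_prop : Differentiable ℂ
      fun g : ℂ => (g, (x : ℂ) + y * Complex.I))).differentiableOn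

/-- The integral over the shifted contour `Im x = y`, for poles on one side. -/
def shiftIntegral (D : ℂ × ℂ → ℂ) (y : ℝ) (H : ℂ × ℂ → ℂ) (g : ℂ) : ℂ :=
  ∫ x : ℝ in (0 : ℝ)..1, H (g, x + y * Complex.I) / D (g, x + y * Complex.I)

/-- The zeros of `poleUp` lie at Im x = Im g − Im a_i < 0, so with the other family absent the
contour rises freely. On Im x = y the integral still makes sense up to Im g < C when C ≤ Im a_i + y,
which gives the continuation. -/
lemma poleIntegral_eq_shift_up (hH : IsAdmissible C L H) {y : ℝ} (hy0 : 0 ≤ y) (hy : y < L)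
    {A : Finset ι} {g : ℂ} (hg : g.im < C) (hgA : ∀ i ∈ A, g.im < (a i).im) :
    poleIntegral a A ∅ H g = shiftIntegral (poleUp a A) y H g := by
  have := contour_shift (f := fun x => H (g, x) / poleUp a A (g, x))
    (fun x => by rw [hH.periodic, poleUp_periodic]) 0 y (by
      refine DifferentiableOn.div ((hH.diff_snd hg).mono fun x hx => ?_)
        ((differentiable_poleUp a A).comp (by fun_prop : Differentiable ℂ
          fun x : ℂ => (g, x))).differentiableOn fun x hx => poleUp_ne_zero fun i hi => ?_
      · rw [Set.mem_ofPred_eq, Set.uIcc_of_le hy0] at hx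
        rw [Set.mem_ofPred_eq, abs_lt]
        exact ⟨by linarith [hx.1], by linarith [hx.2]⟩
      · rw [Set.mem_ofPred_eq, Set.uIcc_of_le hy0] at hx
        linarith [hgA i hi, hx.1])
  simpa [poleIntegral, shiftIntegral, poleDown] using this

lemma poleIntegral_eq_shift_down (hH : IsAdmissible C L H) {y : ℝ} (hy0 : 0 ≤ y) (hy : y < L)
    {B : Finset ι} {g : ℂ} (hg : g.im < C) (hgB : ∀ i ∈ B, g.im < (a i).im) :
    poleIntegral a ∅ B H g = shiftIntegral (poleDown a B) (-y) H g := by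
  have := contour_shift (f := fun x => H (g, x) / poleDown a B (g, x))
    (fun x => by rw [hH.periodic, poleDown_periodic]) 0 (-y) (by
      refine DifferentiableOn.div ((hH.diff_snd hg).mono fun x hx => ?_)
        ((differentiable_poleDown a B).comp (by fun_prop : Differentiable ℂ
          fun x : ℂ => (g, x))).differentiableOn fun x hx => poleDown_ne_zero fun i hi => ?_
      · rw [Set.mem_ofPred_eq, Set.uIcc_of_ge (by linarith)] at hx
        rw [Set.mem_ofPred_eq, abs_lt]
        exact ⟨by linarith [hx.1], by linarith [hx.2]⟩
      · rw [Set.mem_ofPred_eq, Set.uIcc_of_ge (by linarith)] at hx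
        linarith [hgB i hi, hx.2])
  simpa [poleIntegral, shiftIntegral, poleUp] using this

lemma differentiableOn_shift_up (hH : IsAdmissible C L H) {y : ℝ} (hy0 : 0 ≤ y) (hy : y < L)
    {A : Finset ι} (hA : ∀ i ∈ A, C ≤ (a i).im + y) :
    DifferentiableOn ℂ (shiftIntegral (poleUp a A) y H) {g | g.im < C} :=
  hH.differentiableOn_integral (by rwa [abs_of_nonneg hy0]) (differentiable_poleUp a A)
    fun g x hg hx => poleUp_ne_zero fun i hi => by rw [hx]; linarith [hA i hi]

lemma differentiableOn_shift_down (hH : IsAdmissible C L H) {y : ℝ} (hy0 : 0 ≤ y) (hy : y < L)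
    {A : Finset ι} (hA : ∀ i ∈ A, C ≤ (a i).im + y) :
    DifferentiableOn ℂ (shiftIntegral (poleDown a A) (-y) H) {g | g.im < C} :=
  hH.differentiableOn_integral (by rwa [abs_neg, abs_of_nonneg hy0]) (differentiable_poleDown a A)
    fun g x hg hx => poleDown_ne_zero fun i hi => by rw [hx]; linarith [hA i hi]

lemma continuous_poleIntegrand (hH : IsAdmissible C L H) (hL : 0 < L) {A B : Finset ι} {g : ℂ}
    (hg : g.im < C) (hgA : ∀ i ∈ A, g.im < (a i).im) (hgB : ∀ i ∈ B, g.im < (a i).im) :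
    Continuous fun x : ℝ => H (g, x) / (poleUp a A (g, x) * poleDown a B (g, x)) := by
  have hm : Continuous fun x : ℝ => (g, (x : ℂ)) := by fun_prop
  refine Continuous.div ?_ (((differentiable_poleUp a A).continuous.comp hm).mul
    ((differentiable_poleDown a B).continuous.comp hm)) fun x => ?_
  · rw [← continuousOn_univ]
    exact hH.diff.continuousOn.comp hm.continuousOn fun x _ => ⟨hg, by simpa using hL⟩
  · exact mul_ne_zero (poleUp_ne_zero fun i hi => by simpa using hgA i hi)
      (poleDown_ne_zero fun i hi => by simpa using hgB i hi)

/-- Let u and v be the exponentials of one pole from each family. Then 1/((1 − u)(1 − v)) = (1/(1 −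
u) + v/(1 − v))/(1 − uv), and uv does not depend on x. The factor v is absorbed into the numerator.
-/
lemma poleIntegral_step [DecidableEq ι] (hH : IsAdmissible C L H) (hL : 0 < L) {A B : Finset ι}
    {g : ℂ} (hg : g.im < C) (hgA : ∀ i ∈ A, g.im < (a i).im) (hgB : ∀ i ∈ B, g.im < (a i).im)
    {i j : ι} (hi : i ∈ A) (hj : j ∈ B) :
    poleIntegral a A B H g = (1 - ee (a i + a j - 2 * g))⁻¹ *
      (poleIntegral a A (B.erase j) H g +
        poleIntegral a (A.erase i) B (fun w => H w * ee (-w.2 + a j - w.1)) g) := by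
  have h1 : 1 - ee (a i + a j - 2 * g) ≠ 0 := one_sub_ee_ne_zero (by
    simp only [Complex.sub_im, Complex.add_im, Complex.mul_im, Complex.re_ofNat, Complex.im_ofNat]
    have := hgA i hi
    have := hgB j hj
    linarith)
  unfold poleIntegral
  rw [← intervalIntegral.integral_add, ← intervalIntegral.integral_const_mul]
  · refine intervalIntegral.integral_congr fun x _ => ?_
    simp only
    have hA0 : poleUp a A (g, x) ≠ 0 := poleUp_ne_zero fun i hi => by simpa using hgA i hi
    have hB0 : poleDown a B (g, x) ≠ 0 := poleDown_ne_zero fun i hi => by simpa using hgB i hi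
    have eA : poleUp a A (g, x) = (1 - ee (x + a i - g)) * poleUp a (A.erase i) (g, x) :=
      (Finset.mul_prod_erase A _ hi).symm
    have eB : poleDown a B (g, x) = (1 - ee (-x + a j - g)) * poleDown a (B.erase j) (g, x) :=
      (Finset.mul_prod_erase B _ hj).symm
    have e : ee (a i + a j - 2 * g) = ee (x + a i - g) * ee (-x + a j - g) := by
      rw [← ee_add]; ring_nf
    rw [e] at h1 ⊢
    rw [eA] at hA0 ⊢
    rw [eB] at hB0 ⊢
    have := left_ne_zero_of_mul hA0
    have := right_ne_zero_of_mul hA0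
    have := left_ne_zero_of_mul hB0
    have := right_ne_zero_of_mul hB0
    generalize ee (x + a i - g) = u at *
    generalize ee (-x + a j - g) = v at *
    field_simp
    ring
  · exact (continuous_poleIntegrand hH hL hg hgA
      (fun i hi => hgB i (Finset.mem_of_mem_erase hi))).intervalIntegrable _ _
  · exact (continuous_poleIntegrand (hH.mul (isAdmissible_ee j)) hL hg
      (fun i hi => hgA i (Finset.mem_of_mem_erase hi)) hgB).intervalIntegrable _ _

lemma analyticAt_one_sub_ee (c g : ℂ) : AnalyticAt ℂ (fun g => 1 - ee (c - 2 * g)) g :=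
  ((differentiable_ee.comp (by fun_prop : Differentiable ℂ
    fun g : ℂ => c - 2 * g)).const_sub 1).analyticAt g

/-- Meromorphic continuation in `g` of an integral with two families of poles. -/
theorem exists_meromorphic_poleIntegral [DecidableEq ι] (hH : IsAdmissible C L H) {y : ℝ}
    (hy0 : 0 ≤ y) (hy : y < L) (A B : Finset ι) (hA : ∀ i ∈ A, C ≤ (a i).im + y)
    (hB : ∀ i ∈ B, C ≤ (a i).im + y) :
    ∃ G : ℂ → ℂ, MeromorphicOn G {g | g.im < C} ∧ ∀ g : ℂ, g.im < C →
      (∀ i ∈ A, g.im < (a i).im) → (∀ i ∈ B, g.im < (a i).im) → G g = poleIntegral a A B H g := by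
  -- Induction on the number of poles: each partial fraction step removes one from either family,
  -- until one family is empty and the contour can be shifted.
  obtain ⟨n, hn⟩ : ∃ n, A.card + B.card = n := ⟨_, rfl⟩
  induction n generalizing A B H with
  | zero =>
    have hA0 : A = ∅ := Finset.card_eq_zero.1 (by omega)
    have hB0 : B = ∅ := Finset.card_eq_zero.1 (by omega)
    subst hA0 hB0
    exact ⟨_, ((differentiableOn_shift_up hH hy0 hy hA).analyticOnNhd
      (isOpen_im_lt C)).meromorphicOn, fun g hg hgA _ =>
        (poleIntegral_eq_shift_up hH hy0 hy hg hgA).symm⟩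
  | succ n ih =>
    rcases A.eq_empty_or_nonempty with rfl | ⟨i, hi⟩
    · exact ⟨_, ((differentiableOn_shift_down hH hy0 hy hB).analyticOnNhd
        (isOpen_im_lt C)).meromorphicOn, fun g hg _ hgB =>
          (poleIntegral_eq_shift_down hH hy0 hy hg hgB).symm⟩
    rcases B.eq_empty_or_nonempty with rfl | ⟨j, hj⟩
    · exact ⟨_, ((differentiableOn_shift_up hH hy0 hy hA).analyticOnNhd
        (isOpen_im_lt C)).meromorphicOn, fun g hg hgA _ =>
          (poleIntegral_eq_shift_up hH hy0 hy hg hgA).symm⟩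
    have hcA := Finset.card_erase_add_one hi
    have hcB := Finset.card_erase_add_one hj
    obtain ⟨G₁, hG₁, hG₁'⟩ := ih hH A (B.erase j) hA
      (fun i hi => hB i (Finset.mem_of_mem_erase hi)) (by omega)
    obtain ⟨G₂, hG₂, hG₂'⟩ := ih (hH.mul (isAdmissible_ee (a := a) j)) (A.erase i) B
      (fun i hi => hA i (Finset.mem_of_mem_erase hi)) hB (by omega)
    refine ⟨fun g => (1 - ee (a i + a j - 2 * g))⁻¹ * (G₁ g + G₂ g), fun g hg =>
      (analyticAt_one_sub_ee _ g).meromorphicAt.inv.mul ((hG₁ g hg).add (hG₂ g hg)),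
      fun g hg hgA hgB => ?_⟩
    rw [poleIntegral_step hH (hy0.trans_lt hy) hg hgA hgB hi hj,
      ← hG₁' g hg hgA fun i hi => hgB i (Finset.mem_of_mem_erase hi),
      ← hG₂' g hg (fun i hi => hgA i (Finset.mem_of_mem_erase hi)) hgB]

end

/-! ### Vanishing residues and pinched contours -/

/-- The two opposite contours of a simple pole agree when the residue vanishes. -/
lemma contour_eq_of_residue_zero {L y : ℝ} (hy : y < L) {h : ℂ → ℂ} {u₀ : ℂ}
    (hh : DifferentiableOn ℂ h {x | |x.im| < L}) (hper : ∀ x, h (x + 1) = h x)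
    (hu : |u₀.im| < y) (h0 : h u₀ = 0) :
    ∫ x : ℝ in (0 : ℝ)..1, h (x + y * Complex.I) / (1 - ee (x + y * Complex.I - u₀)) =
      ∫ x : ℝ in (0 : ℝ)..1,
        h (x + (-y : ℝ) * Complex.I) / (1 - ee (x + (-y : ℝ) * Complex.I - u₀)) := by
  set f := fun x => h x / (1 - ee (x - u₀)) with hf
  have hy0 : 0 ≤ y := (abs_nonneg _).trans hu.le
  have hfper : ∀ x, f (x + 1) = f x := fun x => by
    simp only [hf, hper]
    rw [← ee_add_one (x - u₀)]; ring_nf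
  set D := fun x => 1 - ee (x - u₀) with hD
  have hDd : Differentiable ℂ D := (differentiable_ee.comp (differentiable_id.sub_const u₀)).const_sub 1
  have hD' : deriv D u₀ ≠ 0 := by
    have : HasDerivAt D (-(2 * π * Complex.I * ee (u₀ - u₀))) u₀ :=
      ((hasDerivAt_ee (u₀ - u₀)).comp_sub_const u₀ u₀).const_sub 1
    rw [this.deriv, sub_self, ee_zero, mul_one, neg_ne_zero]
    exact Complex.two_pi_I_ne_zero
  have hS : IsOpen {x : ℂ | |x.im| < L} :=
    isOpen_lt (f := fun w : ℂ => |w.im|) (by fun_prop) continuous_const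
  have huS : u₀ ∈ {x : ℂ | |x.im| < L} := hu.trans hy
  -- Dividing numerator and denominator by x − u₀ extends f holomorphically across u₀, since h
  -- vanishes there and D has a simple zero.
  set q := fun x => dslope h u₀ x / dslope D u₀ x with hq
  have hqf : ∀ x, x ≠ u₀ → q x = f x := fun x hx => by
    have hx' : x - u₀ ≠ 0 := sub_ne_zero.2 hx
    simp only [hq, hf, dslope_of_ne _ hx, slope_def_field, h0]
    have : D u₀ = 0 := by simp [hD, ee_zero]
    rw [this, sub_zero, sub_zero, div_div_div_cancel_right₀ hx']
  -- The zeros of D are the integer translates of u₀. In the strip of width one centred at u₀ only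
  -- u₀ itself occurs, and it stays off the vertical sides.
  set c := u₀.re - 1 / 2 with hc
  have key := rectangle_shift (f := q) c y (-y) ?_ ?_
  · rw [← periodic_intervalIntegral hfper c y, ← periodic_intervalIntegral hfper c (-y)]
    refine Eq.trans ?_ (key.trans ?_) <;> refine intervalIntegral.integral_congr fun x _ => ?_
    · refine (hqf _ fun he => ?_).symm
      have := congrArg Complex.im he
      simp at this
      rw [← this, abs_of_nonneg hy0] at hu
      exact lt_irrefl _ hu
    · refine hqf _ fun he => ?_
      have := congrArg Complex.im he
      simp at this
      rw [← this, abs_neg, abs_of_nonneg hy0] at hu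
      exact lt_irrefl _ hu
  · refine DifferentiableOn.div
      (((Complex.differentiableOn_dslope (hS.mem_nhds huS)).2 hh).mono fun x hx => ?_)
      (((Complex.differentiableOn_dslope Filter.univ_mem).2 hDd.differentiableOn).mono
        (Set.subset_univ _)) fun x hx => ?_
    · have := hx.2
      rw [Set.mem_preimage, Set.uIcc_of_ge (by linarith)] at this
      rw [Set.mem_ofPred_eq, abs_lt]
      exact ⟨by linarith [this.1], by linarith [this.2]⟩
    · by_cases hxu : x = u₀
      · rw [hxu, dslope_same]; exact hD'
      · rw [dslope_of_ne _ hxu, slope_def_field]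
        have : D u₀ = 0 := by simp [hD, ee_zero]
        rw [this, sub_zero]
        refine div_ne_zero (fun h1 => ?_) (sub_ne_zero.2 hxu)
        obtain ⟨n, hn⟩ := (ee_eq_one_iff (x - u₀)).1 (sub_eq_zero.1 h1).symm
        have hre := congrArg Complex.re hn
        rw [Complex.sub_re, Complex.intCast_re] at hre
        have h2 := hx.1
        rw [Set.mem_preimage, Set.mem_Icc] at h2
        have h3 : (-1 : ℝ) < n := by linarith
        have h4 : (n : ℝ) < 1 := by linarith
        have h5 : n = 0 := by
          have : (-1 : ℤ) < n := by exact_mod_cast h3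
          have : n < (1 : ℤ) := by exact_mod_cast h4
          omega
        rw [h5, Int.cast_zero] at hn
        exact hxu (sub_eq_zero.1 hn)
  · intro y'
    rw [hqf, hqf, ← hfper (c + _)]
    · push_cast; ring_nf
    · intro he
      have := congrArg Complex.re he
      simp [hc] at this
    · intro he
      have := congrArg Complex.re he
      simp [hc] at this
      linarith

section
variable {C L : ℝ} {a : ι → ℂ}

lemma eventually_one_sub_ee_ne_zero (g₀ : ℂ) :
    ∀ᶠ g in 𝓝[≠] g₀, 1 - ee (2 * (g₀ - g)) ≠ 0 := by
  have : HasDerivAt (fun g => 1 - ee (2 * (g₀ - g)))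
      (-(2 * π * Complex.I * ee (2 * (g₀ - g₀)) * (2 * -1))) g₀ := by
    have h : HasDerivAt (fun g => 2 * (g₀ - g)) (2 * -1) g₀ :=
      ((hasDerivAt_id g₀).const_sub g₀).const_mul 2
    exact ((hasDerivAt_ee (2 * (g₀ - g₀))).comp g₀ h).const_sub 1
  have h2 := this.eventually_ne (c := 0) (by
    rw [sub_self, mul_zero, ee_zero]
    simp)
  exact h2

/-- Near a point `g₀` where poles of the two families pinch the contour in disjoint pairs, the
continued integral has at most a simple pole, with residue determined by the values of the
numerator at the pinching points. -/
theorem exists_pinch_poleIntegral [DecidableEq ι] {H : ℂ × ℂ → ℂ} (hH : IsAdmissible C L H)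
    {y : ℝ} (hy0 : 0 ≤ y) (hy : y < L) {g₀ : ℂ} (hg₀ : g₀.im < C) (A B : Finset ι)
    (hA : ∀ i ∈ A, C ≤ (a i).im + y) (hB : ∀ i ∈ B, C ≤ (a i).im + y)
    (hmA : ∀ i ∈ A, ∀ i' ∈ A, ∀ j ∈ B, ee (a i + a j - 2 * g₀) = 1 →
      ee (a i' + a j - 2 * g₀) = 1 → i = i')
    (hmB : ∀ i ∈ A, ∀ j ∈ B, ∀ j' ∈ B, ee (a i + a j - 2 * g₀) = 1 →
      ee (a i + a j' - 2 * g₀) = 1 → j = j') :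
    ∃ G : ℂ → ℂ, MeromorphicOn G {g | g.im < C} ∧ (∀ g : ℂ, g.im < C →
      (∀ i ∈ A, g.im < (a i).im) → (∀ i ∈ B, g.im < (a i).im) → G g = poleIntegral a A B H g) ∧
      ∃ K : ℂ → ℂ, AnalyticAt ℂ K g₀ ∧
        (∀ᶠ g in 𝓝[≠] g₀, G g * (1 - ee (2 * (g₀ - g))) = K g) ∧
        ((∀ i ∈ A, ∀ j ∈ B, ee (a i + a j - 2 * g₀) = 1 → H (g₀, g₀ - a i) = 0) → K g₀ = 0) := by
  have hC := isOpen_im_lt C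
  -- When one family is empty the continuation is analytic at g₀, so its product with 1 −
  -- e^{2πi·2(g₀ − g)} vanishes there unconditionally.
  have hbase : ∀ G : ℂ → ℂ, DifferentiableOn ℂ G {g | g.im < C} → MeromorphicOn G {g | g.im < C} ∧
      ∃ K : ℂ → ℂ, AnalyticAt ℂ K g₀ ∧
        (∀ᶠ g in 𝓝[≠] g₀, G g * (1 - ee (2 * (g₀ - g))) = K g) ∧ K g₀ = 0 := fun G hG => by
    have hG' := hG.analyticOnNhd hC
    refine ⟨hG'.meromorphicOn, _, (hG' g₀ hg₀).mul (analyticAt_one_sub_ee (2 * g₀) g₀),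
      Eventually.of_forall fun g => by simp only [Pi.mul_apply, mul_sub], ?_⟩
    simp [ee_zero]
  obtain ⟨n, hn⟩ : ∃ n, A.card + B.card = n := ⟨_, rfl⟩
  induction n generalizing A B H with
  | zero =>
    have hA0 : A = ∅ := Finset.card_eq_zero.1 (by omega)
    have hB0 : B = ∅ := Finset.card_eq_zero.1 (by omega)
    subst hA0 hB0
    obtain ⟨h1, K, h2, h3, h4⟩ := hbase _ (differentiableOn_shift_up hH hy0 hy hA)
    exact ⟨_, h1, fun g hg hgA _ => (poleIntegral_eq_shift_up hH hy0 hy hg hgA).symm,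
      K, h2, h3, fun _ => h4⟩
  | succ n ih =>
    rcases A.eq_empty_or_nonempty with rfl | ⟨i, hi⟩
    · obtain ⟨h1, K, h2, h3, h4⟩ := hbase _ (differentiableOn_shift_down hH hy0 hy hB)
      exact ⟨_, h1, fun g hg _ hgB => (poleIntegral_eq_shift_down hH hy0 hy hg hgB).symm,
        K, h2, h3, fun _ => h4⟩
    rcases B.eq_empty_or_nonempty with rfl | ⟨j, hj⟩
    · obtain ⟨h1, K, h2, h3, h4⟩ := hbase _ (differentiableOn_shift_up hH hy0 hy hA)
      exact ⟨_, h1, fun g hg hgA _ => (poleIntegral_eq_shift_up hH hy0 hy hg hgA).symm,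
        K, h2, h3, fun _ => h4⟩
    -- If every pair pinches, disjointness leaves one pole in each family and the residue is
    -- computed directly. Otherwise a pair that does not pinch is split off, at the cost of a factor
    -- analytic at g₀, so no pole order is gained.
    by_cases hall : ∀ i ∈ A, ∀ j ∈ B, ee (a i + a j - 2 * g₀) = 1
    · have hAi : A = {i} := Finset.eq_singleton_iff_unique_mem.2
        ⟨hi, fun i' hi' => hmA _ hi' _ hi j hj (hall _ hi' _ hj) (hall _ hi _ hj)⟩
      have hBj : B = {j} := Finset.eq_singleton_iff_unique_mem.2
        ⟨hj, fun j' hj' => hmB i hi _ hj' _ hj (hall _ hi _ hj') (hall _ hi _ hj)⟩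
      have hHv := hH.mul (isAdmissible_ee (a := a) j)
      have hpin := hall i hi j hj
      subst hAi hBj
      have hU := (differentiableOn_shift_up hH hy0 hy hA).analyticOnNhd hC
      have hV := (differentiableOn_shift_down hHv hy0 hy hB).analyticOnNhd hC
      set U := shiftIntegral (poleUp a {i}) y H
      set V := shiftIntegral (poleDown a {j}) (-y) fun w => H w * ee (-w.2 + a j - w.1)
      refine ⟨fun g => (1 - ee (a i + a j - 2 * g))⁻¹ * (U g + V g), fun g hg =>
        (analyticAt_one_sub_ee _ g).meromorphicAt.inv.mul
          ((hU g hg).add (hV g hg)).meromorphicAt, fun g hg hgA hgB => ?_,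
        fun g => U g + V g, (hU g₀ hg₀).add (hV g₀ hg₀), ?_, fun hvan => ?_⟩
      · rw [poleIntegral_step hH (hy0.trans_lt hy) hg hgA hgB hi hj, Finset.erase_singleton,
          Finset.erase_singleton, poleIntegral_eq_shift_up hH hy0 hy hg hgA,
          poleIntegral_eq_shift_down hHv hy0 hy hg hgB]
      · filter_upwards [eventually_one_sub_ee_ne_zero g₀] with g hg
        have e : ee (a i + a j - 2 * g) = ee (2 * (g₀ - g)) := by
          rw [← one_mul (ee (2 * (g₀ - g))), ← hpin, ← ee_add]; ring_nf
        rw [e]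
        field_simp
      · have h0 := hvan i hi j hj hpin
        -- One bound comes from C ≤ Im a_i + y. For the other, pinching forces Im a_i − Im g₀ = Im
        -- g₀ − Im a_j, and `hB` applies.
        have hu : |(g₀ - a i).im| < y := by
          have h1 := hA i hi
          have h2 := hB j hj
          obtain ⟨m, hm⟩ := (ee_eq_one_iff _).1 hpin
          have h3 := congrArg Complex.im hm
          simp only [Complex.sub_im, Complex.add_im, Complex.mul_im, Complex.re_ofNat,
            Complex.im_ofNat, Complex.intCast_im] at h3
          rw [Complex.sub_im, abs_lt]
          constructor <;> linarith
        -- At g₀ one has uv = 1, hence v/(1 − v) = −1/(1 − u). So U + V is the difference of one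
        -- integrand over the lines Im x = y and Im x = −y, which is zero when the residue at g₀ −
        -- a_i vanishes.
        have key := contour_eq_of_residue_zero hy (hH.diff_snd hg₀) (hH.periodic g₀) hu h0
        have eU : U g₀ = _ := Eq.trans (intervalIntegral.integral_congr fun x _ => by
          simp only [poleUp, Finset.prod_singleton]; rw [sub_sub_eq_add_sub]) key
        have eV : V g₀ = -∫ x : ℝ in (0 : ℝ)..1, H (g₀, x + (-y : ℝ) * Complex.I) /
            (1 - ee (x + (-y : ℝ) * Complex.I - (g₀ - a i))) := by
          rw [← intervalIntegral.integral_neg]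
          refine intervalIntegral.integral_congr fun x _ => ?_
          simp only [poleDown, Finset.prod_singleton]
          set w : ℂ := x + (-y : ℝ) * Complex.I with hw
          have e : ee (-w + a j - g₀) = (ee (w - (g₀ - a i)))⁻¹ := by
            rw [← ee_neg, ← mul_one (ee (-(w - (g₀ - a i)))), ← hpin, ← ee_add]; ring_nf
          have h1 : 1 - ee (w - (g₀ - a i)) ≠ 0 := one_sub_ee_ne_zero (by
            have : w.im = -y := by simp [hw]
            rw [Complex.sub_im, this]
            have := (abs_lt.1 hu).1
            linarith)
          have h2 := ee_ne_zero (w - (g₀ - a i))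
          rw [e]
          generalize ee (w - (g₀ - a i)) = E at *
          have h3 : 1 - E⁻¹ ≠ 0 := fun h => h1 (by field_simp at h; linear_combination -h)
          have h4 : E - 1 ≠ 0 := fun h => h1 (by linear_combination -h)
          field_simp
          ring
        simp only
        rw [eU, eV, add_neg_cancel]
    · push Not at hall
      obtain ⟨i, hi, j, hj, hij⟩ := hall
      have hcA := Finset.card_erase_add_one hi
      have hcB := Finset.card_erase_add_one hj
      have sA : ∀ i' ∈ A.erase i, i' ∈ A := fun _ => Finset.mem_of_mem_erase
      have sB : ∀ j' ∈ B.erase j, j' ∈ B := fun _ => Finset.mem_of_mem_erase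
      obtain ⟨G₁, hG₁, hG₁', K₁, hK₁, hGK₁, hv₁⟩ := ih hH A (B.erase j) hA
        (fun i hi => hB i (sB i hi)) (fun i hi i' hi' j hj => hmA i hi i' hi' j (sB j hj))
        (fun i hi j hj j' hj' => hmB i hi j (sB j hj) j' (sB j' hj')) (by omega)
      obtain ⟨G₂, hG₂, hG₂', K₂, hK₂, hGK₂, hv₂⟩ := ih (hH.mul (isAdmissible_ee (a := a) j))
        (A.erase i) B (fun i hi => hA i (sA i hi)) hB
        (fun i hi i' hi' => hmA i (sA i hi) i' (sA i' hi'))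
        (fun i hi => hmB i (sA i hi)) (by omega)
      refine ⟨fun g => (1 - ee (a i + a j - 2 * g))⁻¹ * (G₁ g + G₂ g), fun g hg =>
        (analyticAt_one_sub_ee _ g).meromorphicAt.inv.mul ((hG₁ g hg).add (hG₂ g hg)),
        fun g hg hgA hgB => ?_, fun g => (1 - ee (a i + a j - 2 * g))⁻¹ * (K₁ g + K₂ g),
        ((analyticAt_one_sub_ee _ g₀).inv (sub_ne_zero.2 (Ne.symm hij))).mul (hK₁.add hK₂),
        ?_, fun hvan => ?_⟩
      · rw [poleIntegral_step hH (hy0.trans_lt hy) hg hgA hgB hi hj,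
          ← hG₁' g hg hgA fun i hi => hgB i (sB i hi),
          ← hG₂' g hg (fun i hi => hgA i (sA i hi)) hgB]
      · filter_upwards [hGK₁, hGK₂] with g h1 h2
        rw [← h1, ← h2]; ring
      · simp only
        rw [hv₁ fun i hi j hj h => hvan i hi j (sB j hj) h,
          hv₂ fun i hi j hj h => by rw [hvan i (sA i hi) j hj h, zero_mul], add_zero, mul_zero]

end

/-! ### Identity theorem for meromorphic functions -/

/-- The order of f − h is infinite at one point, hence at every point of a preconnected set. -/
lemma MeromorphicOn.eventuallyEq_of_eventuallyEq {f h : ℂ → ℂ} {U : Set ℂ}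
    (hf : MeromorphicOn f U) (hh : MeromorphicOn h U) (hU : IsPreconnected U) {x y : ℂ}
    (hx : x ∈ U) (hy : y ∈ U) (he : f =ᶠ[𝓝[≠] x] h) : f =ᶠ[𝓝[≠] y] h := by
  have hsub : MeromorphicOn (f - h) U := hf.sub hh
  have h1 : meromorphicOrderAt (f - h) x = ⊤ := by
    rw [meromorphicOrderAt_eq_top_iff]
    filter_upwards [he] with w hw
    rw [Pi.sub_apply, hw, sub_self]
  have h2 : meromorphicOrderAt (f - h) y = ⊤ := by
    by_contra hne
    exact hsub.meromorphicOrderAt_ne_top_of_isPreconnected hU hy hx hne h1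
  rw [meromorphicOrderAt_eq_top_iff] at h2
  filter_upwards [h2] with w hw
  exact sub_eq_zero.1 hw

lemma isPreconnected_im_lt (C : ℝ) : IsPreconnected {g : ℂ | g.im < C} :=
  (convex_halfSpace_im_lt C).isPreconnected

lemma AnalyticAt.eq_of_eventuallyEq {f h : ℂ → ℂ} {x : ℂ} (hf : AnalyticAt ℂ f x)
    (hh : AnalyticAt ℂ h x) (he : f =ᶠ[𝓝[≠] x] h) : f x = h x :=
  ((hf.continuousAt.eventuallyEq_nhds_iff_eventuallyEq_nhdsNE hh.continuousAt).1 he).eq_of_nhds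

lemma eventually_codiscrete_ne_zero {f : ℂ → ℂ} (hf : Differentiable ℂ f) {x : ℂ} (hx : f x ≠ 0) :
    ∀ᶠ z in codiscrete ℂ, f z ≠ 0 :=
  AnalyticOnNhd.preimage_zero_mem_codiscrete (fun z _ => hf.analyticAt z) hx

lemma eventually_codiscrete_iff {P : ℂ → Prop} :
    (∀ᶠ z in codiscrete ℂ, P z) ↔ ∀ x, ∀ᶠ z in 𝓝[≠] x, P z := by
  simp [Filter.Eventually, mem_codiscrete, disjoint_principal_right]

/-! ### The integrand -/

section
variable {τ η : ℂ}

/-- The part of the integrand holomorphic in a large region. -/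
def integrandNum (τ η z : ℂ) (s : Finset (ℕ × ℕ)) (Φ : ℂ → ℂ) (w : ℂ × ℂ) : ℂ :=
  dprod τ η (τ + 2 * η - (z + w.2 - w.1)) * dprod τ η (τ + 2 * η - (z - w.2 - w.1)) *
    dprod τ η (τ + 2 * η - (-z + w.2 - w.1)) * dprod τ η (τ + 2 * η - (-z - w.2 - w.1)) /
    (drest τ η s (z + w.2 - w.1) * drest τ η s (z - w.2 - w.1) *
      drest τ η s (-z + w.2 - w.1) * drest τ η s (-z - w.2 - w.1)) *
    (reflFactor τ η (2 * w.2) * reflFactor τ η (-2 * w.2)) * Φ w.2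

/-- The positions of the poles. -/
def polePos (τ η z : ℂ) : (ℕ × ℕ) ⊕ (ℕ × ℕ) → ℂ :=
  Sum.elim (fun nm => z + lat τ η nm) fun nm => -z + lat τ η nm

lemma poleUp_polePos (z : ℂ) (s t : Finset (ℕ × ℕ)) (g x : ℂ) :
    poleUp (polePos τ η z) (s.disjSum t) (g, x) =
      dfin τ η s (z + x - g) * dfin τ η t (-z + x - g) := by
  rw [poleUp, Finset.prod_disjSum]
  congr 1 <;> refine Finset.prod_congr rfl fun nm _ => ?_ <;> simp only [polePos, Sum.elim_inl,
    Sum.elim_inr] <;> ring_nf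

lemma poleDown_polePos (z : ℂ) (s t : Finset (ℕ × ℕ)) (g x : ℂ) :
    poleDown (polePos τ η z) (s.disjSum t) (g, x) =
      dfin τ η s (z - x - g) * dfin τ η t (-z - x - g) := by
  rw [poleDown, Finset.prod_disjSum]
  congr 1 <;> refine Finset.prod_congr rfl fun nm _ => ?_ <;> simp only [polePos, Sum.elim_inl,
    Sum.elim_inr] <;> ring_nf

/-- The prefactor `(q;q)(p;p) / (2 Γ(-2g))`. -/
def spinFactor (τ η g : ℂ) : ℂ :=
  qPoch (base (2 * η)) (base (2 * η)) * qPoch (base τ) (base τ) / 2 *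
    (dprod τ η (-2 * g) / dprod τ η (τ + 2 * η + 2 * g))

lemma neg_abs_le_polePos_im (hτ : 0 < τ.im) (hη : 0 < η.im) (z : ℂ) (i : (ℕ × ℕ) ⊕ (ℕ × ℕ)) :
    -|z.im| ≤ (polePos τ η z i).im := by
  rcases i with nm | nm <;> simp only [polePos, Sum.elim_inl, Sum.elim_inr, Complex.add_im,
    Complex.neg_im] <;> have := lat_im_nonneg hτ hη nm
  · linarith [neg_abs_le z.im]
  · linarith [le_abs_self z.im]

lemma lt_neg_abs_iff (g z : ℂ) : g.im < -|z.im| ↔ 0 < (-g + z).im ∧ 0 < (-g - z).im := by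
  rw [lt_neg, abs_lt]
  simp only [Complex.add_im, Complex.sub_im, Complex.neg_im]
  constructor
  · rintro ⟨h1, h2⟩; constructor <;> linarith
  · rintro ⟨h1, h2⟩; constructor <;> linarith

/-- The kernel `Γ(±z ± x - g) / Γ(-2g, ±2x)`. -/
def spinKernel (τ η g z x : ℂ) : ℂ :=
  ellGamma τ η (z + x - g) * ellGamma τ η (z - x - g) *
      ellGamma τ η (-z + x - g) * ellGamma τ η (-z - x - g) /
    (ellGamma τ η (-2 * g) * ellGamma τ η (2 * x) * ellGamma τ η (-2 * x))

/-- Real x keeps Γ(±2x) away from its zeros, so the reflection factors may replace 1/Γ(±2x). The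
rest is a regrouping of quotients that survives the convention 1/0 = 0, so no condition on g or z is
needed. -/
lemma spinKernel_mul_eq (hτ : 0 < τ.im) (hη : 0 < η.im) (s : Finset (ℕ × ℕ)) (Φ : ℂ → ℂ)
    (g z : ℂ) (x : ℝ) :
    spinKernel τ η g z x * Φ x = dprod τ η (-2 * g) / dprod τ η (τ + 2 * η + 2 * g) *
      (integrandNum τ η z s Φ (g, x) / (poleUp (polePos τ η z) (s.disjSum s) (g, x) *
        poleDown (polePos τ η z) (s.disjSum s) (g, x))) := by
  have hre : ∀ w : ℂ, w.im = 0 → dprod τ η (τ + 2 * η + w) ≠ 0 := fun w hw =>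
    dprod_ne_zero_of_im_pos hτ hη (by
      rw [Complex.add_im, Complex.add_im, hw]
      have := im_two_mul_pos hη
      linarith)
  have h1 := inv_ellGamma_mul (z := 2 * (x : ℂ)) hτ hη (hre _ (by simp))
    (by rw [sub_eq_add_neg]; exact hre _ (by simp))
  have e1 : ellGamma τ η (-2 * g) * ellGamma τ η (2 * x) * ellGamma τ η (-2 * x) =
      ellGamma τ η (-2 * g) * (ellGamma τ η (2 * x) * ellGamma τ η (-(2 * x))) := by ring_nf
  rw [spinKernel, poleUp_polePos, poleDown_polePos, e1, div_eq_mul_inv, mul_inv, h1, integrandNum]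
  simp only [ellGamma_eq hτ hη]
  rw [dprod_eq_dfin_mul_drest hτ hη s (z + x - g), dprod_eq_dfin_mul_drest hτ hη s (z - x - g),
    dprod_eq_dfin_mul_drest hτ hη s (-z + x - g), dprod_eq_dfin_mul_drest hτ hη s (-z - x - g)]
  have e2 : τ + 2 * η - -2 * g = τ + 2 * η + 2 * g := by ring
  have e3 : -(2 * (x : ℂ)) = -2 * x := by ring
  rw [e2, e3]
  simp only [div_eq_mul_inv, mul_inv, inv_inv]
  ring

lemma intertwinerIntegral_eq (hτ : 0 < τ.im) (hη : 0 < η.im) (s : Finset (ℕ × ℕ)) (Φ : ℂ → ℂ)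
    (g z : ℂ) :
    intertwinerIntegral τ η g Φ z = spinFactor τ η g *
      poleIntegral (polePos τ η z) (s.disjSum s) (s.disjSum s) (integrandNum τ η z s Φ) g := by
  rw [intertwinerIntegral, spinFactor, mul_assoc (_ / 2) (_ / _), poleIntegral,
    ← intervalIntegral.integral_const_mul (dprod τ η (-2 * g) / dprod τ η (τ + 2 * η + 2 * g))]
  congr 1
  exact intervalIntegral.integral_congr fun x _ => spinKernel_mul_eq hτ hη s Φ g z x

lemma exists_finset_lat (hτ : 0 < τ.im) (hη : 0 < η.im) (Y : ℝ) :
    ∃ s : Finset (ℕ × ℕ), (0, 0) ∈ s ∧ ∀ nm ∉ s, Y < (lat τ η nm).im := by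
  obtain ⟨N₁, hN₁⟩ := exists_nat_gt (Y / τ.im)
  obtain ⟨N₂, hN₂⟩ := exists_nat_gt (Y / (2 * η.im))
  rw [div_lt_iff₀ (by positivity)] at hN₁ hN₂
  refine ⟨Finset.range (N₁ + 1) ×ˢ Finset.range (N₂ + 1), by simp, ?_⟩
  rintro ⟨j, k⟩ h
  rw [lat_im]
  simp only [Finset.mem_product, Finset.mem_range, not_and_or, not_lt] at h
  rcases h with h | h
  · have h1 : (N₁ : ℝ) + 1 ≤ j := by exact_mod_cast h
    have h2 : 0 ≤ (k : ℝ) * (2 * η.im) := by positivity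
    nlinarith
  · have h1 : (N₂ : ℝ) + 1 ≤ k := by exact_mod_cast h
    have h2 : 0 ≤ (j : ℝ) * τ.im := by positivity
    nlinarith

/-- For Im g < C and |Im x| < L the arguments ±z ± x − g have imaginary part above −(C + L + |Im
z|); every factor kept in `drest` is shifted by more than that, so none vanishes. -/
lemma isAdmissible_integrandNum (hτ : 0 < τ.im) (hη : 0 < η.im) {C L : ℝ} {z : ℂ}
    {s : Finset (ℕ × ℕ)} (hs : ∀ nm ∉ s, C + L + |z.im| < (lat τ η nm).im) {Φ : ℂ → ℂ}
    (hΦ : IsTestFunction Φ) : IsAdmissible C L (integrandNum τ η z s Φ) := by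
  have hD := differentiable_dprod hτ hη
  have hR := differentiable_drest hτ hη s
  have hW := differentiable_reflFactor hτ hη
  have hne : ∀ g x u : ℂ, g.im < C → |x.im| < L → -|z.im| - |x.im| - g.im ≤ u.im →
      drest τ η s u ≠ 0 := fun g x u hg hx hu => drest_ne_zero hτ hη fun nm hnm h => by
    refine one_sub_ee_ne_zero (u := u + lat τ η nm) ?_ (by rw [h, sub_self])
    rw [Complex.add_im]
    have := hs nm hnm
    linarith
  have d1 : Differentiable ℂ fun w : ℂ × ℂ => z + w.2 - w.1 := by fun_prop
  have d2 : Differentiable ℂ fun w : ℂ × ℂ => z - w.2 - w.1 := by fun_prop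
  have d3 : Differentiable ℂ fun w : ℂ × ℂ => -z + w.2 - w.1 := by fun_prop
  have d4 : Differentiable ℂ fun w : ℂ × ℂ => -z - w.2 - w.1 := by fun_prop
  constructor
  · unfold integrandNum
    simp only [div_eq_mul_inv]
    refine ((DifferentiableOn.mul ?_ (DifferentiableOn.fun_inv ?_ ?_)).mul ?_).mul ?_
    · exact ((((hD.comp (d1.const_sub _)).mul (hD.comp (d2.const_sub _))).mul
        (hD.comp (d3.const_sub _))).mul (hD.comp (d4.const_sub _))).differentiableOn
    · exact ((((hR.comp d1).mul (hR.comp d2)).mul (hR.comp d3)).mul (hR.comp d4)).differentiableOn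
    · rintro ⟨g, x⟩ ⟨hg, hx⟩
      have h1 := neg_abs_le x.im
      have h2 := le_abs_self x.im
      have h3 := neg_abs_le z.im
      have h4 := le_abs_self z.im
      refine mul_ne_zero (mul_ne_zero (mul_ne_zero ?_ ?_) ?_) ?_ <;> refine hne g x _ hg hx ?_ <;>
        simp only [Complex.sub_im, Complex.add_im, Complex.neg_im] <;> linarith
    · exact ((hW.comp (by fun_prop : Differentiable ℂ fun w : ℂ × ℂ => 2 * w.2)).mul
        (hW.comp (by fun_prop : Differentiable ℂ fun w : ℂ × ℂ => -2 * w.2))).differentiableOn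
    · exact (hΦ.1.comp differentiable_snd).differentiableOn
  · intro g x
    simp only [integrandNum]
    have e1 : z + (x + 1) - g = z + x - g + 1 := by ring
    have e2 : -z + (x + 1) - g = -z + x - g + 1 := by ring
    have e3 : z - x - g = z - (x + 1) - g + 1 := by ring
    have e4 : -z - x - g = -z - (x + 1) - g + 1 := by ring
    have e5 : τ + 2 * η - (z + x - g) = τ + 2 * η - (z + x - g + 1) + 1 := by ring
    have e6 : τ + 2 * η - (-z + x - g) = τ + 2 * η - (-z + x - g + 1) + 1 := by ring
    have e7 : τ + 2 * η - (z - (x + 1) - g) = τ + 2 * η - (z - (x + 1) - g + 1) + 1 := by ring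
    have e8 : τ + 2 * η - (-z - (x + 1) - g) = τ + 2 * η - (-z - (x + 1) - g + 1) + 1 := by ring
    have e9 : 2 * (x + 1) = 2 * x + 1 + 1 := by ring
    have e10 : -2 * x = -2 * (x + 1) + 1 + 1 := by ring
    rw [hΦ.2, e1, e2, e3, e4, e7, e8, e5, e6, e9, reflFactor_add_one, reflFactor_add_one, e10,
      reflFactor_add_one, reflFactor_add_one]
    simp only [dprod_add_one, drest_add_one]

lemma eventually_dprod_ne_zero (hτ : 0 < τ.im) (hη : 0 < η.im) (g₀ : ℂ) :
    ∀ᶠ g in 𝓝[≠] g₀, dprod τ η (τ + 2 * η + 2 * g) ≠ 0 := by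
  refine eventually_codiscrete_iff.1 (eventually_codiscrete_ne_zero (x := 0)
    ((differentiable_dprod hτ hη).comp (by fun_prop : Differentiable ℂ
      fun g : ℂ => τ + 2 * η + 2 * g)) ?_) g₀
  refine dprod_ne_zero_of_im_pos hτ hη ?_
  have := im_two_mul_pos hη
  simp only [Complex.add_im, mul_zero, Complex.zero_im] at *
  linarith

lemma ellGamma_neg_two_mul_ne_zero_iff (hτ : 0 < τ.im) (hη : 0 < η.im) {g : ℂ} (hg : g.im < 0) :
    ellGamma τ η (-2 * g) ≠ 0 ↔ dprod τ η (τ + 2 * η + 2 * g) ≠ 0 := by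
  have h : dprod τ η (-2 * g) ≠ 0 := dprod_ne_zero_of_im_pos hτ hη (by
    simp [Complex.mul_im]; linarith)
  have e : τ + 2 * η - -2 * g = τ + 2 * η + 2 * g := by ring
  rw [ellGamma_eq hτ hη, e, Ne, div_eq_zero_iff, or_iff_left h]

lemma meromorphicAt_spinFactor (hτ : 0 < τ.im) (hη : 0 < η.im) (g : ℂ) :
    MeromorphicAt (spinFactor τ η) g := by
  have hD := differentiable_dprod hτ hη
  refine (MeromorphicAt.const _ _).mul (MeromorphicAt.div ?_ ?_)
  · exact ((hD.comp (by fun_prop : Differentiable ℂ fun g : ℂ => -2 * g)).analyticAt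
      g).meromorphicAt
  · exact ((hD.comp (by fun_prop : Differentiable ℂ fun g : ℂ => τ + 2 * η + 2 * g)).analyticAt
      g).meromorphicAt

lemma analyticAt_spinFactor (hτ : 0 < τ.im) (hη : 0 < η.im) {g : ℂ}
    (hg : dprod τ η (τ + 2 * η + 2 * g) ≠ 0) : AnalyticAt ℂ (spinFactor τ η) g := by
  have hD := differentiable_dprod hτ hη
  refine analyticAt_const.mul (AnalyticAt.div ?_ ?_ hg)
  · exact (hD.comp (by fun_prop : Differentiable ℂ fun g : ℂ => -2 * g)).analyticAt g
  · exact (hD.comp (by fun_prop : Differentiable ℂ fun g : ℂ => τ + 2 * η + 2 * g)).analyticAt g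

/-- The integral is analytic in the spin on its region of convergence, off the zeros of
`Γ(-2g)`. -/
lemma analyticAt_intertwinerIntegral (hτ : 0 < τ.im) (hη : 0 < η.im) {Φ : ℂ → ℂ}
    (hΦ : IsTestFunction Φ) {g z : ℂ} (hg : g.im < -|z.im|)
    (hg' : dprod τ η (τ + 2 * η + 2 * g) ≠ 0) :
    AnalyticAt ℂ (fun g => intertwinerIntegral τ η g Φ z) g := by
  obtain ⟨s, -, hs⟩ := exists_finset_lat hτ hη (-|z.im| + 1 + |z.im|)
  have hH := isAdmissible_integrandNum hτ hη hs hΦ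
  have hd := hH.differentiableOn_integral (y := 0) (by simp)
    (D := fun w => poleUp (polePos τ η z) (s.disjSum s) w * poleDown (polePos τ η z) (s.disjSum s) w)
    ((differentiable_poleUp _ _).mul (differentiable_poleDown _ _)) fun g x hg hx =>
      mul_ne_zero
        (poleUp_ne_zero fun i _ => by rw [hx]; linarith [neg_abs_le_polePos_im hτ hη z i])
        (poleDown_ne_zero fun i _ => by rw [hx]; linarith [neg_abs_le_polePos_im hτ hη z i])
  have h1 := hd.analyticAt ((isOpen_im_lt _).mem_nhds hg)
  refine ((analyticAt_spinFactor hτ hη hg').mul h1).congr (Eventually.of_forall fun g => ?_)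
  simp only [Pi.mul_apply]
  rw [intertwinerIntegral_eq hτ hη s]
  simp [poleIntegral]

/-! ### Uniqueness and existence of the continuation in the spin -/

lemma IsSpinContinuation.eventuallyEq_integral (hτ : 0 < τ.im) (hη : 0 < η.im) {Φ F : ℂ → ℂ}
    {z : ℂ} (hF : IsSpinContinuation τ η Φ z F) {g₀ : ℂ} (hg₀ : g₀.im < -|z.im|) :
    F =ᶠ[𝓝[≠] g₀] fun g => intertwinerIntegral τ η g Φ z := by
  filter_upwards [eventually_dprod_ne_zero hτ hη g₀,
    mem_nhdsWithin_of_mem_nhds ((isOpen_im_lt _).mem_nhds hg₀)] with g h1 h2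
  obtain ⟨h3, h4⟩ := (lt_neg_abs_iff g z).1 h2
  refine hF.2 g h3 h4 ((ellGamma_neg_two_mul_ne_zero_iff hτ hη ?_).2 h1)
  have h2' : g.im < -|z.im| := h2
  exact h2'.trans_le (neg_nonpos.2 (abs_nonneg _))

/-- A meromorphic function which agrees with the integral somewhere is the continuation. -/
lemma IsSpinContinuation.eventuallyEq (hτ : 0 < τ.im) (hη : 0 < η.im) {Φ F f : ℂ → ℂ}
    {z : ℂ} (hF : IsSpinContinuation τ η Φ z F) {U : Set ℂ} (hU : IsPreconnected U)
    (hf : MeromorphicOn f U) {g₁ : ℂ} (hg₁ : g₁.im < -|z.im|) (hg₁U : g₁ ∈ U)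
    (he : f =ᶠ[𝓝[≠] g₁] fun g => intertwinerIntegral τ η g Φ z) {g : ℂ} (hg : g ∈ U) :
    F =ᶠ[𝓝[≠] g] f :=
  MeromorphicOn.eventuallyEq_of_eventuallyEq
    (fun x _ => (hF.1 (Set.mem_univ x)).meromorphicAt) hf hU hg₁U hg
    ((hF.eventuallyEq_integral hτ hη hg₁).trans he.symm)

/-- Both functions equal the integral near a point far down the imaginary axis, hence agree on
punctured neighbourhoods everywhere; the normal form then fixes the values themselves. -/
lemma IsSpinContinuation.unique (hτ : 0 < τ.im) (hη : 0 < η.im) {Φ F F' : ℂ → ℂ}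
    {z : ℂ} (hF : IsSpinContinuation τ η Φ z F) (hF' : IsSpinContinuation τ η Φ z F') : F = F' := by
  ext g
  have hg₁ : (((-|z.im| - 1 : ℝ) : ℂ) * Complex.I).im < -|z.im| := by simp
  have := hF.eventuallyEq hτ hη isPreconnected_univ hF'.1.meromorphicOn hg₁ trivial
    (hF'.eventuallyEq_integral hτ hη hg₁) (g := g) trivial
  exact (((hF.1 (Set.mem_univ g)).eventuallyEq_nhdsNE_iff_eventuallyEq_nhds
    (hF'.1 (Set.mem_univ g))).1 this).eq_of_nhds

lemma exists_halfPlane_continuation (hτ : 0 < τ.im) (hη : 0 < η.im) {Φ : ℂ → ℂ}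
    (hΦ : IsTestFunction Φ) (z : ℂ) (C : ℝ) :
    ∃ f : ℂ → ℂ, MeromorphicOn f {g | g.im < C} ∧
      ∀ g : ℂ, g.im < C → g.im < -|z.im| → f g = intertwinerIntegral τ η g Φ z := by
  -- Since Im a_i ≥ −|Im z|, this height satisfies C ≤ Im a_i + y for all poles.
  set y := |C| + |z.im| with hy
  obtain ⟨s, -, hs⟩ := exists_finset_lat hτ hη (C + (y + 1) + |z.im|)
  have hH := isAdmissible_integrandNum hτ hη hs hΦ
  have ha : ∀ i ∈ s.disjSum s, C ≤ (polePos τ η z i).im + y := fun i _ => by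
    have := neg_abs_le_polePos_im hτ hη z i
    have := le_abs_self C
    linarith
  obtain ⟨G, hG, hG'⟩ := exists_meromorphic_poleIntegral hH (by positivity) (lt_add_one y) _ _ ha ha
  refine ⟨fun g => spinFactor τ η g * G g,
    fun g hg => (meromorphicAt_spinFactor hτ hη g).mul (hG g hg), fun g hg hgz => ?_⟩
  have hlt : ∀ i ∈ s.disjSum s, g.im < (polePos τ η z i).im := fun i _ =>
    hgz.trans_le (neg_abs_le_polePos_im hτ hη z i)
  simp only
  rw [intertwinerIntegral_eq hτ hη s, hG' g hg hlt hlt]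

/-- Existence of the meromorphic continuation in the spin. -/
theorem exists_isSpinContinuation (hτ : 0 < τ.im) (hη : 0 < η.im) {Φ : ℂ → ℂ}
    (hΦ : IsTestFunction Φ) (z : ℂ) : ∃ F : ℂ → ℂ, IsSpinContinuation τ η Φ z F := by
  choose f hf hf' using fun n : ℕ => exists_halfPlane_continuation hτ hη hΦ z (n : ℝ)
  -- The continuations to Im g < n and Im g < m agree on the smaller half-plane, because both equal
  -- the integral near a point of the domain of convergence.
  have hcompat : ∀ n m : ℕ, ∀ g : ℂ, g.im < n → g.im < m → f n =ᶠ[𝓝[≠] g] f m := by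
    intro n m g hn hm
    set g₁ : ℂ := ((-|z.im| - 1 : ℝ) : ℂ) * Complex.I
    have hg₁ : g₁.im < -|z.im| := by simp [g₁]
    have h0 := abs_nonneg z.im
    have hpos : ∀ k : ℕ, g₁.im < k := fun k => by
      have : (0 : ℝ) ≤ k := k.cast_nonneg
      linarith
    refine MeromorphicOn.eventuallyEq_of_eventuallyEq (U := {g | g.im < min (n : ℝ) m})
      (fun x hx => hf n x (show x.im < n from (lt_min_iff.1 hx).1))
      (fun x hx => hf m x (show x.im < m from (lt_min_iff.1 hx).2)) (isPreconnected_im_lt _)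
      (x := g₁) (lt_min (hpos n) (hpos m)) (lt_min hn hm) ?_
    filter_upwards [mem_nhdsWithin_of_mem_nhds ((isOpen_im_lt (-|z.im|)).mem_nhds hg₁)] with w hw
    have hw' : w.im < -|z.im| := hw
    have : ∀ k : ℕ, w.im < k := fun k => by
      have : (0 : ℝ) ≤ k := k.cast_nonneg
      linarith
    rw [hf' n w (this n) hw, hf' m w (this m) hw]
  choose N hN using fun g : ℂ => exists_nat_gt g.im
  -- Gluing: at each g take the normal form value of any half-plane continuation defined there; by
  -- compatibility the choice is immaterial.
  set F : ℂ → ℂ := fun g => toMeromorphicNFAt (f (N g)) g g with hFdef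
  have hFn : ∀ n : ℕ, ∀ g : ℂ, g.im < n → F g = toMeromorphicNFAt (f n) g g := fun n g hg =>
    (toMeromorphicNFAt_eventuallyEq_nhds_congr (hcompat (N g) n g (hN g) hg)).eq_of_nhds
  have hFloc : ∀ n : ℕ, ∀ g : ℂ, g.im < n →
      F =ᶠ[𝓝 g] toMeromorphicNFOn (f n) {g | g.im < n} := fun n g hg => by
    filter_upwards [(isOpen_im_lt n).mem_nhds hg] with w hw
    rw [hFn n w hw, toMeromorphicNFOn_eq_toMeromorphicNFAt (hf n) hw]
  have hNF : MeromorphicNFOn F Set.univ := fun g _ =>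
    (meromorphicNFAt_congr (hFloc (N g) g (hN g))).2
      (meromorphicNFOn_toMeromorphicNFOn _ _ (hN g))
  refine ⟨F, hNF, fun g h1 h2 h3 => ?_⟩
  have hg := (lt_neg_abs_iff g z).2 ⟨h1, h2⟩
  have hg0 : g.im < 0 := hg.trans_le (neg_nonpos.2 (abs_nonneg _))
  -- The integral is analytic at g, hence in normal form, so agreement on a punctured neighbourhood
  -- extends to g itself.
  have hA := analyticAt_intertwinerIntegral hτ hη hΦ hg
    ((ellGamma_neg_two_mul_ne_zero_iff hτ hη hg0).1 h3)
  refine (((hNF (Set.mem_univ g)).eventuallyEq_nhdsNE_iff_eventuallyEq_nhds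
    hA.meromorphicNFAt).1 ?_).eq_of_nhds
  have hg00 : g.im < (0 : ℕ) := by simpa using hg0
  have e1 : F =ᶠ[𝓝[≠] g] f 0 := ((hFloc 0 g hg00).filter_mono nhdsWithin_le_nhds).trans
    ((hf 0).toMeromorphicNFOn_eq_self_on_nhdsNE hg00)
  refine e1.trans ?_
  filter_upwards [mem_nhdsWithin_of_mem_nhds ((isOpen_im_lt (-|z.im|)).mem_nhds hg)] with w hw
  have hw' : w.im < -|z.im| := hw
  exact hf' 0 w (by have := abs_nonneg z.im; simp; linarith) hw

lemma isSpinContinuation_intertwiner (hτ : 0 < τ.im) (hη : 0 < η.im) {Φ : ℂ → ℂ}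
    (hΦ : IsTestFunction Φ) (z : ℂ) :
    IsSpinContinuation τ η Φ z fun g => intertwiner τ η g Φ z := by
  have h := exists_isSpinContinuation hτ hη hΦ z
  have e : (fun g => intertwiner τ η g Φ z) = h.choose := by
    ext g; exact dif_pos h
  rw [e]
  exact h.choose_spec

/-- A continuation is the intertwining operator. -/
lemma IsSpinContinuation.eq_intertwiner (hτ : 0 < τ.im) (hη : 0 < η.im) {Φ F : ℂ → ℂ}
    (hΦ : IsTestFunction Φ) {z : ℂ} (hF : IsSpinContinuation τ η Φ z F) (g : ℂ) :
    intertwiner τ η g Φ z = F g :=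
  congrFun ((isSpinContinuation_intertwiner hτ hη hΦ z).unique hτ hη hF) g

end

section
variable {τ η : ℂ}

/-! ### The half-period shift and the exchange of bases -/

lemma IsTestFunction.halfShift {Φ : ℂ → ℂ} (hΦ : IsTestFunction Φ) :
    IsTestFunction (halfShift Φ) :=
  ⟨hΦ.1.comp (differentiable_id.add_const _), fun z => by
    simp only [EllipticDouble.halfShift]; rw [add_right_comm, hΦ.2]⟩

lemma halfShift_even {Φ : ℂ → ℂ} (hΦ : IsTestFunction Φ) (he : ∀ x, Φ (-x) = Φ x) (x : ℂ) :
    halfShift Φ (-x) = halfShift Φ x := by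
  simp only [halfShift]
  rw [← he, ← hΦ.2]; ring_nf

lemma ellGamma_sub_one (hτ : 0 < τ.im) (hη : 0 < η.im) (z : ℂ) :
    ellGamma τ η (z - 1) = ellGamma τ η z := by
  rw [← ellGamma_add_one hτ hη, sub_add_cancel]

/-- Under x → x + 1/2 every argument of Γ becomes that for spin g up to an integer, and the
integrand has period 1, so the interval of integration may be moved. -/
lemma intertwinerIntegral_add_half (hτ : 0 < τ.im) (hη : 0 < η.im) {Φ : ℂ → ℂ}
    (hΦ : IsTestFunction Φ) (g z : ℂ) :
    intertwinerIntegral τ η (g + 1 / 2) Φ z = intertwinerIntegral τ η g (halfShift Φ) z := by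
  rw [intertwinerIntegral, intertwinerIntegral]
  congr 1
  set f : ℂ → ℂ := fun x =>
      ellGamma τ η (z + x - (g + 1 / 2)) * ellGamma τ η (z - x - (g + 1 / 2)) *
        ellGamma τ η (-z + x - (g + 1 / 2)) * ellGamma τ η (-z - x - (g + 1 / 2)) /
      (ellGamma τ η (-2 * (g + 1 / 2)) * ellGamma τ η (2 * x) * ellGamma τ η (-2 * x)) * Φ x with hf
  have hs : ∀ u v : ℂ, u = v + 1 → ellGamma τ η u = ellGamma τ η v := fun u v h => by
    rw [h, ellGamma_add_one hτ hη]
  have hper : ∀ x, f (x + 1) = f x := fun x => by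
    simp only [hf, hΦ.2]
    rw [hs (z + (x + 1) - (g + 1 / 2)) (z + x - (g + 1 / 2)) (by ring),
      hs (-z + (x + 1) - (g + 1 / 2)) (-z + x - (g + 1 / 2)) (by ring),
      ← hs (z - x - (g + 1 / 2)) (z - (x + 1) - (g + 1 / 2)) (by ring),
      ← hs (-z - x - (g + 1 / 2)) (-z - (x + 1) - (g + 1 / 2)) (by ring),
      hs (2 * (x + 1)) (2 * x + 1) (by ring), hs (2 * x + 1) (2 * x) (by ring),
      ← hs (-2 * x - 1) (-2 * (x + 1)) (by ring), ← hs (-2 * x) (-2 * x - 1) (by ring)]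
  have h1 := periodic_intervalIntegral hper (1 / 2) 0
  simp only [Complex.ofReal_zero, zero_mul, add_zero] at h1
  rw [← h1]
  have h2 := intervalIntegral.integral_comp_add_right (a := 0) (b := 1)
    (fun x : ℝ => f x) (1 / 2)
  rw [zero_add, add_comm 1] at h2
  rw [← h2]
  refine intervalIntegral.integral_congr fun x _ => ?_
  simp only [hf, halfShift]
  push_cast
  rw [hs (-2 * g) (-2 * (g + 1 / 2)) (by ring),
    hs (2 * (x + 1 / 2)) (2 * x) (by ring),
    hs (-2 * x) (-2 * (x + 1 / 2)) (by ring),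
    hs (z - x - g) (z - (x + 1 / 2) - (g + 1 / 2)) (by ring),
    hs (-z - x - g) (-z - (x + 1 / 2) - (g + 1 / 2)) (by ring)]
  have e1 : z + ((x : ℂ) + 1 / 2) - (g + 1 / 2) = z + x - g := by ring
  have e2 : -z + ((x : ℂ) + 1 / 2) - (g + 1 / 2) = -z + x - g := by ring
  rw [e1, e2]

/-- `M(g + 1/2) = M(g) P`. -/
theorem intertwiner_add_half (hτ : 0 < τ.im) (hη : 0 < η.im) {Φ : ℂ → ℂ}
    (hΦ : IsTestFunction Φ) (g z : ℂ) :
    intertwiner τ η (g + 1 / 2) Φ z = intertwiner τ η g (halfShift Φ) z := by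
  have hF := isSpinContinuation_intertwiner hτ hη hΦ z
  refine (IsSpinContinuation.eq_intertwiner (F := fun g => intertwiner τ η (g + 1 / 2) Φ z)
    hτ hη hΦ.halfShift ⟨?_, fun g h1 h2 h3 => ?_⟩ g).symm
  · intro g _
    exact (meromorphicNFAt_comp_add_const_iff_meromorphicNFAt
      (f := fun g => intertwiner τ η g Φ z)).2 (hF.1 (Set.mem_univ _))
  · rw [← intertwinerIntegral_add_half hτ hη hΦ]
    have him : ∀ w : ℂ, (-(g + 1 / 2) + w).im = (-g + w).im := fun w => by simp
    have him' : ∀ w : ℂ, (-(g + 1 / 2) - w).im = (-g - w).im := fun w => by simp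
    refine hF.2 _ (by rwa [him]) (by rwa [him']) ?_
    have e : -2 * (g + 1 / 2) = -2 * g - 1 := by ring
    rwa [e, ellGamma_sub_one hτ hη]

lemma intertwinerIntegral_swap (hτ : 0 < τ.im) (hη : 0 < η.im) (g : ℂ) (Φ : ℂ → ℂ) (z : ℂ) :
    intertwinerIntegral (2 * η) (τ / 2) g Φ z = intertwinerIntegral τ η g Φ z := by
  simp only [intertwinerIntegral, ellGamma_swap hτ hη, mul_div_cancel₀ τ (two_ne_zero' ℂ)]
  ring

open Classical in
lemma intertwiner_swap (hτ : 0 < τ.im) (hη : 0 < η.im) (g : ℂ) (Φ : ℂ → ℂ) (z : ℂ) :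
    intertwiner (2 * η) (τ / 2) g Φ z = intertwiner τ η g Φ z := by
  have e : IsSpinContinuation (2 * η) (τ / 2) Φ z = IsSpinContinuation τ η Φ z := by
    ext F
    simp only [IsSpinContinuation, ellGamma_swap hτ hη, intertwinerIntegral_swap hτ hη]
  -- The operator is a choice from its set of continuations, and equal predicates yield equal
  -- choices. Hence no assumption on Φ is required.
  have h : ∀ Q R : (ℂ → ℂ) → Prop, Q = R →
      (if h : ∃ F, Q F then h.choose g else 0) = if h : ∃ F, R F then h.choose g else 0 := by
    rintro Q _ rfl; rfl
  exact h _ _ e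

/-! ### Regularity and locality at the lattice points -/

lemma lat_add (nm nm' : ℕ × ℕ) : lat τ η (nm + nm') = lat τ η nm + lat τ η nm' := by
  simp only [lat, Prod.fst_add, Prod.snd_add]; push_cast; ring

/-- No other lattice vector `jτ + 2kη`, `j, k ≥ 0`, is congruent to `mτ + 2nη` modulo `1`. -/
def SpinGeneric (τ η : ℂ) (m n : ℕ) : Prop :=
  ∀ nm : ℕ × ℕ, ee (lat τ η nm) = ee (lat τ η (m, n)) → nm = (m, n)

/-- No pinching between poles of equal sign. -/
def PinchGeneric (τ η : ℂ) (m n : ℕ) (s : Finset (ℕ × ℕ)) (z : ℂ) : Prop :=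
  ∀ nm ∈ s, ∀ nm' ∈ s, ee (2 * z + lat τ η nm + lat τ η nm' - lat τ η (m, n)) ≠ 1 ∧
    ee (-2 * z + lat τ η nm + lat τ η nm' - lat τ η (m, n)) ≠ 1

/-- Poles of equal sign in z could meet only for the special z excluded by `hz`. For opposite signs
z cancels, and the two lattice vectors must add up to mτ + 2nη modulo 1, hence exactly by `hsg`. -/
lemma pinch_cases {m n : ℕ} {s : Finset (ℕ × ℕ)} {z : ℂ} (hsg : SpinGeneric τ η m n)
    (hz : PinchGeneric τ η m n s z) {i j : (ℕ × ℕ) ⊕ (ℕ × ℕ)} (hi : i ∈ s.disjSum s)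
    (hj : j ∈ s.disjSum s)
    (h : ee (polePos τ η z i + polePos τ η z j - lat τ η (m, n)) = 1) :
    ∃ nm nm', nm + nm' = (m, n) ∧
      (i = Sum.inl nm ∧ j = Sum.inr nm' ∨ i = Sum.inr nm ∧ j = Sum.inl nm') := by
  rcases i with nm | nm <;> rcases j with nm' | nm' <;>
    simp only [Finset.inl_mem_disjSum, Finset.inr_mem_disjSum] at hi hj <;>
    simp only [polePos, Sum.elim_inl, Sum.elim_inr] at h
  · refine absurd ?_ (hz nm hi nm' hj).1
    rw [← h]; ring_nf
  · refine ⟨nm, nm', hsg _ ?_, Or.inl ⟨rfl, rfl⟩⟩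
    rw [← mul_one (ee (lat τ η (m, n))), ← h, ← ee_add, lat_add]; ring_nf
  · refine ⟨nm, nm', hsg _ ?_, Or.inr ⟨rfl, rfl⟩⟩
    rw [← mul_one (ee (lat τ η (m, n))), ← h, ← ee_add, lat_add]; ring_nf
  · refine absurd ?_ (hz nm hi nm' hj).2
    rw [← h]; ring_nf

lemma eventually_ee_ne_one (c d z₀ : ℂ) (hc : c ≠ 0) :
    ∀ᶠ z in 𝓝[≠] z₀, ee (c * z + d) ≠ 1 := by
  have hd : Differentiable ℂ fun z => ee (c * z + d) - 1 :=
    (differentiable_ee.comp (by fun_prop : Differentiable ℂ fun z : ℂ => c * z + d)).sub_const 1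
  have h := eventually_codiscrete_ne_zero (x := (Complex.I - d) / c) hd (by
    rw [mul_div_cancel₀ _ hc, sub_add_cancel]
    have : (1 : ℂ) - ee Complex.I ≠ 0 := one_sub_ee_ne_zero (by simp)
    exact fun h => this (by linear_combination -h))
  filter_upwards [eventually_codiscrete_iff.1 h z₀] with z hz h1
  exact hz (by rw [h1, sub_self])

lemma eventually_pinchGeneric (m n : ℕ) (s : Finset (ℕ × ℕ)) (z₀ : ℂ) :
    ∀ᶠ z in 𝓝[≠] z₀, PinchGeneric τ η m n s z := by
  unfold PinchGeneric
  simp only [Filter.eventually_all_finset]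
  intro nm _ nm' _
  filter_upwards [eventually_ee_ne_one 2 (lat τ η nm + lat τ η nm' - lat τ η (m, n)) z₀
    two_ne_zero, eventually_ee_ne_one (-2) (lat τ η nm + lat τ η nm' - lat τ η (m, n)) z₀
    (by norm_num)] with z h1 h2
  constructor
  · rwa [add_sub_assoc, add_assoc, ← add_sub_assoc]
  · rwa [add_sub_assoc, add_assoc, ← add_sub_assoc]

/-- A property which, for every bound on `|Im z|`, holds for all `z` generic with respect to some
finite set of pairs, holds on a codiscrete set. -/
lemma eventually_codiscrete_of_pinchGeneric (m n : ℕ) {P : ℂ → Prop}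
    (h : ∀ Y : ℝ, ∃ s, ∀ z : ℂ, |z.im| ≤ Y → PinchGeneric τ η m n s z → P z) :
    ∀ᶠ z in codiscrete ℂ, P z := by
  rw [eventually_codiscrete_iff]
  intro z₀
  obtain ⟨s, hs⟩ := h (|z₀.im| + 1)
  have hY : ∀ᶠ z : ℂ in 𝓝[≠] z₀, |z.im| < |z₀.im| + 1 := by
    refine mem_nhdsWithin_of_mem_nhds ((isOpen_lt (f := fun z : ℂ => |z.im|) (by fun_prop)
      continuous_const).mem_nhds ?_)
    exact lt_add_one |z₀.im|
  filter_upwards [hY, eventually_pinchGeneric m n s z₀] with z h1 h2 using hs z h1.le h2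

/-- The spin factor with its zero at a lattice point removed. -/
def regSpinFactor (τ η : ℂ) (m n : ℕ) (g : ℂ) : ℂ :=
  qPoch (base (2 * η)) (base (2 * η)) * qPoch (base τ) (base τ) / 2 *
    (drest τ η {(m, n)} (-2 * g) / dprod τ η (τ + 2 * η + 2 * g))

/-- The factor of index (m, n) in the product for 1/Γ(−2g) vanishes at g₀. This is the zero that
cancels the pole created by pinching. -/
lemma spinFactor_eq (hτ : 0 < τ.im) (hη : 0 < η.im) {m n : ℕ} {g₀ : ℂ}
    (h2 : 2 * g₀ = lat τ η (m, n)) (g : ℂ) :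
    spinFactor τ η g = regSpinFactor τ η m n g * (1 - ee (2 * (g₀ - g))) := by
  rw [spinFactor, regSpinFactor, dprod_eq_dfin_mul_drest hτ hη {(m, n)} (-2 * g), dfin,
    Finset.prod_singleton, ← h2]
  have e : -2 * g + 2 * g₀ = 2 * (g₀ - g) := by ring
  rw [e]
  ring

lemma dprod_latticePoint_ne_zero (hτ : 0 < τ.im) (hη : 0 < η.im) {nm : ℕ × ℕ} {g₀ : ℂ}
    (h2 : 2 * g₀ = lat τ η nm) : dprod τ η (τ + 2 * η + 2 * g₀) ≠ 0 := by
  refine dprod_ne_zero_of_im_pos hτ hη ?_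
  have h3 := lat_im_nonneg hτ hη nm
  have h4 := im_two_mul_pos hη
  rw [h2, Complex.add_im, Complex.add_im]
  linarith

lemma analyticAt_regSpinFactor (hτ : 0 < τ.im) (hη : 0 < η.im) {m n : ℕ} {g₀ : ℂ}
    (h2 : 2 * g₀ = lat τ η (m, n)) : AnalyticAt ℂ (regSpinFactor τ η m n) g₀ := by
  refine analyticAt_const.mul (AnalyticAt.div ?_ ?_ (dprod_latticePoint_ne_zero hτ hη h2))
  · exact ((differentiable_drest hτ hη _).comp
      (by fun_prop : Differentiable ℂ fun g : ℂ => -2 * g)).analyticAt g₀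
  · exact ((differentiable_dprod hτ hη).comp
      (by fun_prop : Differentiable ℂ fun g : ℂ => τ + 2 * η + 2 * g)).analyticAt g₀

/-- The operator near a lattice point in terms of a continuation of the pole integral with at most
a simple pole. -/
lemma intertwiner_eventuallyEq (hτ : 0 < τ.im) (hη : 0 < η.im) {Φ : ℂ → ℂ}
    (hΦ : IsTestFunction Φ) {z : ℂ} {m n : ℕ} {g₀ : ℂ} (h2 : 2 * g₀ = lat τ η (m, n)) {C : ℝ}
    (hg₀ : g₀.im < C) {s : Finset (ℕ × ℕ)} {G K : ℂ → ℂ} (hG : MeromorphicOn G {g | g.im < C})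
    (hG' : ∀ g : ℂ, g.im < C → g.im < -|z.im| → G g = poleIntegral (polePos τ η z) (s.disjSum s)
      (s.disjSum s) (integrandNum τ η z s Φ) g)
    (hK : AnalyticAt ℂ K g₀) (hGK : ∀ᶠ g in 𝓝[≠] g₀, G g * (1 - ee (2 * (g₀ - g))) = K g) :
    (fun g => intertwiner τ η g Φ z) =ᶠ[𝓝 g₀] fun g => regSpinFactor τ η m n g * K g := by
  have hF := isSpinContinuation_intertwiner hτ hη hΦ z
  have hA : AnalyticAt ℂ (fun g => regSpinFactor τ η m n g * K g) g₀ :=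
    (analyticAt_regSpinFactor hτ hη h2).mul hK
  -- Both sides are in normal form, so equality on a punctured neighbourhood suffices; it is carried
  -- up from a point low enough for the integral to converge.
  refine ((hF.1 (Set.mem_univ g₀)).eventuallyEq_nhdsNE_iff_eventuallyEq_nhds
    hA.meromorphicNFAt).1 ?_
  set g₁ : ℂ := ((-|z.im| - |C| - 1 : ℝ) : ℂ) * Complex.I
  have hg₁ : g₁.im = -|z.im| - |C| - 1 := by simp [g₁]
  have hlt1 : g₁.im < -|z.im| := by rw [hg₁]; linarith [abs_nonneg C]
  have hlt2 : g₁.im < C := by rw [hg₁]; linarith [neg_abs_le C, abs_nonneg z.im]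
  have h := hF.eventuallyEq hτ hη (isPreconnected_im_lt C)
    (f := fun g => spinFactor τ η g * G g)
    (fun g hg => (meromorphicAt_spinFactor hτ hη g).mul (hG g hg)) hlt1 hlt2 (by
      filter_upwards [mem_nhdsWithin_of_mem_nhds ((isOpen_im_lt _).mem_nhds hlt1),
        mem_nhdsWithin_of_mem_nhds ((isOpen_im_lt _).mem_nhds hlt2)] with g h1 h2
      rw [intertwinerIntegral_eq hτ hη s, hG' g h2 h1]) hg₀
  refine h.trans ?_
  filter_upwards [hGK] with g hg
  rw [spinFactor_eq hτ hη h2, ← hg]; ring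

/-- The pole integral of the kernel near a lattice point. -/
lemma exists_pinch_integrand (hτ : 0 < τ.im) (hη : 0 < η.im) {m n : ℕ}
    (hsg : SpinGeneric τ η m n) {g₀ : ℂ} (h2 : 2 * g₀ = lat τ η (m, n)) (Y : ℝ) :
    ∃ (s : Finset (ℕ × ℕ)) (L : ℝ), (0, 0) ∈ s ∧ 0 < L ∧ ∀ z : ℂ, |z.im| ≤ Y →
      PinchGeneric τ η m n s z →
      (∀ Φ, IsTestFunction Φ → IsAdmissible (g₀.im + 1) L (integrandNum τ η z s Φ)) ∧
      ∀ H, IsAdmissible (g₀.im + 1) L H →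
      ∃ G K : ℂ → ℂ, MeromorphicOn G {g | g.im < g₀.im + 1} ∧
        (∀ g : ℂ, g.im < g₀.im + 1 → g.im < -|z.im| → G g = poleIntegral (polePos τ η z)
          (s.disjSum s) (s.disjSum s) H g) ∧
        AnalyticAt ℂ K g₀ ∧ (∀ᶠ g in 𝓝[≠] g₀, G g * (1 - ee (2 * (g₀ - g))) = K g) ∧
        ((∀ i ∈ s.disjSum s, ∀ j ∈ s.disjSum s,
          ee (polePos τ η z i + polePos τ η z j - lat τ η (m, n)) = 1 →
          H (g₀, g₀ - polePos τ η z i) = 0) → K g₀ = 0) := by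
  -- The half-plane Im g < C contains g₀, and the height and the finite set depend only on the bound
  -- Y for |Im z|, so they serve all such z at once.
  set C := g₀.im + 1
  set y := |C| + |Y|
  obtain ⟨s, hs0, hs⟩ := exists_finset_lat hτ hη (C + (y + 1) + |Y|)
  refine ⟨s, y + 1, hs0, by positivity, fun z hz hgen => ⟨fun Φ hΦ => ?_, fun H hH => ?_⟩⟩
  · refine isAdmissible_integrandNum hτ hη (fun nm hnm => lt_of_le_of_lt ?_ (hs nm hnm)) hΦ
    linarith [le_abs_self Y]
  have ha : ∀ i ∈ s.disjSum s, C ≤ (polePos τ η z i).im + y := fun i _ => by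
    have := neg_abs_le_polePos_im hτ hη z i
    have := le_abs_self C
    have := le_abs_self Y
    linarith
  obtain ⟨G, h1, h3, K, h4, h5, h6⟩ := exists_pinch_poleIntegral hH (by positivity) (lt_add_one y)
    (lt_add_one g₀.im) (s.disjSum s) (s.disjSum s) ha ha
    -- Pinched pairs are disjoint: the indices of partners add up to (m, n) and their signs are
    -- opposite, so each pole determines its partner.
    (fun i hi i' hi' j hj hij hij' => by
      rw [h2] at hij hij'
      obtain ⟨a, b, hab, ⟨rfl, rfl⟩ | ⟨rfl, rfl⟩⟩ := pinch_cases hsg hgen hi hj hij <;>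
      obtain ⟨a', b', hab', ⟨rfl, hb⟩ | ⟨rfl, hb⟩⟩ := pinch_cases hsg hgen hi' hj hij' <;>
      simp only [Sum.inl.injEq, Sum.inr.injEq, reduceCtorEq] at hb ⊢ <;> subst hb <;>
      exact add_right_cancel (hab.trans hab'.symm))
    (fun i hi j hj j' hj' hij hij' => by
      rw [h2] at hij hij'
      obtain ⟨a, b, hab, ⟨rfl, rfl⟩ | ⟨rfl, rfl⟩⟩ := pinch_cases hsg hgen hi hj hij <;>
      obtain ⟨a', b', hab', ⟨hb, rfl⟩ | ⟨hb, rfl⟩⟩ := pinch_cases hsg hgen hi hj' hij' <;>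
      simp only [Sum.inl.injEq, Sum.inr.injEq, reduceCtorEq] at hb ⊢ <;> subst hb <;>
      exact add_left_cancel (hab.trans hab'.symm))
  refine ⟨G, K, h1, fun g hg hgz => ?_, h4, h5, fun h => h6 fun i hi j hj hij => ?_⟩
  · have hlt : ∀ i ∈ s.disjSum s, g.im < (polePos τ η z i).im := fun i _ =>
      hgz.trans_le (neg_abs_le_polePos_im hτ hη z i)
    exact h3 g hg hlt hlt
  · rw [h2] at hij
    exact h i hi j hj hij

lemma IsTestFunction.sub {Φ Ψ : ℂ → ℂ} (hΦ : IsTestFunction Φ) (hΨ : IsTestFunction Ψ) :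
    IsTestFunction fun x => Φ x - Ψ x :=
  ⟨hΦ.1.sub hΨ.1, fun z => by simp only [hΦ.2, hΨ.2]⟩

lemma intertwinerIntegral_sub (hτ : 0 < τ.im) (hη : 0 < η.im) {Φ Ψ : ℂ → ℂ}
    (hΦ : IsTestFunction Φ) (hΨ : IsTestFunction Ψ) {g z : ℂ} (hg : g.im < -|z.im|) :
    intertwinerIntegral τ η g (fun x => Φ x - Ψ x) z =
      intertwinerIntegral τ η g Φ z - intertwinerIntegral τ η g Ψ z := by
  obtain ⟨s, -, hs⟩ := exists_finset_lat hτ hη (-|z.im| + 1 + |z.im|)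
  have hlt : ∀ i ∈ s.disjSum s, g.im < (polePos τ η z i).im := fun i _ =>
    hg.trans_le (neg_abs_le_polePos_im hτ hη z i)
  rw [intertwinerIntegral_eq hτ hη s, intertwinerIntegral_eq hτ hη s,
    intertwinerIntegral_eq hτ hη s, ← mul_sub]
  congr 1
  unfold poleIntegral
  rw [← intervalIntegral.integral_sub
    ((continuous_poleIntegrand (isAdmissible_integrandNum hτ hη hs hΦ) one_pos hg hlt
      hlt).intervalIntegrable _ _)
    ((continuous_poleIntegrand (isAdmissible_integrandNum hτ hη hs hΨ) one_pos hg hlt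
      hlt).intervalIntegrable _ _)]
  refine intervalIntegral.integral_congr fun x _ => ?_
  simp only [integrandNum]
  ring

/-- Additivity passes from the integral to its continuation only on punctured neighbourhoods: with
the value 0 at poles, normal forms need not add up pointwise. -/
lemma intertwiner_sub (hτ : 0 < τ.im) (hη : 0 < η.im) {Φ Ψ : ℂ → ℂ}
    (hΦ : IsTestFunction Φ) (hΨ : IsTestFunction Ψ) (z g : ℂ) :
    (fun g => intertwiner τ η g (fun x => Φ x - Ψ x) z) =ᶠ[𝓝[≠] g]
      fun g => intertwiner τ η g Φ z - intertwiner τ η g Ψ z := by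
  have hF := isSpinContinuation_intertwiner hτ hη hΦ z
  have hF' := isSpinContinuation_intertwiner hτ hη hΨ z
  have hg₁ : (((-|z.im| - 1 : ℝ) : ℂ) * Complex.I).im < -|z.im| := by simp
  refine (isSpinContinuation_intertwiner hτ hη (hΦ.sub hΨ) z).eventuallyEq hτ hη
    isPreconnected_univ (hF.1.meromorphicOn.sub hF'.1.meromorphicOn) hg₁ trivial ?_ trivial
  filter_upwards [hF.eventuallyEq_integral hτ hη hg₁, hF'.eventuallyEq_integral hτ hη hg₁,
    mem_nhdsWithin_of_mem_nhds ((isOpen_im_lt _).mem_nhds hg₁)] with g h1 h2 h3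
  rw [Pi.sub_apply, h1, h2, intertwinerIntegral_sub hτ hη hΦ hΨ h3]

/-- At a lattice point the operator is regular, and depends only on the values of the (even) test
function at finitely many points. -/
theorem intertwiner_regular_and_local (hτ : 0 < τ.im) (hη : 0 < η.im) {m n : ℕ}
    (hsg : SpinGeneric τ η m n) :
    ∀ᶠ z in codiscrete ℂ,
      (∀ Φ, IsTestFunction Φ →
        AnalyticAt ℂ (fun g => intertwiner τ η g Φ z) (n * η + m * (τ / 2))) ∧
      ∀ Φ Ψ, IsTestFunction Φ → IsTestFunction Ψ → (∀ x, Φ (-x) = Φ x) → (∀ x, Ψ (-x) = Ψ x) →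
        (∀ α β : ℤ, |α| ≤ n → |β| ≤ m → Φ (z + (α * η + β * (τ / 2))) =
          Ψ (z + (α * η + β * (τ / 2)))) →
        intertwiner τ η (n * η + m * (τ / 2)) Φ z = intertwiner τ η (n * η + m * (τ / 2)) Ψ z := by
  set g₀ : ℂ := n * η + m * (τ / 2) with hg₀
  have h2 : 2 * g₀ = lat τ η (m, n) := by simp only [hg₀, lat]; ring
  refine eventually_codiscrete_of_pinchGeneric (τ := τ) (η := η) m n fun Y => ?_
  obtain ⟨s, L, -, -, hs⟩ := exists_pinch_integrand hτ hη hsg h2 Y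
  refine ⟨s, fun z hz hgen => ?_⟩
  obtain ⟨hadm, hpin⟩ := hs z hz hgen
  have hreg : ∀ Φ, IsTestFunction Φ → AnalyticAt ℂ (fun g => intertwiner τ η g Φ z) g₀ ∧
      ((∀ x, Φ (-x) = Φ x) → (∀ α β : ℤ, |α| ≤ n → |β| ≤ m →
        Φ (z + (α * η + β * (τ / 2))) = 0) → intertwiner τ η g₀ Φ z = 0) := fun Φ hΦ => by
    obtain ⟨G, K, hG, hG', hK, hGK, hv⟩ := hpin _ (hadm Φ hΦ)
    have he := intertwiner_eventuallyEq hτ hη hΦ h2 (lt_add_one _) hG hG' hK hGK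
    refine ⟨(((analyticAt_regSpinFactor hτ hη h2).mul hK).congr he.symm), fun hev hvan => ?_⟩
    rw [he.eq_of_nhds, hv, mul_zero]
    intro i hi j hj hij
    obtain ⟨a, b, hab, hc⟩ := pinch_cases hsg hgen hi hj hij
    obtain ⟨hab1, hab2⟩ := Prod.mk.inj hab
    have hα : |((n : ℤ) - 2 * a.2)| ≤ n := by rw [abs_le]; constructor <;> omega
    have hβ : |((m : ℤ) - 2 * a.1)| ≤ m := by rw [abs_le]; constructor <;> omega
    have hα' : |(2 * a.2 - (n : ℤ))| ≤ n := by rw [abs_le]; constructor <;> omega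
    have hβ' : |(2 * a.1 - (m : ℤ))| ≤ m := by rw [abs_le]; constructor <;> omega
    -- For a pole z + lat a the pinching point is −(z + (2a₂ − n)η + (2a₁ − m)τ/2), which needs
    -- evenness of Φ; for −z + lat a it is z + (n − 2a₂)η + (m − 2a₁)τ/2.
    have hΦ0 : Φ (g₀ - polePos τ η z i) = 0 := by
      rcases hc with ⟨rfl, -⟩ | ⟨rfl, -⟩
      · rw [← hvan _ _ hα' hβ', ← hev]
        congr 1
        simp only [polePos, Sum.elim_inl, lat, hg₀]; push_cast; ring
      · rw [← hvan _ _ hα hβ]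
        congr 1
        simp only [polePos, Sum.elim_inr, lat, hg₀]; push_cast; ring
    simp only [integrandNum, hΦ0, mul_zero]
  refine ⟨fun Φ hΦ => (hreg Φ hΦ).1, fun Φ Ψ hΦ hΨ he he' hval => ?_⟩
  -- Locality follows from the vanishing statement applied to Φ − Ψ; additivity holds at g₀ itself
  -- because all three functions of g are analytic there.
  have hsub := hreg _ (hΦ.sub hΨ)
  have h0 := hsub.2 (fun x => by simp only [he, he']) fun α β hα hβ => by
    rw [hval α β hα hβ, sub_self]
  have := AnalyticAt.eq_of_eventuallyEq hsub.1 ((hreg Φ hΦ).1.sub (hreg Ψ hΨ).1)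
    (intertwiner_sub hτ hη hΦ hΨ z g₀)
  simp only [Pi.sub_apply] at this
  rw [h0] at this
  exact (sub_eq_zero.1 this.symm)

end

/-! ### The operator at zero spin -/

/-- The integral is the mean over the unit circle of (1 − w e^{2πic})⁻¹, holomorphic on the closed
disc, and equals the value at w = 0. -/
lemma integral_inv_one_sub_ee {c : ℂ} (hc : 0 < c.im) :
    ∫ x : ℝ in (0 : ℝ)..1, (1 - ee (x + c))⁻¹ = 1 := by
  have hd : DiffContOnCl ℂ (fun w : ℂ => (1 - w * ee c)⁻¹) (Metric.ball 0 |(1 : ℝ)|) := by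
    refine DifferentiableOn.diffContOnCl ?_
    rw [closure_ball _ (by norm_num)]
    refine DifferentiableOn.inv (by fun_prop) fun w hw h => ?_
    have h1 : ‖w * ee c‖ = 1 := by
      have : w * ee c = 1 := by linear_combination -h
      rw [this, norm_one]
    have h2 : ‖w‖ ≤ 1 := by simpa using hw
    have h3 := norm_ee_lt_one hc
    rw [norm_mul] at h1
    nlinarith [norm_nonneg w, norm_nonneg (ee c)]
  have h := hd.circleAverage
  rw [zero_mul, sub_zero, inv_one, Real.circleAverage_def] at h
  have h2 := intervalIntegral.integral_comp_mul_left (a := 0) (b := 1)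
    (fun θ : ℝ => (1 - circleMap 0 1 θ * ee c)⁻¹) (c := 2 * π) (by positivity)
  rw [mul_zero, mul_one] at h2
  refine Eq.trans (intervalIntegral.integral_congr fun x _ => ?_) (h2.trans h)
  simp only [circleMap, zero_add, Complex.ofReal_one, one_mul]
  rw [ee_add, ee]
  push_cast
  ring_nf

lemma integral_inv_one_sub_ee_neg {c : ℂ} (hc : 0 < c.im) :
    ∫ x : ℝ in (0 : ℝ)..1, (1 - ee (-x + c))⁻¹ = 1 := by
  have h := intervalIntegral.integral_comp_sub_left (a := 0) (b := 1)
    (fun x : ℝ => (1 - ee (x + c))⁻¹) 1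
  rw [sub_self, sub_zero, integral_inv_one_sub_ee hc] at h
  refine Eq.trans (intervalIntegral.integral_congr fun x _ => ?_) h
  rw [← ee_add_one (-x + c)]
  push_cast
  ring_nf

section
variable {ι : Type*} [DecidableEq ι]

/-- The part of the denominator complementary to the pair of factors `i`, `j`. -/
def poleCompl (a : ι → ℂ) (A : Finset ι) (i j : ι) (w : ℂ × ℂ) : ℂ :=
  poleUp a (A.erase i) w * poleDown a (A.erase j) w

lemma isAdmissible_poleCompl (a : ι → ℂ) (A : Finset ι) (i j : ι) (C L : ℝ) :
    IsAdmissible C L (poleCompl a A i j) :=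
  ⟨((differentiable_poleUp _ _).mul (differentiable_poleDown _ _)).differentiableOn,
    fun g x => by simp only [poleCompl, poleUp_periodic, poleDown_periodic]⟩

/-- Only one factor of each family remains, and 1/((1 − u)(1 − v)) = (1/(1 − u) + 1/(1 − v) − 1)/(1
− uv), where each of the three terms 1/(1 − u), 1/(1 − v), 1 has mean 1. This explicit integral with
a pole is the yardstick at zero spin. -/
lemma poleIntegral_poleCompl {a : ι → ℂ} {A : Finset ι} {i j : ι} (hi : i ∈ A) (hj : j ∈ A)
    {g : ℂ} (hg : ∀ i ∈ A, g.im < (a i).im) :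
    poleIntegral a A A (poleCompl a A i j) g = (1 - ee (a i + a j - 2 * g))⁻¹ := by
  have h1 : 1 - ee (a i + a j - 2 * g) ≠ 0 := one_sub_ee_ne_zero (by
    simp only [Complex.sub_im, Complex.add_im, Complex.mul_im, Complex.re_ofNat, Complex.im_ofNat]
    have := hg i hi
    have := hg j hj
    linarith)
  have hci : 0 < (a i - g).im := by rw [Complex.sub_im]; linarith [hg i hi]
  have hcj : 0 < (a j - g).im := by rw [Complex.sub_im]; linarith [hg j hj]
  have hU : ∀ x : ℝ, 1 - ee (x + (a i - g)) ≠ 0 := fun x => one_sub_ee_ne_zero (by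
    rw [Complex.add_im, Complex.ofReal_im, zero_add]; exact hci.ne')
  have hV : ∀ x : ℝ, 1 - ee (-x + (a j - g)) ≠ 0 := fun x => one_sub_ee_ne_zero (by
    rw [Complex.add_im, Complex.neg_im, Complex.ofReal_im, neg_zero, zero_add]; exact hcj.ne')
  have cU : Continuous fun x : ℝ => (1 - ee (x + (a i - g)))⁻¹ :=
    (continuous_const.sub (differentiable_ee.continuous.comp
      (by fun_prop : Continuous fun x : ℝ => (x : ℂ) + (a i - g)))).inv₀ hU
  have cV : Continuous fun x : ℝ => (1 - ee (-x + (a j - g)))⁻¹ :=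
    (continuous_const.sub (differentiable_ee.continuous.comp
      (by fun_prop : Continuous fun x : ℝ => -(x : ℂ) + (a j - g)))).inv₀ hV
  have cUV : Continuous fun x : ℝ =>
      (1 - ee (x + (a i - g)))⁻¹ + (1 - ee (-x + (a j - g)))⁻¹ := cU.add cV
  have e : poleIntegral a A A (poleCompl a A i j) g = ∫ x : ℝ in (0 : ℝ)..1,
      (1 - ee (a i + a j - 2 * g))⁻¹ *
        ((1 - ee (x + (a i - g)))⁻¹ + (1 - ee (-x + (a j - g)))⁻¹ - 1) := by
    refine intervalIntegral.integral_congr fun x _ => ?_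
    simp only [poleCompl]
    have hA0 : poleUp a A (g, x) ≠ 0 := poleUp_ne_zero fun i hi => by simpa using hg i hi
    have hB0 : poleDown a A (g, x) ≠ 0 := poleDown_ne_zero fun i hi => by simpa using hg i hi
    have eA : poleUp a A (g, x) = (1 - ee (x + (a i - g))) * poleUp a (A.erase i) (g, x) := by
      rw [← add_sub_assoc]; exact (Finset.mul_prod_erase A _ hi).symm
    have eB : poleDown a A (g, x) = (1 - ee (-x + (a j - g))) * poleDown a (A.erase j) (g, x) := by
      rw [← add_sub_assoc]; exact (Finset.mul_prod_erase A _ hj).symm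
    have e : ee (a i + a j - 2 * g) = ee (x + (a i - g)) * ee (-x + (a j - g)) := by
      rw [← ee_add]; ring_nf
    have hUx := hU x
    have hVx := hV x
    rw [e] at h1 ⊢
    rw [eA] at hA0 ⊢
    rw [eB] at hB0 ⊢
    have := right_ne_zero_of_mul hA0
    have := right_ne_zero_of_mul hB0
    generalize ee (x + (a i - g)) = u at *
    generalize ee (-x + (a j - g)) = v at *
    field_simp
    ring
  rw [e, intervalIntegral.integral_const_mul, intervalIntegral.integral_sub
    (cUV.intervalIntegrable _ _) (continuous_const.intervalIntegrable _ _),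
    intervalIntegral.integral_add (cU.intervalIntegrable _ _) (cV.intervalIntegrable _ _),
    integral_inv_one_sub_ee hci, integral_inv_one_sub_ee_neg hcj]
  simp

end

section
variable {τ η : ℂ}

/-- Two entire functions whose products with `1 - e^{2πiw}` agree have the same value at `0`. -/
lemma eq_at_zero_of_one_sub_ee_mul {f h : ℂ → ℂ} (hf : Differentiable ℂ f)
    (hh : Differentiable ℂ h) (he : ∀ w, (1 - ee w) * f w = (1 - ee w) * h w) : f 0 = h 0 := by
  refine AnalyticAt.eq_of_eventuallyEq (hf.analyticAt 0) (hh.analyticAt 0) ?_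
  filter_upwards [eventually_ee_ne_one 1 0 0 one_ne_zero] with w hw
  rw [one_mul, add_zero] at hw
  exact mul_left_cancel₀ (sub_ne_zero.2 hw.symm) (he w)

/-- Both sides are what is left of the double product at w = 0 after cancelling 1 − e^{2πiw}, on the
right by way of the reflection factorisation. The value produces the constants that normalise M. -/
lemma drest_zero_zero (hτ : 0 < τ.im) (hη : 0 < η.im) : drest τ η {(0, 0)} 0 =
    qPoch (base τ) (base τ) * qPoch (base (2 * η)) (base (2 * η)) * dprod τ η (τ + 2 * η) := by
  have hp := norm_ee_lt_one hτ
  have hq := norm_ee_lt_one (im_two_mul_pos hη)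
  have h := eq_at_zero_of_one_sub_ee_mul (f := drest τ η {(0, 0)}) (h := fun w =>
      qPoch (ee (w + τ)) (ee τ) * qPoch (ee (w + 2 * η)) (ee (2 * η)) *
        dprod τ η (τ + 2 * η + w)) (differentiable_drest hτ hη _)
    ((((differentiable_qPoch_left hp).comp (differentiable_ee.comp
      (differentiable_id.add_const _))).mul ((differentiable_qPoch_left hq).comp
      (differentiable_ee.comp (differentiable_id.add_const _)))).mul
      ((differentiable_dprod hτ hη).comp (differentiable_id.const_add _))) fun w => by
    have h1 := dprod_eq_dfin_mul_drest hτ hη {(0, 0)} w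
    rw [dfin, Finset.prod_singleton, dprod_eq_reflFactor_mul hτ hη, reflFactor,
      qPoch_eq_mul _ hp] at h1
    simp only [lat, Nat.cast_zero, zero_mul, add_zero] at h1
    rw [← h1, ee_add w τ]
    ring
  simpa [base_eq_ee] using h

lemma dfin_erase_mul_drest (hτ : 0 < τ.im) (hη : 0 < η.im) {s : Finset (ℕ × ℕ)}
    (hs : (0, 0) ∈ s) : dfin τ η (s.erase (0, 0)) 0 * drest τ η s 0 = drest τ η {(0, 0)} 0 := by
  refine eq_at_zero_of_one_sub_ee_mul (f := fun w => dfin τ η (s.erase (0, 0)) w * drest τ η s w)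
    ?_ (differentiable_drest hτ hη _) fun w => ?_
  · refine Differentiable.mul ?_ (differentiable_drest hτ hη _)
    unfold dfin
    exact Differentiable.fun_finsetProd fun nm _ => (differentiable_ee.comp
      (differentiable_id.add_const _)).const_sub 1
  · have h1 := dprod_eq_dfin_mul_drest hτ hη {(0, 0)} w
    have h2 := dprod_eq_dfin_mul_drest hτ hη s w
    rw [dfin, Finset.prod_singleton] at h1
    rw [dfin, ← Finset.mul_prod_erase s _ hs] at h2
    simp only [lat, Nat.cast_zero, zero_mul, add_zero] at h1 h2
    rw [← h1, h2, mul_assoc]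
    rfl

/-- No incommensurability is needed at zero spin, since every nonzero lattice vector has positive
imaginary part. -/
lemma spinGeneric_zero (hτ : 0 < τ.im) (hη : 0 < η.im) : SpinGeneric τ η 0 0 := by
  rintro ⟨j, k⟩ h
  have h0 : lat τ η (0, 0) = 0 := by simp [lat]
  by_contra hne
  refine one_sub_ee_ne_zero (u := lat τ η (j, k)) ?_ (by rw [h, h0, ee_zero, sub_self])
  rw [lat_im]
  have h1 : 0 ≤ (j : ℝ) * τ.im := by positivity
  have h2 : 0 ≤ (k : ℝ) * (2 * η.im) := by positivity
  intro h3
  have hj : (j : ℝ) * τ.im = 0 := by linarith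
  have hk : (k : ℝ) * (2 * η.im) = 0 := by linarith
  refine hne ?_
  simp only [mul_eq_zero, Nat.cast_eq_zero, hτ.ne', hη.ne', or_false, two_ne_zero] at hj hk
  rw [hj, hk]

lemma integrandNum_even {z : ℂ} {s : Finset (ℕ × ℕ)} {Φ : ℂ → ℂ} (he : ∀ x, Φ (-x) = Φ x)
    (g x : ℂ) : integrandNum τ η z s Φ (g, -x) = integrandNum τ η z s Φ (g, x) := by
  simp only [integrandNum, he]
  have e1 : z + -x - g = z - x - g := by ring
  have e2 : z - -x - g = z + x - g := by ring
  have e3 : -z + -x - g = -z - x - g := by ring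
  have e4 : -z - -x - g = -z + x - g := by ring
  have e5 : 2 * -x = -2 * x := by ring
  have e6 : -2 * -x = 2 * x := by ring
  rw [e1, e2, e3, e4, e5, e6]
  ring

/-- The ratio which determines the residue at zero spin. -/
lemma integrandNum_eq_mul_poleCompl (hτ : 0 < τ.im) (hη : 0 < η.im) {z : ℂ}
    {s : Finset (ℕ × ℕ)} (hs0 : (0, 0) ∈ s) {Φ : ℂ → ℂ} (he : ∀ x, Φ (-x) = Φ x)
    (h1 : dprod τ η (2 * z) ≠ 0) (h2 : dprod τ η (-2 * z) ≠ 0) :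
    integrandNum τ η z s Φ (0, -z) = Φ z / (qPoch (base τ) (base τ) *
      qPoch (base (2 * η)) (base (2 * η))) ^ 2 *
      poleCompl (polePos τ η z) (s.disjSum s) (Sum.inl (0, 0)) (Sum.inr (0, 0)) (0, -z) := by
  have eA : (s.disjSum s).erase (Sum.inl (0, 0)) = (s.erase (0, 0)).disjSum s := by
    ext i; rcases i with i | i <;> simp
  have eB : (s.disjSum s).erase (Sum.inr (0, 0)) = s.disjSum (s.erase (0, 0)) := by
    ext i; rcases i with i | i <;> simp
  have hE := dfin_erase_mul_drest hτ hη hs0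
  rw [drest_zero_zero hτ hη] at hE
  have hp := dprod_eq_dfin_mul_drest hτ hη s (2 * z)
  have hm := dprod_eq_dfin_mul_drest hτ hη s (-2 * z)
  have rp := dprod_eq_reflFactor_mul hτ hη (2 * z)
  have rm := dprod_eq_reflFactor_mul hτ hη (-2 * z)
  have hT : dprod τ η (τ + 2 * η) ≠ 0 := dprod_ne_zero_of_im_pos hτ hη (by
    rw [Complex.add_im]; have := im_two_mul_pos hη; linarith)
  have hP : qPoch (base τ) (base τ) ≠ 0 := qPoch_self_ne_zero (norm_ee_lt_one hτ)
  have hQ : qPoch (base (2 * η)) (base (2 * η)) ≠ 0 :=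
    qPoch_self_ne_zero (norm_ee_lt_one (im_two_mul_pos hη))
  rw [poleCompl, eA, eB, poleUp_polePos, poleDown_polePos, integrandNum, he]
  have a1 : z + -z - 0 = 0 := by ring
  have a2 : z - -z - 0 = 2 * z := by ring
  have a3 : -z + -z - 0 = -2 * z := by ring
  have a4 : -z - -z - 0 = 0 := by ring
  have a5 : 2 * -z = -2 * z := by ring
  have a6 : -2 * -z = 2 * z := by ring
  have a7 : τ + 2 * η - -2 * z = τ + 2 * η + 2 * z := by ring
  have a8 : τ + 2 * η - 2 * z = τ + 2 * η + -2 * z := by ring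
  simp only [a1, a2, a3, a4, a5, a6]
  rw [a7, a8, sub_zero]
  have hdp := h1
  have hdm := h2
  rw [hp] at hdp
  rw [hm] at hdm
  have n1 : drest τ η s 0 ≠ 0 := right_ne_zero_of_mul (hE ▸ mul_ne_zero (mul_ne_zero hP hQ) hT)
  have n2 := right_ne_zero_of_mul hdp
  have n3 := right_ne_zero_of_mul hdm
  -- Two factorisations of the double product at ±2z: the reflection factors of the numerator become
  -- the finite products of the denominator.
  have k1 := hp.symm.trans rp
  have k2 := hm.symm.trans rm
  have hD := eq_div_of_mul_eq n1 hE
  rw [hD]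
  have k1' := eq_div_of_mul_eq n2 k1
  have k2' := eq_div_of_mul_eq n3 k2
  rw [k1', k2']
  field_simp

/-- `M(0) = 1` on even test functions. -/
theorem intertwiner_zero (hτ : 0 < τ.im) (hη : 0 < η.im) :
    ∀ᶠ z in codiscrete ℂ, ∀ Φ, IsTestFunction Φ → (∀ x, Φ (-x) = Φ x) →
      intertwiner τ η 0 Φ z = Φ z := by
  have hT : dprod τ η (τ + 2 * η) ≠ 0 := dprod_ne_zero_of_im_pos hτ hη (by
    rw [Complex.add_im]; have := im_two_mul_pos hη; linarith)
  have hdp : ∀ c : ℂ, c ≠ 0 → ∀ᶠ z in codiscrete ℂ, dprod τ η (c * z) ≠ 0 := fun c hc =>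
    eventually_codiscrete_ne_zero (x := (τ + 2 * η) / c) ((differentiable_dprod hτ hη).comp
      (differentiable_id.const_mul c)) (by
        rwa [mul_div_cancel₀ _ hc])
  have key : ∀ᶠ z in codiscrete ℂ, dprod τ η (2 * z) ≠ 0 → dprod τ η (-2 * z) ≠ 0 →
      ∀ Φ, IsTestFunction Φ → (∀ x, Φ (-x) = Φ x) → intertwiner τ η 0 Φ z = Φ z := by
    have hl0 : lat τ η (0, 0) = 0 := by simp [lat]
    have h2 : 2 * (0 : ℂ) = lat τ η (0, 0) := by rw [hl0, mul_zero]
    refine eventually_codiscrete_of_pinchGeneric (τ := τ) (η := η) 0 0 fun Y => ?_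
    obtain ⟨s, L, hs0, hL, hs⟩ := exists_pinch_integrand hτ hη (spinGeneric_zero hτ hη) h2 Y
    refine ⟨s, fun z hz hgen hz1 hz2 Φ hΦ hev => ?_⟩
    obtain ⟨hadm, hpin⟩ := hs z hz hgen
    set A := s.disjSum s
    set a := polePos τ η z
    set i₀ : (ℕ × ℕ) ⊕ (ℕ × ℕ) := Sum.inl (0, 0) with hi₀
    set i₁ : (ℕ × ℕ) ⊕ (ℕ × ℕ) := Sum.inr (0, 0) with hi₁
    have hA₀ : i₀ ∈ A := by simp [A, i₀, hs0]
    have hA₁ : i₁ ∈ A := by simp [A, i₁, hs0]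
    have ha₀ : a i₀ = z := by simp [a, i₀, polePos, hl0]
    have ha₁ : a i₁ = -z := by simp [a, i₁, polePos, hl0]
    set c := Φ z / (qPoch (base τ) (base τ) * qPoch (base (2 * η)) (base (2 * η))) ^ 2 with hc
    set H := integrandNum τ η z s Φ with hH
    have hHadm : IsAdmissible _ _ H := hadm Φ hΦ
    have hE1 := isAdmissible_poleCompl a A i₀ i₁ ((0 : ℂ).im + 1) L
    have hE2 := isAdmissible_poleCompl a A i₁ i₀ ((0 : ℂ).im + 1) L
    -- The subtracted comparison term takes the same values as `H` at the two pinching points x =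
    -- ∓z, where only one of its two summands is nonzero, so the remainder has no residue there.
    have hH' : IsAdmissible ((0 : ℂ).im + 1) L fun w =>
        H w - c * (poleCompl a A i₀ i₁ w + poleCompl a A i₁ i₀ w) :=
      ⟨hHadm.diff.sub ((hE1.diff.add hE2.diff).const_mul c), fun g x => by
        rw [hHadm.periodic, hE1.periodic, hE2.periodic]⟩
    have hsym : ∀ x, poleCompl a A i₁ i₀ (0, -x) = poleCompl a A i₀ i₁ (0, x) := fun x => by
      simp only [poleCompl, poleUp, poleDown, neg_neg]; ring
    have hv1 : H (0, -z) = c * poleCompl a A i₀ i₁ (0, -z) :=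
      integrandNum_eq_mul_poleCompl hτ hη hs0 hev hz1 hz2
    have hz0 : poleCompl a A i₁ i₀ (0, -z) = 0 := by
      rw [poleCompl, poleUp, Finset.prod_eq_zero (Finset.mem_erase.2 ⟨by simp [i₀, i₁], hA₀⟩),
        zero_mul]
      rw [ha₀]; simp [ee_zero]
    obtain ⟨G, K, hG, hG', hK, hGK, hv⟩ := hpin _ hH'
    have hAlt : ∀ g : ℂ, g.im < -|z.im| → ∀ i ∈ A, g.im < (a i).im := fun g hg i _ =>
      hg.trans_le (neg_abs_le_polePos_im hτ hη z i)
    have hee : ∀ g : ℂ, 2 * (0 - g) = z + -z - 2 * g := fun g => by ring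
    -- Restoring the comparison term adds the explicit integral 2c/(1 − e^{2πi(−2g)}) to `G`, hence
    -- the constant 2c to `K`.
    have he := intertwiner_eventuallyEq (G := fun g => G g + 2 * c * (1 - ee (2 * (0 - g)))⁻¹)
      (K := fun g => K g + 2 * c) hτ hη hΦ h2 (lt_add_one _)
      (fun g hg => (hG g hg).add ((MeromorphicAt.const _ _).mul (by
        have := (analyticAt_one_sub_ee 0 g).meromorphicAt.inv
        refine this.congr (Eventually.of_forall fun g => ?_)
        simp only [Pi.inv_apply]; ring_nf)))
      (fun g hg hgz => by
        have hlt := hAlt g hgz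
        have e1 := poleIntegral_poleCompl hA₀ hA₁ hlt
        have e2 := poleIntegral_poleCompl hA₁ hA₀ hlt
        rw [ha₀, ha₁] at e1 e2
        rw [add_comm (-z)] at e2
        have i1 : IntervalIntegrable _ MeasureTheory.volume 0 1 :=
          (continuous_poleIntegrand hE1 hL hg hlt hlt).intervalIntegrable _ _
        have i2 : IntervalIntegrable _ MeasureTheory.volume 0 1 :=
          (continuous_poleIntegrand hE2 hL hg hlt hlt).intervalIntegrable _ _
        have i3 : IntervalIntegrable _ MeasureTheory.volume 0 1 :=
          (continuous_poleIntegrand hH' hL hg hlt hlt).intervalIntegrable _ _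
        rw [hG' g hg hgz, hee g]
        have e3 : 2 * c * (1 - ee (z + -z - 2 * g))⁻¹ = c * (poleIntegral a A A
            (poleCompl a A i₀ i₁) g + poleIntegral a A A (poleCompl a A i₁ i₀) g) := by
          rw [e1, e2]; ring
        rw [e3]
        simp only [poleIntegral] at *
        rw [← intervalIntegral.integral_add i1 i2, ← intervalIntegral.integral_const_mul,
          ← intervalIntegral.integral_add i3 ((i1.add i2).const_mul c)]
        refine intervalIntegral.integral_congr fun x _ => ?_
        ring)
      (hK.add analyticAt_const) (by
        filter_upwards [hGK, eventually_one_sub_ee_ne_zero 0] with g h1 h2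
        rw [← h1, add_mul, mul_assoc (2 * c), inv_mul_cancel₀ h2, mul_one])
    rw [he.eq_of_nhds]
    have hK0 : K 0 = 0 := hv fun i hi j hj hij => by
      obtain ⟨b, b', hbb, hcase⟩ := pinch_cases (spinGeneric_zero hτ hη) hgen hi hj hij
      have hb : b = (0, 0) := by
        obtain ⟨h3, h4⟩ := Prod.mk.inj hbb
        ext <;> simp <;> omega
      subst hb
      rcases hcase with ⟨rfl, -⟩ | ⟨rfl, -⟩
      · change H (0, 0 - a i₀) - c * (poleCompl a A i₀ i₁ (0, 0 - a i₀) +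
          poleCompl a A i₁ i₀ (0, 0 - a i₀)) = 0
        rw [ha₀, zero_sub, hz0, hv1]; ring
      · change H (0, 0 - a i₁) - c * (poleCompl a A i₀ i₁ (0, 0 - a i₁) +
          poleCompl a A i₁ i₀ (0, 0 - a i₁)) = 0
        have e1 := hsym (-z)
        have e2 := hsym z
        rw [hz0] at e2
        rw [neg_neg] at e1
        have e4 : H (0, -z) = H (0, z) := integrandNum_even hev 0 z
        rw [ha₁, zero_sub, neg_neg, e1, ← e4, hv1]
        have e3 : poleCompl a A i₀ i₁ (0, z) = 0 := e2.symm
        rw [e3]; ring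
    -- The value is 2c times the regularised prefactor at 0, and all products (p;p)_∞, (q;q)_∞
    -- cancel.
    simp only [hK0, regSpinFactor, mul_zero, add_zero, zero_add]
    rw [drest_zero_zero hτ hη, hc]
    have hP : qPoch (base τ) (base τ) ≠ 0 := qPoch_self_ne_zero (norm_ee_lt_one hτ)
    have hQ : qPoch (base (2 * η)) (base (2 * η)) ≠ 0 :=
      qPoch_self_ne_zero (norm_ee_lt_one (im_two_mul_pos hη))
    field_simp
  filter_upwards [key, hdp 2 two_ne_zero, hdp (-2) (by norm_num)] with z h1 h2 h3 using h1 h2 h3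

end

section
variable {τ η : ℂ}

/-! ### The recurrence in the spin -/

lemma constR_ne_zero (hτ : 0 < τ.im) : constR τ ≠ 0 :=
  div_ne_zero (Complex.exp_ne_zero _)
    (mul_ne_zero Complex.I_ne_zero (qPoch_self_ne_zero (norm_ee_lt_one hτ)))

lemma mtheta_neg (hτ : 0 < τ.im) (z : ℂ) : mtheta τ (-z) = -(ee (-z) * mtheta τ z) := by
  have hp := norm_ee_lt_one hτ
  have h1 := ee_add z (-z)
  rw [add_neg_cancel, ee_zero] at h1
  rw [mtheta, mtheta, qPoch_eq_mul (ee z) hp, qPoch_eq_mul (ee (-z)) hp, ← ee_add, ← ee_add]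
  have e1 : τ - -z = z + τ := by ring
  have e2 : -z + τ = τ - z := by ring
  rw [e1, e2]
  linear_combination (qPoch (ee (τ - z)) (ee τ) * qPoch (ee (z + τ)) (ee τ)) * h1

lemma theta1_neg (hτ : 0 < τ.im) (z : ℂ) : theta1 (-z) τ = -theta1 z τ := by
  refine mul_left_cancel₀ (constR_ne_zero hτ) ?_
  rw [mul_neg, constR_mul_theta1 hτ, constR_mul_theta1 hτ, mtheta_neg hτ, mul_neg, ← mul_assoc,
    ← ee_add]
  congr 3; ring

lemma mtheta_eq (hτ : 0 < τ.im) (z : ℂ) : mtheta τ z = constR τ * ee (z / 2) * theta1 z τ := by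
  have h := constR_mul_theta1 hτ z
  have h1 := ee_add (z / 2) (-z / 2)
  rw [← add_div, add_neg_cancel, zero_div, ee_zero] at h1
  linear_combination (-ee (z / 2)) * h + mtheta τ z * h1

/-- Here both products in the triple product have first argument e^{πiτ}, of modulus below 1. The
point witnesses that θ₁ and θ_k do not vanish identically. -/
lemma theta1_half_period_ne_zero (hτ : 0 < τ.im) : theta1 (τ / 2) τ ≠ 0 := by
  have hp := norm_ee_lt_one hτ
  have hne : qPoch (ee (τ / 2)) (ee τ) ≠ 0 := qPoch_ne_zero hp fun k hk => by
    have h1 := norm_ee_lt_one (im_half_pos hτ)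
    have : ‖ee (τ / 2) * ee τ ^ k‖ < 1 := by
      rw [norm_mul, norm_pow]
      calc _ ≤ ‖ee (τ / 2)‖ * 1 := by
            gcongr; exact pow_le_one₀ (norm_nonneg _) hp.le
        _ < 1 := by rwa [mul_one]
    rw [hk, norm_one] at this
    exact lt_irrefl _ this
  have h := mtheta_eq hτ (τ / 2)
  intro h0
  rw [h0, mul_zero, mtheta, sub_half] at h
  exact mul_ne_zero hne hne h

/-- The difference operator `A_k(g)`, with the exponentials simplified. -/
lemma opA_eq (hη : 0 < η.im) (k : ThetaIndex) (g : ℂ) (Φ : ℂ → ℂ) (z : ℂ) :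
    opA τ η k g Φ z = (theta k (z + (g + η)) (τ / 2) * ee (-z) * Φ (z + η) -
      theta k (z - (g + η)) (τ / 2) * ee z * Φ (z - η)) / (constR τ * theta1 (2 * z) τ) := by
  have hη0 : η ≠ 0 := fun h => by simp [h] at hη
  have h1 : Complex.exp (π * Complex.I * z ^ 2 / η) * Complex.exp (π * Complex.I * η) *
      Complex.exp (-(π * Complex.I * (z + η) ^ 2 / η)) = ee (-z) := by
    rw [← Complex.exp_add, ← Complex.exp_add, ee]; congr 1; field_simp; ring
  have h2 : Complex.exp (π * Complex.I * z ^ 2 / η) * Complex.exp (π * Complex.I * η) *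
      Complex.exp (-(π * Complex.I * (z - η) ^ 2 / η)) = ee z := by
    rw [← Complex.exp_add, ← Complex.exp_add, ee]; congr 1; field_simp; ring
  rw [opA, ← h1, ← h2, div_div, ← add_assoc, sub_sub]
  ring

lemma spinKernel_im_pos {z g : ℂ} (hg : g.im < -|z.im|) (x : ℝ) :
    0 < (z + x - g).im ∧ 0 < (z - x - g).im ∧ 0 < (-z + x - g).im ∧ 0 < (-z - x - g).im := by
  have h1 := neg_abs_le z.im
  have h2 := le_abs_self z.im
  refine ⟨?_, ?_, ?_, ?_⟩ <;>
    simp only [Complex.sub_im, Complex.add_im, Complex.neg_im, Complex.ofReal_im] <;> linarith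

/-- The recurrence at the level of the kernel. -/
lemma opA_spinKernel (hτ : 0 < τ.im) (hη : 0 < η.im) (k : ThetaIndex) {g z : ℂ}
    (hz : theta1 (2 * z) τ ≠ 0) (hg : (g + η).im < -|z.im|) (hg' : theta1 (-2 * (g + η)) τ ≠ 0)
    (x : ℝ) :
    opA τ η k g (fun z' => spinKernel τ η g z' x) z =
      theta k x (τ / 2) * spinKernel τ η (g + η) z x := by
  set G := g + η with hG
  obtain ⟨h1, h2, h3, h4⟩ := spinKernel_im_pos hg x
  have hshift : ∀ w : ℂ, 0 < w.im → ellGamma τ η (w + 2 * η) = mtheta τ w * ellGamma τ η w :=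
    fun w hw => ellGamma_add_two_mul hτ hη (dprod_ne_zero_of_im_pos hτ hη hw)
  have hR := constR_ne_zero hτ
  -- In terms of G = g + η, the shift z + η moves the two arguments containing z by 2η, and z − η
  -- the two containing −z. Both shifted kernels are thus theta multiples of the kernel at spin G.
  have a1 : z + η + x - g = z + x - G + 2 * η := by rw [hG]; ring
  have a2 : z + η - x - g = z - x - G + 2 * η := by rw [hG]; ring
  have a3 : -(z + η) + x - g = -z + x - G := by rw [hG]; ring
  have a4 : -(z + η) - x - g = -z - x - G := by rw [hG]; ring
  have b1 : z - η + x - g = z + x - G := by rw [hG]; ring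
  have b2 : z - η - x - g = z - x - G := by rw [hG]; ring
  have b3 : -(z - η) + x - g = -z + x - G + 2 * η := by rw [hG]; ring
  have b4 : -(z - η) - x - g = -z - x - G + 2 * η := by rw [hG]; ring
  have c1 : -2 * g = -2 * G + 2 * η := by rw [hG]; ring
  have hGim : 0 < (-2 * G).im := by
    have := abs_nonneg z.im
    simp [Complex.mul_im] at *
    linarith
  rw [opA_eq hη, ← hG]
  simp only [spinKernel]
  rw [a1, a2, a3, a4, b1, b2, b3, b4, c1, hshift _ h1, hshift _ h2, hshift _ h3, hshift _ h4,
    hshift _ hGim, mtheta_eq hτ (z + x - G), mtheta_eq hτ (z - x - G), mtheta_eq hτ (-z + x - G),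
    mtheta_eq hτ (-z - x - G), mtheta_eq hτ (-2 * G)]
  have t1 : theta1 (-z + x - G) τ = -theta1 (z + G - x) τ := by
    rw [← theta1_neg hτ]; ring_nf
  have t2 : theta1 (-z - x - G) τ = -theta1 (z + G + x) τ := by
    rw [← theta1_neg hτ]; ring_nf
  have t3 : z + x - G = z - G + x := by ring
  have t4 : z - x - G = z - G - x := by ring
  have e1 : ee (-z) * (ee ((z + x - G) / 2) * ee ((z - x - G) / 2)) = ee (-2 * G / 2) := by
    rw [← ee_add, ← ee_add]; ring_nf
  have e2 : ee z * (ee ((-z + x - G) / 2) * ee ((-z - x - G) / 2)) = ee (-2 * G / 2) := by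
    rw [← ee_add, ← ee_add]; ring_nf
  rw [t1, t2]
  -- After the common kernel is removed the claim is the three-term identity; the exponentials
  -- combine to the same factor `E` in both terms.
  have h3t := theta_three_term k hτ z G x
  rw [← t3, ← t4] at h3t
  have hE := ee_ne_zero (-2 * G / 2)
  generalize ee (-2 * G / 2) = E at *
  generalize ee ((z + x - G) / 2) = E1 at *
  generalize ee ((z - x - G) / 2) = E2 at *
  generalize ee ((-z + x - G) / 2) = E3 at *
  generalize ee ((-z - x - G) / 2) = E4 at *
  generalize ee z = Ez at *
  generalize ee (-z) = Ez' at *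
  rw [div_eq_iff (mul_ne_zero hR hz)]
  have hD : (constR τ * E * theta1 (-2 * G) τ) ≠ 0 := mul_ne_zero (mul_ne_zero hR hE) hg'
  set K := ellGamma τ η (z + x - G) * ellGamma τ η (z - x - G) * ellGamma τ η (-z + x - G) *
    ellGamma τ η (-z - x - G) / (ellGamma τ η (-2 * G) * ellGamma τ η (2 * x) *
      ellGamma τ η (-2 * x)) with hK
  have k1 : ∀ m1 m2 : ℂ, m1 * ellGamma τ η (z + x - G) * (m2 * ellGamma τ η (z - x - G)) *
      ellGamma τ η (-z + x - G) * ellGamma τ η (-z - x - G) /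
      (constR τ * E * theta1 (-2 * G) τ * ellGamma τ η (-2 * G) * ellGamma τ η (2 * x) *
      ellGamma τ η (-2 * x)) = m1 * m2 / (constR τ * E * theta1 (-2 * G) τ) * K := fun m1 m2 => by
    rw [hK, div_mul_div_comm]; congr 1 <;> ring
  have k2 : ∀ m1 m2 : ℂ, ellGamma τ η (z + x - G) * ellGamma τ η (z - x - G) *
      (m1 * ellGamma τ η (-z + x - G)) * (m2 * ellGamma τ η (-z - x - G)) /
      (constR τ * E * theta1 (-2 * G) τ * ellGamma τ η (-2 * G) * ellGamma τ η (2 * x) *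
      ellGamma τ η (-2 * x)) = m1 * m2 / (constR τ * E * theta1 (-2 * G) τ) * K := fun m1 m2 => by
    rw [hK, div_mul_div_comm]; congr 1 <;> ring
  rw [k1, k2]
  clear_value K
  generalize theta1 (-2 * G) τ = T at *
  generalize theta1 (2 * z) τ = S at *
  field_simp
  linear_combination (K * theta k (z + G) (τ / 2) * theta1 (z + x - G) τ *
      theta1 (z - x - G) τ) * e1 - (K * theta k (z - G) (τ / 2) * theta1 (z + G + x) τ *
      theta1 (z + G - x) τ) * e2 + K * E * h3t

lemma intervalIntegrable_spinKernel (hτ : 0 < τ.im) (hη : 0 < η.im) {Φ : ℂ → ℂ}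
    (hΦ : IsTestFunction Φ) {g z : ℂ} (hg : g.im < -|z.im|) :
    IntervalIntegrable (fun x : ℝ => spinKernel τ η g z x * Φ x) MeasureTheory.volume 0 1 := by
  obtain ⟨s, -, hs⟩ := exists_finset_lat hτ hη (-|z.im| + 1 + |z.im|)
  have hlt : ∀ i ∈ s.disjSum s, g.im < (polePos τ η z i).im := fun i _ =>
    hg.trans_le (neg_abs_le_polePos_im hτ hη z i)
  simp only [spinKernel_mul_eq hτ hη s]
  exact ((continuous_poleIntegrand (isAdmissible_integrandNum hτ hη hs hΦ) one_pos hg hlt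
    hlt).const_mul _).intervalIntegrable _ _

lemma IsTestFunction.theta_mul (hτ : 0 < τ.im) (k : ThetaIndex) {Φ : ℂ → ℂ}
    (hΦ : IsTestFunction Φ) : IsTestFunction fun x => theta k x (τ / 2) * Φ x :=
  ⟨(differentiable_theta k (im_half_pos hτ)).mul hΦ.1, fun z => by
    simp only [theta_add_one, hΦ.2]⟩

/-- The recurrence on the domain of convergence. -/
lemma opA_intertwinerIntegral (hτ : 0 < τ.im) (hη : 0 < η.im) (k : ThetaIndex) {Φ : ℂ → ℂ}
    (hΦ : IsTestFunction Φ) {g z : ℂ} (hz : theta1 (2 * z) τ ≠ 0) (hg : (g + η).im < -|z.im|)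
    (hgp : g.im < -|(z + η).im|) (hgm : g.im < -|(z - η).im|)
    (hg' : theta1 (-2 * (g + η)) τ ≠ 0) :
    opA τ η k g (fun z' => intertwinerIntegral τ η g Φ z') z =
      intertwinerIntegral τ η (g + η) (fun x => theta k x (τ / 2) * Φ x) z := by
  have e : ∀ g Φ z, intertwinerIntegral τ η g Φ z = qPoch (base (2 * η)) (base (2 * η)) *
      qPoch (base τ) (base τ) / 2 * ∫ x : ℝ in (0 : ℝ)..1, spinKernel τ η g z x * Φ x :=
    fun _ _ _ => rfl
  have e2 : ∀ x : ℝ, spinKernel τ η (g + η) z x * (theta k x (τ / 2) * Φ x) =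
      theta k (z + (g + η)) (τ / 2) * ee (-z) / (constR τ * theta1 (2 * z) τ) *
        (spinKernel τ η g (z + η) x * Φ x) -
      theta k (z - (g + η)) (τ / 2) * ee z / (constR τ * theta1 (2 * z) τ) *
        (spinKernel τ η g (z - η) x * Φ x) := fun x => by
    rw [← mul_assoc, mul_comm (spinKernel _ _ _ _ _), ← opA_spinKernel hτ hη k hz hg hg' x,
      opA_eq hη]
    ring
  rw [opA_eq hη]
  simp only [e]
  simp only [e2]
  rw [intervalIntegral.integral_sub ((intervalIntegrable_spinKernel hτ hη hΦ hgp).const_mul _)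
    ((intervalIntegrable_spinKernel hτ hη hΦ hgm).const_mul _),
    intervalIntegral.integral_const_mul, intervalIntegral.integral_const_mul]
  ring

/-- `M(g + η) θ_k = A_k(g) M(g)`. -/
theorem intertwiner_add_eta (hτ : 0 < τ.im) (hη : 0 < η.im) (k : ThetaIndex) {Φ : ℂ → ℂ}
    (hΦ : IsTestFunction Φ) {z : ℂ} (hz : theta1 (2 * z) τ ≠ 0) (g₀ : ℂ) :
    (fun g => intertwiner τ η (g + η) (fun x => theta k x (τ / 2) * Φ x) z) =ᶠ[𝓝[≠] g₀]
      fun g => opA τ η k g (fun z' => intertwiner τ η g Φ z') z := by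
  have hF := isSpinContinuation_intertwiner hτ hη (hΦ.theta_mul hτ k) z
  have hP := isSpinContinuation_intertwiner hτ hη hΦ (z + η)
  have hM := isSpinContinuation_intertwiner hτ hη hΦ (z - η)
  have hth := differentiable_theta k (im_half_pos hτ)
  -- Low enough for the integrals with spin g at z ± η and with spin g + η at z all to converge.
  set y : ℝ := -|z.im| - |(z + η).im| - |(z - η).im| - η.im - 1 with hy
  set g₁ : ℂ := (y : ℂ) * Complex.I with hg₁
  have hg₁' : g₁.im = y := by simp [hg₁]
  have n1 := abs_nonneg z.im
  have n2 := abs_nonneg (z + η).im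
  have n3 := abs_nonneg (z - η).im
  have d1 : (g₁ + η).im < -|z.im| := by rw [Complex.add_im, hg₁', hy]; linarith
  have d2 : g₁.im < -|(z + η).im| := by rw [hg₁', hy]; linarith
  have d3 : g₁.im < -|(z - η).im| := by rw [hg₁', hy]; linarith
  refine MeromorphicOn.eventuallyEq_of_eventuallyEq (U := Set.univ) (x := g₁) ?_ ?_
    isPreconnected_univ trivial trivial ?_
  · intro g _
    have := (meromorphicNFAt_comp_add_const_iff_meromorphicNFAt (x := g) (c := η)
      (f := fun g => intertwiner τ η g (fun x => theta k x (τ / 2) * Φ x) z)).2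
        (hF.1 (Set.mem_univ _))
    exact this.meromorphicAt
  · intro g _
    have m1 : MeromorphicAt (fun g => theta k (z + (g + η)) (τ / 2) * ee (-z)) g :=
      ((hth.comp (by fun_prop : Differentiable ℂ fun g : ℂ => z + (g + η))).analyticAt
        g).meromorphicAt.mul (MeromorphicAt.const _ _)
    have m2 : MeromorphicAt (fun g => theta k (z - (g + η)) (τ / 2) * ee z) g :=
      ((hth.comp (by fun_prop : Differentiable ℂ fun g : ℂ => z - (g + η))).analyticAt
        g).meromorphicAt.mul (MeromorphicAt.const _ _)
    simp only [opA_eq hη]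
    exact ((m1.mul (hP.1 (Set.mem_univ g)).meromorphicAt).sub
      (m2.mul (hM.1 (Set.mem_univ g)).meromorphicAt)).div (MeromorphicAt.const _ _)
  · have hT : ∀ᶠ g in 𝓝[≠] g₁, theta1 (-2 * (g + η)) τ ≠ 0 := by
      refine eventually_codiscrete_iff.1 (eventually_codiscrete_ne_zero
        (x := -(τ / 2) / 2 - η) ((differentiable_theta1 hτ).comp
        (by fun_prop : Differentiable ℂ fun g : ℂ => -2 * (g + η))) ?_) g₁
      have e : -2 * (-(τ / 2) / 2 - η + η) = τ / 2 := by ring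
      change theta1 (-2 * (-(τ / 2) / 2 - η + η)) τ ≠ 0
      rw [e]
      exact theta1_half_period_ne_zero hτ
    have hshift : Tendsto (fun g => g + η) (𝓝[≠] g₁) (𝓝[≠] (g₁ + η)) :=
      tendsto_nhdsWithin_of_tendsto_nhds_of_eventually_within _
        ((continuous_add_const η).continuousAt.tendsto.mono_left nhdsWithin_le_nhds)
        (by filter_upwards [self_mem_nhdsWithin] with g hg h using hg (add_right_cancel h))
    filter_upwards [hT, hP.eventuallyEq_integral hτ hη d2, hM.eventuallyEq_integral hτ hη d3,
      hshift.eventually (hF.eventuallyEq_integral hτ hη d1),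
      mem_nhdsWithin_of_mem_nhds ((isOpen_im_lt _).mem_nhds d2),
      mem_nhdsWithin_of_mem_nhds ((isOpen_im_lt _).mem_nhds d3),
      hshift.eventually (mem_nhdsWithin_of_mem_nhds ((isOpen_im_lt _).mem_nhds d1))]
      with g h1 h2 h3 h4 h5 h6 h7
    rw [h4, ← opA_intertwinerIntegral hτ hη k hΦ hz h7 h5 h6 h1, opA_eq hη, opA_eq hη, h2, h3]

/-- The recurrence at a point where all the operators are regular. -/
lemma intertwiner_add_eta_of_analyticAt (hτ : 0 < τ.im) (hη : 0 < η.im) (k : ThetaIndex)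
    {Φ : ℂ → ℂ} (hΦ : IsTestFunction Φ) {z g : ℂ} (hz : theta1 (2 * z) τ ≠ 0)
    (h1 : AnalyticAt ℂ (fun g => intertwiner τ η g (fun x => theta k x (τ / 2) * Φ x) z) (g + η))
    (h2 : AnalyticAt ℂ (fun g => intertwiner τ η g Φ (z + η)) g)
    (h3 : AnalyticAt ℂ (fun g => intertwiner τ η g Φ (z - η)) g) :
    intertwiner τ η (g + η) (fun x => theta k x (τ / 2) * Φ x) z =
      opA τ η k g (fun z' => intertwiner τ η g Φ z') z := by
  have hth := differentiable_theta k (im_half_pos hτ)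
  refine AnalyticAt.eq_of_eventuallyEq
    (f := fun g => intertwiner τ η (g + η) (fun x => theta k x (τ / 2) * Φ x) z)
    (h := fun g => opA τ η k g (fun z' => intertwiner τ η g Φ z') z) ?_ ?_
    (intertwiner_add_eta hτ hη k hΦ hz g)
  · exact AnalyticAt.comp (f := fun g => g + η) h1 (analyticAt_id.add analyticAt_const)
  · have m1 : AnalyticAt ℂ (fun g => theta k (z + (g + η)) (τ / 2) * ee (-z)) g :=
      ((hth.comp (by fun_prop : Differentiable ℂ fun g : ℂ => z + (g + η))).analyticAt
        g).mul analyticAt_const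
    have m2 : AnalyticAt ℂ (fun g => theta k (z - (g + η)) (τ / 2) * ee z) g :=
      ((hth.comp (by fun_prop : Differentiable ℂ fun g : ℂ => z - (g + η))).analyticAt
        g).mul analyticAt_const
    simp only [opA_eq hη]
    exact ((m1.mul h2).sub (m2.mul h3)).div analyticAt_const
      (mul_ne_zero (constR_ne_zero hτ) hz)

end

section
variable {τ η : ℂ}

/-! ### Codiscrete sets -/

lemma tendsto_add_const_nhdsNE (c x : ℂ) :
    Tendsto (fun z : ℂ => z + c) (𝓝[≠] x) (𝓝[≠] (x + c)) :=
  tendsto_nhdsWithin_of_tendsto_nhds_of_eventually_within _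
    ((continuous_add_const c).continuousAt.tendsto.mono_left nhdsWithin_le_nhds)
    (by filter_upwards [self_mem_nhdsWithin] with z hz h using hz (add_right_cancel h))

lemma eventually_codiscrete_add {P : ℂ → Prop} (h : ∀ᶠ z in codiscrete ℂ, P z) (c : ℂ) :
    ∀ᶠ z in codiscrete ℂ, P (z + c) := by
  rw [eventually_codiscrete_iff] at h ⊢
  exact fun x => (tendsto_add_const_nhdsNE c x).eventually (h (x + c))

lemma exists_theta_ne_zero (k : ThetaIndex) (hτ : 0 < τ.im) : ∃ x, theta k x τ ≠ 0 := by
  have h := theta1_half_period_ne_zero hτ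
  rw [theta1_eq, neg_ne_zero] at h
  have h3 := right_ne_zero_of_mul h
  cases k
  · exact ⟨_, by simp only [theta, theta3_eq]; exact h3⟩
  · refine ⟨τ / 2 + τ / 2, ?_⟩
    simp only [theta, theta4_eq]
    rwa [add_right_comm]

lemma eventually_theta_ne_zero (k : ThetaIndex) (hτ : 0 < τ.im) :
    ∀ᶠ z in codiscrete ℂ, theta k z τ ≠ 0 := by
  obtain ⟨x, hx⟩ := exists_theta_ne_zero k hτ
  exact eventually_codiscrete_ne_zero (differentiable_theta k hτ) hx

lemma eventually_theta1_two_mul_ne_zero (hτ : 0 < τ.im) :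
    ∀ᶠ z in codiscrete ℂ, theta1 (2 * z) τ ≠ 0 := by
  refine eventually_codiscrete_ne_zero (x := τ / 2 / 2) ((differentiable_theta1 hτ).comp
    (differentiable_id.const_mul 2)) ?_
  rw [mul_div_cancel₀ _ two_ne_zero]
  exact theta1_half_period_ne_zero hτ

/-! ### Incommensurate periods -/

/-- `1, 2η, τ` have no nontrivial integral relation. -/
def Incommensurate (τ η : ℂ) : Prop :=
  ∀ a b c : ℤ, (a : ℂ) + b * (2 * η) + c * τ = 0 → b = 0 ∧ c = 0

lemma incommensurate_of_linearIndependent (h : LinearIndependent ℚ ![(1 : ℂ), 2 * η, τ]) :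
    Incommensurate τ η := by
  intro a b c habc
  have := Fintype.linearIndependent_iff.1 h ![(a : ℚ), b, c] (by
    simp only [Fin.sum_univ_three, Matrix.cons_val_zero, Matrix.cons_val_one, Matrix.cons_val]
    rw [← habc]
    simp [Rat.smul_def])
  exact ⟨by simpa using this 1, by simpa using this 2⟩

lemma Incommensurate.swap (h : Incommensurate τ η) : Incommensurate (2 * η) (τ / 2) :=
  fun a b c habc => (h a c b (by rw [← habc]; ring)).symm

lemma Incommensurate.spinGeneric (h : Incommensurate τ η) (m n : ℕ) : SpinGeneric τ η m n := by
  rintro ⟨j, k⟩ hjk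
  have h1 : ee (lat τ η (j, k) - lat τ η (m, n)) = 1 := by
    rw [ee_sub, hjk, div_self (ee_ne_zero _)]
  obtain ⟨a, ha⟩ := (ee_eq_one_iff _).1 h1
  obtain ⟨h2, h3⟩ := h (-a) (k - n) (j - m) (by
    simp only [lat] at ha
    push_cast
    linear_combination ha)
  ext <;> simp only <;> omega

/-! ### Interpolation -/

/-- Even test functions take arbitrary values at finitely many points of a generic shifted
lattice. -/
lemma exists_even_testFunction (hinc : Incommensurate τ η) (n m : ℕ) :
    ∀ᶠ z in codiscrete ℂ, ∀ v : ℂ → ℂ, ∃ Φ : ℂ → ℂ, IsTestFunction Φ ∧ (∀ x, Φ (-x) = Φ x) ∧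
      ∀ α β : ℤ, |α| ≤ n → |β| ≤ m →
        Φ (z + (α * η + β * (τ / 2))) = v (z + (α * η + β * (τ / 2))) := by
  set S : Finset (ℤ × ℤ) := Finset.Icc (-n : ℤ) n ×ˢ Finset.Icc (-m : ℤ) m with hS
  have hmem : ∀ α β : ℤ, |α| ≤ n → |β| ≤ m → (α, β) ∈ S := fun α β hα hβ => by
    simp only [hS, Finset.mem_product, Finset.mem_Icc]
    exact ⟨abs_le.1 hα, abs_le.1 hβ⟩
  set l : ℤ × ℤ → ℂ := fun ab => ab.1 * η + ab.2 * (τ / 2) with hl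
  have hgen : ∀ᶠ z in codiscrete ℂ, ∀ p ∈ S, ∀ p' ∈ S, ee (2 * z + (l p + l p')) ≠ 1 := by
    simp only [Filter.eventually_all_finset]
    intro p _ p' _
    exact eventually_codiscrete_iff.2 fun z₀ => eventually_ee_ne_one 2 _ z₀ two_ne_zero
  filter_upwards [hgen] with z hz v
  -- Polynomials in e^{2πix} + e^{−2πix} are even test functions, so Lagrange interpolation works
  -- once this function separates the nodes.
  set c : ℂ → ℂ := fun x => ee x + ee (-x) with hc
  have hinj : Set.InjOn (fun p => c (z + l p)) S := by
    intro p hp p' hp' hpp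
    simp only [hc, neg_add] at hpp
    -- With X, Y the exponentials of the two nodes, X + 1/X = Y + 1/Y means (X − Y)(XY − 1) = 0.
    -- Incommensurability turns X = Y into equal indices, and genericity of z excludes XY = 1.
    have h1 : (ee (z + l p) - ee (z + l p')) * (ee (2 * z + (l p + l p')) - 1) = 0 := by
      have e1 := ee_add (z + l p) (-z + -l p)
      have e2 := ee_add (z + l p') (-z + -l p')
      have e3 : z + l p + (-z + -l p) = 0 := by ring
      have e4 : z + l p' + (-z + -l p') = 0 := by ring
      have e5 : 2 * z + (l p + l p') = (z + l p) + (z + l p') := by ring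
      rw [e3, ee_zero] at e1
      rw [e4, ee_zero] at e2
      rw [e5, ee_add (z + l p) (z + l p')]
      linear_combination (ee (z + l p) * ee (z + l p')) * hpp + ee (z + l p') * e1 -
        ee (z + l p) * e2
    rcases mul_eq_zero.1 h1 with h2 | h2
    · have h3 : ee (l p - l p') = 1 := by
        have e : l p - l p' = z + l p - (z + l p') := by ring
        rw [e, ee_sub, sub_eq_zero.1 h2, div_self (ee_ne_zero _)]
      obtain ⟨a, ha⟩ := (ee_eq_one_iff _).1 h3
      obtain ⟨h4, h5⟩ := hinc (-2 * a) (p.1 - p'.1) (p.2 - p'.2) (by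
        simp only [hl] at ha
        push_cast
        linear_combination 2 * ha)
      exact Prod.ext (sub_eq_zero.1 h4) (sub_eq_zero.1 h5)
    · exact absurd (sub_eq_zero.1 h2) (hz p hp p' hp')
  obtain ⟨P, hP⟩ : ∃ P : Polynomial ℂ, ∀ p ∈ S, P.eval (c (z + l p)) = v (z + l p) :=
    ⟨_, fun p hp => Lagrange.eval_interpolate_at_node (fun p => v (z + l p)) hinj hp⟩
  refine ⟨fun x => P.eval (c x), ⟨?_, fun x => ?_⟩, fun x => ?_, fun α β hα hβ =>
    hP (α, β) (hmem α β hα hβ)⟩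
  · exact P.differentiable.comp
      (differentiable_ee.add (differentiable_ee.comp differentiable_neg) : Differentiable ℂ c)
  · have e : c (x + 1) = c x := by
      simp only [hc]
      rw [ee_add_one, ← ee_add_one (-(x + 1))]
      ring_nf
    exact congrArg (fun y => P.eval y) e
  · have e : c (-x) = c x := by
      simp only [hc]
      rw [neg_neg, add_comm]
    exact congrArg (fun y => P.eval y) e

/-! ### The factored operators -/

/-- The exchange of 2η and τ is the substitution (τ, η) → (2η, τ/2), so facts about A_k transfer to
B_k. -/
lemma opB_eq_opA (k : ThetaIndex) (g : ℂ) (Φ : ℂ → ℂ) :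
    opB τ η k g Φ = opA (2 * η) (τ / 2) k g Φ := by
  funext z
  have e : ∀ w : ℂ, 2 * π * Complex.I * w ^ 2 / τ = π * Complex.I * w ^ 2 / (τ / 2) := fun w => by
    rw [div_div_eq_mul_div]; ring
  simp only [opB, opA, e, mul_div_cancel_left₀ η (two_ne_zero' ℂ)]

lemma prodB_eq_prodA (k : ThetaIndex) (s : ℂ) (m : ℕ) (Φ : ℂ → ℂ) :
    prodB τ η k s m Φ = prodA (2 * η) (τ / 2) k s m Φ := by
  induction m with
  | zero => rfl
  | succ m ih => rw [prodB, prodA, opB_eq_opA, ih]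

lemma opA_congr (k : ThetaIndex) (g : ℂ) {Φ Ψ : ℂ → ℂ} {z : ℂ} (h1 : Φ (z + η) = Ψ (z + η))
    (h2 : Φ (z - η) = Ψ (z - η)) : opA τ η k g Φ z = opA τ η k g Ψ z := by
  simp only [opA, h1, h2]

lemma prodA_congr (k : ThetaIndex) (s : ℂ) {Φ Ψ : ℂ → ℂ} {n : ℕ} {z : ℂ}
    (h : ∀ α : ℤ, |α| ≤ n → Φ (z + α * η) = Ψ (z + α * η)) :
    prodA τ η k s n Φ z = prodA τ η k s n Ψ z := by
  induction n generalizing z with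
  | zero =>
    have := h 0 (by simp)
    simpa [prodA] using this
  | succ n ih =>
    refine opA_congr k _ (ih fun α hα => ?_) (ih fun α hα => ?_)
    · have := h (α + 1) (by rw [abs_le] at hα ⊢; push_cast; constructor <;> linarith)
      push_cast at this
      rwa [add_mul, one_mul, add_comm (_ * η), ← add_assoc] at this
    · have := h (α - 1) (by rw [abs_le] at hα ⊢; push_cast; constructor <;> linarith)
      push_cast at this
      rwa [sub_mul, one_mul, add_sub, sub_eq_add_neg, add_right_comm, ← sub_eq_add_neg] at this

/-- The functions `A ⋯ A B ⋯ B Φ` depend only on the values of `Φ` on a finite part of the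
lattice. -/
lemma prodA_prodB_congr (k : ThetaIndex) (s s' : ℂ) {Φ Ψ : ℂ → ℂ} {n m : ℕ} {z : ℂ}
    (h : ∀ α β : ℤ, |α| ≤ n → |β| ≤ m →
      Φ (z + (α * η + β * (τ / 2))) = Ψ (z + (α * η + β * (τ / 2)))) :
    prodA τ η k s n (prodB τ η k s' m Φ) z = prodA τ η k s n (prodB τ η k s' m Ψ) z := by
  refine prodA_congr k s fun α hα => ?_
  rw [prodB_eq_prodA, prodB_eq_prodA]
  refine prodA_congr k s' fun β hβ => ?_
  rw [add_assoc]
  exact h α β hα hβ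

lemma factoredM_congr (k : ThetaIndex) {Φ Ψ : ℂ → ℂ} {n m : ℕ} {z : ℂ}
    (h : ∀ α β : ℤ, |α| ≤ n → |β| ≤ m →
      Φ (z + (α * η + β * (τ / 2))) = Ψ (z + (α * η + β * (τ / 2)))) :
    factoredM τ η k n m Φ z = factoredM τ η k n m Ψ z :=
  prodA_prodB_congr k _ _ fun α β hα hβ => by simp only [h α β hα hβ]

lemma factoredM_swap (k : ThetaIndex) (m : ℕ) (Φ : ℂ → ℂ) :
    factoredM (2 * η) (τ / 2) k m 0 Φ = factoredM τ η k 0 m Φ := by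
  simp only [factoredM, prodA, prodB, prodB_eq_prodA, Nat.cast_zero, zero_mul, pow_zero, inv_one,
    one_mul, mul_one, mul_div_cancel_left₀ η (two_ne_zero' ℂ)]

/-! ### Factorisation of the intertwining operator at lattice spins -/

/-- `factoredM` represents the intertwining operator at `nη + mτ/2` on even test functions. -/
def IsFactored (τ η : ℂ) (n m : ℕ) : Prop :=
  ∀ᶠ z in codiscrete ℂ, ∀ (k : ThetaIndex) (Φ : ℂ → ℂ), IsTestFunction Φ → (∀ x, Φ (-x) = Φ x) →
    intertwiner τ η (n * η + m * (τ / 2)) Φ z = factoredM τ η k n m Φ z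

lemma isFactored_zero (hτ : 0 < τ.im) (hη : 0 < η.im) : IsFactored τ η 0 0 := by
  filter_upwards [intertwiner_zero hτ hη] with z hz k Φ hΦ he
  simp only [Nat.cast_zero, zero_mul, add_zero]
  rw [hz Φ hΦ he]
  simp [factoredM, prodA, prodB]

/-- The recurrence M(g + η)θ_k = A_k(g)M(g) has to be applied to Φ/θ_k, which need not be entire. By
locality at both spins an even test function with the right values at finitely many points replaces
it. -/
lemma IsFactored.succ (hτ : 0 < τ.im) (hη : 0 < η.im) (hinc : Incommensurate τ η) {n m : ℕ}
    (h : IsFactored τ η n m) : IsFactored τ η (n + 1) m := by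
  have hreg := intertwiner_regular_and_local hτ hη (hinc.spinGeneric m n)
  have hth : ∀ᶠ z in codiscrete ℂ, ∀ k : ThetaIndex, ∀ α ∈ Finset.Icc (-(n + 1 : ℕ) : ℤ) (n + 1 : ℕ),
      ∀ β ∈ Finset.Icc (-m : ℤ) m, theta k (z + (α * η + β * (τ / 2))) (τ / 2) ≠ 0 := by
    have : ∀ k : ThetaIndex, ∀ᶠ z in codiscrete ℂ,
        ∀ α ∈ Finset.Icc (-(n + 1 : ℕ) : ℤ) (n + 1 : ℕ),
        ∀ β ∈ Finset.Icc (-m : ℤ) m, theta k (z + (α * η + β * (τ / 2))) (τ / 2) ≠ 0 := fun k => by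
      simp only [Filter.eventually_all_finset]
      intro α _ β _
      exact eventually_codiscrete_add (eventually_theta_ne_zero k (im_half_pos hτ)) _
    filter_upwards [this .three, this .four] with z h3 h4 k
    cases k
    · exact h3
    · exact h4
  filter_upwards [eventually_codiscrete_add h η, eventually_codiscrete_add h (-η),
    eventually_codiscrete_add hreg η, eventually_codiscrete_add hreg (-η),
    intertwiner_regular_and_local hτ hη (hinc.spinGeneric m (n + 1)), hth,
    eventually_theta1_two_mul_ne_zero hτ, exists_even_testFunction hinc (n + 1) m]
    with z v1 v2 r1 r2 r3 ht ht1 hint k Φ hΦ he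
  rw [← sub_eq_add_neg] at v2 r2
  -- Interpolate on the larger range |α| ≤ n + 1, which contains the points needed from the two
  -- neighbours z ± η.
  obtain ⟨Ψ, hΨ, hΨe, hΨv⟩ := hint fun x => (theta k x (τ / 2))⁻¹ * Φ x
  have hval : ∀ α β : ℤ, |α| ≤ (n + 1 : ℕ) → |β| ≤ m → Φ (z + (α * η + β * (τ / 2))) =
      theta k (z + (α * η + β * (τ / 2))) (τ / 2) * Ψ (z + (α * η + β * (τ / 2))) :=
    fun α β hα hβ => by
      rw [hΨv α β hα hβ, mul_inv_cancel_left₀ (ht k α (Finset.mem_Icc.2 (abs_le.1 hα)) β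
        (Finset.mem_Icc.2 (abs_le.1 hβ)))]
  have eg : ((n + 1 : ℕ) : ℂ) * η + m * (τ / 2) = n * η + m * (τ / 2) + η := by push_cast; ring
  have hθΨ := hΨ.theta_mul hτ k
  -- Locality at spin (n + 1)η + mτ/2 replaces Φ by θ_kΨ; all functions of g involved are analytic,
  -- so the recurrence holds at the point itself.
  rw [r3.2 Φ _ hΦ hθΨ he (fun x => by rw [theta_neg, hΨe]) hval, eg,
    intertwiner_add_eta_of_analyticAt hτ hη k hΨ ht1 (eg ▸ r3.1 _ hθΨ) (r1.1 Ψ hΨ) (r2.1 Ψ hΨ)]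
  rw [factoredM, prodA, add_comm (_ * (τ / 2))]
  refine opA_congr k _ ?_ ?_
  · rw [v1 k Ψ hΨ hΨe]
    refine prodA_prodB_congr k _ _ fun α β hα hβ => ?_
    have e : z + η + (α * η + β * (τ / 2)) = z + ((α + 1 : ℤ) * η + β * (τ / 2)) := by
      push_cast; ring
    rw [e, hΨv _ β (by rw [abs_le] at hα ⊢; push_cast; constructor <;> linarith) hβ, pow_succ,
      mul_inv]
    ring
  · rw [v2 k Ψ hΨ hΨe]
    refine prodA_prodB_congr k _ _ fun α β hα hβ => ?_
    have e : z - η + (α * η + β * (τ / 2)) = z + ((α - 1 : ℤ) * η + β * (τ / 2)) := by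
      push_cast; ring
    rw [e, hΨv _ β (by rw [abs_le] at hα ⊢; push_cast; constructor <;> linarith) hβ, pow_succ,
      mul_inv]
    ring

/-- The factors A_k stand outermost, so the induction on n starts from (0, m); that case is (m, 0)
with the two bases exchanged. -/
theorem isFactored (hτ : 0 < τ.im) (hη : 0 < η.im) (hinc : Incommensurate τ η) (n m : ℕ) :
    IsFactored τ η n m := by
  have h0 : ∀ {τ η : ℂ}, 0 < τ.im → 0 < η.im → Incommensurate τ η → ∀ n, IsFactored τ η n 0 :=
    fun hτ hη hinc n => by
      induction n with
      | zero => exact isFactored_zero hτ hη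
      | succ n ih => exact ih.succ hτ hη hinc
  induction n with
  | zero =>
    filter_upwards [h0 (im_two_mul_pos hη) (im_half_pos hτ) hinc.swap m] with z hz k Φ hΦ he
    have := hz k Φ hΦ he
    rw [intertwiner_swap hτ hη, factoredM_swap] at this
    rw [← this]
    simp
  | succ n ih => exact ih.succ hτ hη hinc

end

section
variable {τ η : ℂ}

/-! ### Shifts of the spin by one half -/

lemma opA_add_half (k : ThetaIndex) (g : ℂ) (Φ : ℂ → ℂ) :
    opA τ η k (g + 1 / 2) Φ = opA τ η k.swap g Φ := by
  funext z
  have e1 : z + (g + 1 / 2) + η = z + g + η + 1 / 2 := by ring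
  have e2 : z - (g + 1 / 2) - η = z - g - η - 1 / 2 := by ring
  rw [opA, opA, e1, e2, theta_add_half, theta_sub_half]

lemma opB_add_half (k : ThetaIndex) (g : ℂ) (Φ : ℂ → ℂ) :
    opB τ η k (g + 1 / 2) Φ = opB τ η k.swap g Φ := by
  rw [opB_eq_opA, opB_eq_opA, opA_add_half]

lemma prodA_add_half (k : ThetaIndex) (s : ℂ) (n : ℕ) (Φ : ℂ → ℂ) :
    prodA τ η k (s + 1 / 2) n Φ = prodA τ η k.swap s n Φ := by
  induction n with
  | zero => rfl
  | succ n ih => rw [prodA, prodA, ih, add_right_comm, opA_add_half]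

theorem factoredMHalf_eq (k : ThetaIndex) (n m : ℕ) (Φ : ℂ → ℂ) :
    factoredMHalf τ η k n m Φ = factoredM τ η k.swap n m (halfShift Φ) := by
  have h := prodA_add_half (τ := 2 * η) (η := τ / 2) k 0 m
  rw [zero_add] at h
  simp only [factoredMHalf, factoredM, prodB_eq_prodA, prodA_add_half, h, theta_add_half]

lemma analyticAt_intertwiner_add_half (hτ : 0 < τ.im) (hη : 0 < η.im) {Φ : ℂ → ℂ}
    (hΦ : IsTestFunction Φ) {g z : ℂ}
    (h : AnalyticAt ℂ (fun g => intertwiner τ η g (halfShift Φ) z) g) :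
    AnalyticAt ℂ (fun g => intertwiner τ η g Φ z) (g + 1 / 2) := by
  have e : (fun g => intertwiner τ η g Φ z) = fun g' =>
      (fun g => intertwiner τ η g (halfShift Φ) z) (g' - 1 / 2) := by
    funext g'
    simp only
    rw [← intertwiner_add_half hτ hη hΦ, sub_add_cancel]
  rw [e]
  refine AnalyticAt.comp (𝕜 := ℂ) (g := fun g => intertwiner τ η g (halfShift Φ) z)
    (f := fun g' : ℂ => g' - 1 / 2) ?_ (analyticAt_id.sub analyticAt_const)
  rwa [add_sub_cancel_right]

/-! ### Continuity in the parameters -/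

lemma continuousAt_theta (k : ThetaIndex) {z τ : ℂ} (hτ : 0 < τ.im) :
    ContinuousAt (fun p : ℂ × ℂ => theta k p.1 p.2) (z, τ) := by
  cases k
  · simp only [theta, theta3_eq]
    exact continuousAt_jacobiTheta₂ z hτ
  · simp only [theta, theta4_eq]
    exact ContinuousAt.comp (g := fun p : ℂ × ℂ => jacobiTheta₂ p.1 p.2) (x := (z, τ))
      (f := fun p : ℂ × ℂ => (p.1 + 1 / 2, p.2))
      (continuousAt_jacobiTheta₂ (z + 1 / 2) hτ) (by fun_prop)

lemma continuousAt_theta1 {z τ : ℂ} (hτ : 0 < τ.im) :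
    ContinuousAt (fun p : ℂ × ℂ => theta1 p.1 p.2) (z, τ) := by
  simp only [theta1_eq, ee]
  refine (ContinuousAt.mul (by fun_prop) ?_).neg
  exact ContinuousAt.comp (g := fun p : ℂ × ℂ => jacobiTheta₂ p.1 p.2) (x := (z, τ))
    (f := fun p : ℂ × ℂ => (p.1 + 1 / 2 + p.2 / 2, p.2))
    (continuousAt_jacobiTheta₂ (z + 1 / 2 + τ / 2) hτ) (by fun_prop)

lemma continuousAt_constR (hτ : 0 < τ.im) : ContinuousAt constR τ := by
  have hp := norm_ee_lt_one hτ
  have h1 : ContinuousAt (fun q : ℂ => qPoch q q) (ee τ) := by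
    have := (ModularForm.differentiableOn_tprod_one_sub_pow.differentiableAt
      (Metric.isOpen_ball.mem_nhds (mem_ball_zero_iff.2 hp))).continuousAt
    refine this.congr (Eventually.of_forall fun q => tprod_congr fun n => ?_)
    rw [pow_succ']
  have h2 : ContinuousAt (fun τ => qPoch (base τ) (base τ)) τ :=
    ContinuousAt.comp (f := base) h1 differentiable_ee.continuous.continuousAt
  unfold constR
  exact ContinuousAt.div (by fun_prop) (continuousAt_const.mul h2)
    (mul_ne_zero Complex.I_ne_zero (qPoch_self_ne_zero hp))

/-- Joint continuity of `A_k(g) Φ` in a parameter `t`, on which the periods, the spin and the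
function `Φ` may depend, and in `z`. -/
lemma continuousAt_opA (k : ThetaIndex) {T E g : ℂ → ℂ} {Φ : ℂ → ℂ → ℂ} {t z : ℂ}
    (hT : ContinuousAt T t) (hE : ContinuousAt E t) (hg : ContinuousAt g t)
    (hTi : 0 < (T t).im) (hEi : 0 < (E t).im) (hz : theta1 (2 * z) (T t) ≠ 0)
    (h1 : ContinuousAt (fun p : ℂ × ℂ => Φ p.1 p.2) (t, z + E t))
    (h2 : ContinuousAt (fun p : ℂ × ℂ => Φ p.1 p.2) (t, z - E t)) :
    ContinuousAt (fun p : ℂ × ℂ => opA (T p.1) (E p.1) k (g p.1) (Φ p.1) p.2) (t, z) := by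
  have hfst : ContinuousAt (Prod.fst : ℂ × ℂ → ℂ) (t, z) := continuousAt_fst
  have hsnd : ContinuousAt (Prod.snd : ℂ × ℂ → ℂ) (t, z) := continuousAt_snd
  have cT : ContinuousAt (fun p : ℂ × ℂ => T p.1) (t, z) := ContinuousAt.comp (g := T) hT hfst
  have cE : ContinuousAt (fun p : ℂ × ℂ => E p.1) (t, z) := ContinuousAt.comp (g := E) hE hfst
  have cg : ContinuousAt (fun p : ℂ × ℂ => g p.1) (t, z) := ContinuousAt.comp (g := g) hg hfst
  have hT2 : 0 < (T t / 2).im := im_half_pos hTi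
  have cthp : ContinuousAt (fun p : ℂ × ℂ => theta k (p.2 + (g p.1 + E p.1)) (T p.1 / 2)) (t, z) :=
    ContinuousAt.comp (f := fun p : ℂ × ℂ => (p.2 + (g p.1 + E p.1), T p.1 / 2))
      (continuousAt_theta k hT2) ((hsnd.add (cg.add cE)).prodMk (cT.div_const 2))
  have cthm : ContinuousAt (fun p : ℂ × ℂ => theta k (p.2 - (g p.1 + E p.1)) (T p.1 / 2)) (t, z) :=
    ContinuousAt.comp (f := fun p : ℂ × ℂ => (p.2 - (g p.1 + E p.1), T p.1 / 2))
      (continuousAt_theta k hT2) ((hsnd.sub (cg.add cE)).prodMk (cT.div_const 2))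
  have cth1 : ContinuousAt (fun p : ℂ × ℂ => theta1 (2 * p.2) (T p.1)) (t, z) :=
    ContinuousAt.comp (f := fun p : ℂ × ℂ => (2 * p.2, T p.1))
      (continuousAt_theta1 hTi) ((hsnd.const_mul 2).prodMk cT)
  have cR : ContinuousAt (fun p : ℂ × ℂ => constR (T p.1)) (t, z) :=
    ContinuousAt.comp (f := fun p : ℂ × ℂ => T p.1) (continuousAt_constR hTi) cT
  have cp : ContinuousAt (fun p : ℂ × ℂ => Φ p.1 (p.2 + E p.1)) (t, z) :=
    ContinuousAt.comp (g := fun p : ℂ × ℂ => Φ p.1 p.2)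
      (f := fun p : ℂ × ℂ => (p.1, p.2 + E p.1)) h1 (hfst.prodMk (hsnd.add cE))
  have cm : ContinuousAt (fun p : ℂ × ℂ => Φ p.1 (p.2 - E p.1)) (t, z) :=
    ContinuousAt.comp (g := fun p : ℂ × ℂ => Φ p.1 p.2)
      (f := fun p : ℂ × ℂ => (p.1, p.2 - E p.1)) h2 (hfst.prodMk (hsnd.sub cE))
  have cep : ContinuousAt (fun p : ℂ × ℂ => ee p.2) (t, z) :=
    ContinuousAt.comp (g := ee) differentiable_ee.continuous.continuousAt hsnd
  have cem : ContinuousAt (fun p : ℂ × ℂ => ee (-p.2)) (t, z) :=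
    ContinuousAt.comp (g := ee) (f := fun p : ℂ × ℂ => -p.2)
      differentiable_ee.continuous.continuousAt hsnd.neg
  refine ((((cthp.mul cem).mul cp).sub ((cthm.mul cep).mul cm)).div (cR.mul cth1)
    (mul_ne_zero (constR_ne_zero hTi) hz)).congr ?_
  -- The simplified form of A_k requires η ≠ 0, which persists near the point because Im η > 0 is an
  -- open condition.
  have hev : ∀ᶠ p : ℂ × ℂ in 𝓝 (t, z), 0 < (E p.1).im :=
    (Complex.continuous_im.continuousAt.comp cE).eventually (lt_mem_nhds hEi)
  filter_upwards [hev] with p hp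
  exact (opA_eq hp k _ _ _).symm

lemma continuousAt_prodA (k : ThetaIndex) {T E s : ℂ → ℂ} {Φ : ℂ → ℂ → ℂ} {t z : ℂ} {n : ℕ}
    (hT : ContinuousAt T t) (hE : ContinuousAt E t) (hs : ContinuousAt s t)
    (hTi : 0 < (T t).im) (hEi : 0 < (E t).im)
    (hz : ∀ α : ℤ, |α| ≤ n → theta1 (2 * (z + α * E t)) (T t) ≠ 0)
    (h : ∀ α : ℤ, |α| ≤ n → ContinuousAt (fun p : ℂ × ℂ => Φ p.1 p.2) (t, z + α * E t)) :
    ContinuousAt (fun p : ℂ × ℂ => prodA (T p.1) (E p.1) k (s p.1) n (Φ p.1) p.2) (t, z) := by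
  induction n generalizing z with
  | zero =>
    have := h 0 (by simp)
    simpa [prodA] using this
  | succ n ih =>
    have hp : ∀ α : ℤ, |α| ≤ n → z + E t + α * E t = z + (α + 1 : ℤ) * E t ∧
        |α + 1| ≤ (n + 1 : ℕ) := fun α hα => by
      refine ⟨by push_cast; ring, ?_⟩
      rw [abs_le] at hα ⊢
      push_cast
      constructor <;> linarith
    have hm : ∀ α : ℤ, |α| ≤ n → z - E t + α * E t = z + (α - 1 : ℤ) * E t ∧
        |α - 1| ≤ (n + 1 : ℕ) := fun α hα => by
      refine ⟨by push_cast; ring, ?_⟩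
      rw [abs_le] at hα ⊢
      push_cast
      constructor <;> linarith
    refine continuousAt_opA (Φ := fun t => prodA (T t) (E t) k (s t) n (Φ t))
      (g := fun t => s t + n * E t) k hT hE (hs.add (hE.const_mul _)) hTi hEi
      (by simpa using hz 0 (by simp; positivity)) (ih (fun α hα => ?_) fun α hα => ?_)
      (ih (fun α hα => ?_) fun α hα => ?_)
    · rw [(hp α hα).1]; exact hz _ (hp α hα).2
    · rw [(hp α hα).1]; exact h _ (hp α hα).2
    · rw [(hm α hα).1]; exact hz _ (hm α hα).2
    · rw [(hm α hα).1]; exact h _ (hm α hα).2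

/-- No denominator of the factored operators vanishes. -/
def FactoredRegular (τ η : ℂ) (n m : ℕ) (z : ℂ) : Prop :=
  ∀ α ∈ Finset.Icc (-n : ℤ) n, ∀ β ∈ Finset.Icc (-m : ℤ) m,
    theta1 (2 * (z + α * η)) τ ≠ 0 ∧
    theta1 (2 * (z + (α * η + β * (τ / 2)))) (2 * η) ≠ 0 ∧
    ∀ k, theta k (z + (α * η + β * (τ / 2))) η ≠ 0 ∧
      theta k (z + (α * η + β * (τ / 2))) (τ / 2) ≠ 0

lemma eventually_factoredRegular (hτ : 0 < τ.im) (hη : 0 < η.im) (n m : ℕ) :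
    ∀ᶠ z in codiscrete ℂ, FactoredRegular τ η n m z := by
  unfold FactoredRegular
  simp only [Filter.eventually_all_finset]
  intro α _ β _
  filter_upwards [eventually_codiscrete_add (eventually_theta1_two_mul_ne_zero hτ) (α * η),
    eventually_codiscrete_add (eventually_theta1_two_mul_ne_zero (im_two_mul_pos hη))
      (α * η + β * (τ / 2)),
    eventually_codiscrete_add (eventually_theta_ne_zero .three hη) (α * η + β * (τ / 2)),
    eventually_codiscrete_add (eventually_theta_ne_zero .four hη) (α * η + β * (τ / 2)),
    eventually_codiscrete_add (eventually_theta_ne_zero .three (im_half_pos hτ))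
      (α * η + β * (τ / 2)),
    eventually_codiscrete_add (eventually_theta_ne_zero .four (im_half_pos hτ))
      (α * η + β * (τ / 2))] with z h1 h2 h3 h4 h5 h6
  refine ⟨h1, h2, fun k => ?_⟩
  cases k
  · exact ⟨h3, h5⟩
  · exact ⟨h4, h6⟩

/-- Joint continuity of the factored operators in `η` and `z`. -/
lemma continuousAt_factoredM (hτ : 0 < τ.im) (hη : 0 < η.im) (k : ThetaIndex) {n m : ℕ} {z : ℂ}
    (hz : FactoredRegular τ η n m z) {Φ : ℂ → ℂ} (hΦ : Continuous Φ) :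
    ContinuousAt (fun p : ℂ × ℂ => factoredM τ p.1 k n m Φ p.2) (η, z) := by
  have hz' : ∀ α β : ℤ, |α| ≤ n → |β| ≤ m → _ := fun α β hα hβ =>
    hz α (Finset.mem_Icc.2 (abs_le.1 hα)) β (Finset.mem_Icc.2 (abs_le.1 hβ))
  simp only [factoredM, prodB_eq_prodA]
  refine continuousAt_prodA (T := fun _ => τ) (E := fun t => t) (s := fun _ => m * (τ / 2)) k
    (Φ := fun t => prodA (2 * t) (τ / 2) k 0 m fun z =>
      (theta k z t ^ m)⁻¹ * (theta k z (τ / 2) ^ n)⁻¹ * Φ z)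
    continuousAt_const continuousAt_id continuousAt_const hτ hη
    (fun α hα => (hz' α 0 hα (by simp)).1) fun α hα => ?_
  refine continuousAt_prodA (T := fun t => 2 * t) (E := fun _ => τ / 2) (s := fun _ => 0) k
    (Φ := fun t z => (theta k z t ^ m)⁻¹ * (theta k z (τ / 2) ^ n)⁻¹ * Φ z)
    (by fun_prop) continuousAt_const continuousAt_const (im_two_mul_pos hη) (im_half_pos hτ)
    (fun β hβ => by rw [add_assoc]; exact (hz' α β hα hβ).2.1) fun β hβ => ?_
  obtain ⟨-, -, h⟩ := hz' α β hα hβ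
  rw [add_assoc]
  refine ContinuousAt.mul (ContinuousAt.mul (ContinuousAt.inv₀ (ContinuousAt.pow ?_ m)
    (pow_ne_zero m (h k).1)) (ContinuousAt.inv₀ (ContinuousAt.pow ?_ n)
    (pow_ne_zero n (h k).2))) (hΦ.continuousAt.comp continuousAt_snd)
  · exact ContinuousAt.comp (g := fun p : ℂ × ℂ => theta k p.1 p.2) (f := Prod.swap)
      (continuousAt_theta k hη) continuous_swap.continuousAt
  · exact (differentiable_theta k (im_half_pos hτ)).continuous.continuousAt.comp continuousAt_snd

/-! ### Independence of `k` -/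

/-- As Im τ > 0, a relation with b = 0 forces c = 0; every other integral relation determines η. -/
lemma countable_not_incommensurate (hτ : 0 < τ.im) : {η | ¬Incommensurate τ η}.Countable := by
  refine (Set.countable_range fun abc : ℤ × ℤ × ℤ =>
    -((abc.1 : ℂ) + abc.2.2 * τ) / (2 * abc.2.1)).mono fun η hη => ?_
  simp only [Set.mem_ofPred_eq, Incommensurate, not_forall] at hη
  obtain ⟨a, b, c, h, hbc⟩ := hη
  have hb : b ≠ 0 := by
    rintro rfl
    have him := congrArg Complex.im h
    simp at him
    exact hbc ⟨rfl, him.resolve_right hτ.ne'⟩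
  have hb' : (b : ℂ) ≠ 0 := Int.cast_ne_zero.2 hb
  refine ⟨(a, b, c), ?_⟩
  simp only
  rw [div_eq_iff (by simpa using hb)]
  linear_combination -h

/-- Both operators represent M on even test functions, and each sees only finitely many values of
its argument, so an arbitrary Φ may be replaced by an even interpolant. -/
lemma factoredM_eq_of_incommensurate (hτ : 0 < τ.im) (hη : 0 < η.im) (hinc : Incommensurate τ η)
    (k k' : ThetaIndex) (n m : ℕ) :
    ∀ᶠ z in codiscrete ℂ, ∀ Φ : ℂ → ℂ, factoredM τ η k n m Φ z = factoredM τ η k' n m Φ z := by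
  filter_upwards [isFactored hτ hη hinc n m, exists_even_testFunction hinc n m] with z h1 h2 Φ
  obtain ⟨Ψ, hΨ, he, hv⟩ := h2 Φ
  rw [factoredM_congr k fun α β hα hβ => (hv α β hα hβ).symm,
    factoredM_congr k' fun α β hα hβ => (hv α β hα hβ).symm, ← h1 k Ψ hΨ he, ← h1 k' Ψ hΨ he]

/-- A continuous function with prescribed values at the points of a finite set. -/
lemma exists_continuous_eqOn_finset (S : Finset ℂ) (v : ℂ → ℂ) :
    ∃ Φ : ℂ → ℂ, Continuous Φ ∧ ∀ x ∈ S, Φ x = v x :=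
  ⟨_, (Lagrange.interpolate S id v).continuous, fun _ hx =>
    Lagrange.eval_interpolate_at_node v (Set.injOn_id _) hx⟩

/-- Incommensurate η are dense and both sides are jointly continuous in (η, z). An arbitrary Φ is
first replaced by a fixed polynomial with the same values at the lattice points of the given (η, z),
so that the argument stays continuous while η moves. -/
theorem factoredM_eq (hτ : 0 < τ.im) (hη : 0 < η.im) (k k' : ThetaIndex) (n m : ℕ) {z : ℂ}
    (hz : FactoredRegular τ η n m z) (Φ : ℂ → ℂ) :
    factoredM τ η k n m Φ z = factoredM τ η k' n m Φ z := by
  obtain ⟨Ψ, hΨ, hv⟩ := exists_continuous_eqOn_finset ((Finset.Icc (-n : ℤ) n ×ˢ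
    Finset.Icc (-m : ℤ) m).image fun ab => z + (ab.1 * η + ab.2 * (τ / 2))) Φ
  have hv' : ∀ α β : ℤ, |α| ≤ n → |β| ≤ m → Φ (z + (α * η + β * (τ / 2))) =
      Ψ (z + (α * η + β * (τ / 2))) := fun α β hα hβ =>
    (hv _ (Finset.mem_image.2 ⟨(α, β), Finset.mem_product.2 ⟨Finset.mem_Icc.2 (abs_le.1 hα),
      Finset.mem_Icc.2 (abs_le.1 hβ)⟩, rfl⟩)).symm
  rw [factoredM_congr k hv', factoredM_congr k' hv']
  refine tendsto_nhds_unique_of_frequently_eq (continuousAt_factoredM hτ hη k hz hΨ)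
    (continuousAt_factoredM hτ hη k' hz hΨ) ?_
  rw [nhds_prod_eq, Filter.frequently_iff]
  intro U hU
  obtain ⟨V, hV, W, hW, hVW⟩ := Filter.mem_prod_iff.1 hU
  have hdense : Dense {η | Incommensurate τ η} := by
    have := (countable_not_incommensurate hτ).dense_compl ℂ
    simpa [Set.compl_ofPred] using this
  -- The exceptional set of z depends on η', so η' is chosen first and z' afterwards.
  obtain ⟨η', ⟨hη'V, hη'⟩, hinc⟩ := mem_closure_iff_nhds.1 (hdense η) _
    (Filter.inter_mem hV ((isOpen_lt continuous_const Complex.continuous_im).mem_nhds hη))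
  have h := eventually_codiscrete_iff.1 (factoredM_eq_of_incommensurate hτ hη' hinc k k' n m) z
  obtain ⟨z', hz', hz'W⟩ := (h.and (mem_nhdsWithin_of_mem_nhds hW)).exists
  exact ⟨(η', z'), hVW ⟨hη'V, hz'W⟩, hz' Ψ⟩

end

end EllipticDouble

end

/-! ### The main theorem -/

theorem mainTheorem7 (τ η : ℂ) (hτ : 0 < τ.im) (hη : 0 < η.im) :
    -- for every test function and every `z` the continuation in `g` exists and is unique
    (∀ Φ : ℂ → ℂ, IsTestFunction Φ → ∀ z : ℂ, ∃! F : ℂ → ℂ, IsSpinContinuation τ η Φ z F) ∧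
    -- `M(1/2) = P` on even test functions
    (∀ Φ : ℂ → ℂ, IsTestFunction Φ → (∀ x, Φ (-x) = Φ x) →
      ∀ᶠ z in Filter.codiscrete ℂ,
        AnalyticAt ℂ (fun g => intertwiner τ η g Φ z) (1 / 2) ∧
        intertwiner τ η (1 / 2) Φ z = halfShift Φ z) ∧
    -- the swaps of `A_3, A_4` and of `B_3, B_4`
    (∀ (k : ThetaIndex) (g : ℂ) (Φ : ℂ → ℂ),
      opA τ η k (g + 1 / 2) Φ = opA τ η k.swap g Φ ∧
      opB τ η k (g + 1 / 2) Φ = opB τ η k.swap g Φ) ∧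
    ∀ n m : ℕ,
      -- `M(nη + mτ/2 + 1/2) = M(nη + mτ/2) P` for the intertwining operator
      (∀ Φ : ℂ → ℂ, IsTestFunction Φ → ∀ z : ℂ,
        intertwiner τ η (n * η + m * (τ / 2) + 1 / 2) Φ z =
          intertwiner τ η (n * η + m * (τ / 2)) (halfShift Φ) z) ∧
      -- `M^{(3,4)}(nη + mτ/2 + 1/2) = M^{(4,3)}(nη + mτ/2) P`
      (∀ (k : ThetaIndex) (Φ : ℂ → ℂ),
        factoredMHalf τ η k n m Φ = factoredM τ η k.swap n m (halfShift Φ)) ∧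
      -- independence of `k`
      (∀ (k : ThetaIndex) (Φ : ℂ → ℂ),
        factoredMHalf τ η k n m Φ =ᶠ[Filter.codiscrete ℂ] factoredM τ η k n m (halfShift Φ)) ∧
      -- for incommensurate `1, 2η, τ`: `M(g)` is regular at both lattice points and equals
      -- the factored difference operators there
      (LinearIndependent ℚ ![(1 : ℂ), 2 * η, τ] →
        ∀ Φ : ℂ → ℂ, IsTestFunction Φ →
          ∀ᶠ z in Filter.codiscrete ℂ,
            AnalyticAt ℂ (fun g => intertwiner τ η g Φ z) (n * η + m * (τ / 2)) ∧
            AnalyticAt ℂ (fun g => intertwiner τ η g Φ z) (n * η + m * (τ / 2) + 1 / 2) ∧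
            ((∀ x, Φ (-x) = Φ x) → ∀ k : ThetaIndex,
              intertwiner τ η (n * η + m * (τ / 2)) Φ z = factoredM τ η k n m Φ z ∧
              intertwiner τ η (n * η + m * (τ / 2) + 1 / 2) Φ z =
                factoredMHalf τ η k n m Φ z)) := by
  refine ⟨fun Φ hΦ z => ?_, fun Φ hΦ he => ?_, fun k g Φ => ⟨opA_add_half k g Φ,
    opB_add_half k g Φ⟩, fun n m => ⟨fun Φ hΦ z => intertwiner_add_half hτ hη hΦ _ z,
    fun k Φ => factoredMHalf_eq k n m Φ, fun k Φ => ?_, fun hind Φ hΦ => ?_⟩⟩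
  · exact ⟨_, isSpinContinuation_intertwiner hτ hη hΦ z, fun F hF =>
      hF.unique hτ hη (isSpinContinuation_intertwiner hτ hη hΦ z)⟩
  -- M(1/2)Φ = M(0)PΦ, and PΦ is again even because Φ is even with period 1, so the zero-spin
  -- results apply to it.
  · filter_upwards [intertwiner_zero hτ hη,
      intertwiner_regular_and_local hτ hη (spinGeneric_zero hτ hη)] with z h1 h2
    have h3 := analyticAt_intertwiner_add_half hτ hη hΦ (h2.1 _ hΦ.halfShift)
    have h4 := intertwiner_add_half hτ hη hΦ 0 z
    rw [h1 _ hΦ.halfShift (halfShift_even hΦ he)] at h4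
    simp only [Nat.cast_zero, zero_mul, zero_add] at h3 h4
    exact ⟨h3, h4⟩
  · filter_upwards [eventually_factoredRegular hτ hη n m] with z hz
    rw [factoredMHalf_eq]
    exact factoredM_eq hτ hη _ _ n m hz _
  · have hinc := incommensurate_of_linearIndependent hind
    filter_upwards [intertwiner_regular_and_local hτ hη (hinc.spinGeneric m n),
      isFactored hτ hη hinc n m] with z h1 h2
    refine ⟨h1.1 Φ hΦ, analyticAt_intertwiner_add_half hτ hη hΦ (h1.1 _ hΦ.halfShift),
      fun he k => ⟨h2 k Φ hΦ he, ?_⟩⟩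
    rw [intertwiner_add_half hτ hη hΦ, factoredMHalf_eq]
    exact h2 k.swap _ hΦ.halfShift (halfShift_even hΦ he)
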